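/- **Conventions.** A *framed triangulated polygon* is a triangulated convex $(s+1)$-gon ($s\ge 2$) with vertices $P_0,\dots,P_s$ in counterclockwise order, where $P_0$ is called the hidden vertex. The index $b_i$ of $P_i$ is one plus the number of diagonals at $P_i$; we write $[b_1,\dots,b_s\mid b_0]$ for the polygon. It is an *accordion triangulation* if $s\ge3$ and its diagonals can be listed as $\ell_0,\dots,\ell_{s-3}$ so that $\ell_0$ cuts off a triangle with two polygon sides and each next $\ell_{J+1}$ cuts off, from the polygon that remains after removing the previous triangles, a triangle having $\ell_J$ as a side. The *weights* $x_1,\dots,x_n$ are the entries greater than $2$ of $(b_1,\dots,b_s,b_0)$, in this order; $y_i$ is the number of vertices strictly between $x_i$ and $x_{i+1}$ on the boundary of the polygon, counterclockwise (between $x_n$ and $x_1$ for $i=n$). The *coherent graph* is the cycle $([x_1,\dots,x_{n-1}\mid x_n],(y_1,\dots,y_n))$. Indices of $x$, $y$, $k$ are taken modulo $n$. The diagonals from $x_i$ *go to the pair* $(x_j,x_{j+1})$ if they are exactly the diagonals joining $x_i$ to the vertices of the closed boundary arc running counterclockwise from $x_j$ to $x_{j+1}$. The frame is *standard* if the hidden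 vertex is a weight (hence $x_n$) whose diagonals go to $(x_n,x_1)$ or to $(x_{n-1},x_n)$, and $b_1=1$. For integers $x_1,\dots,x_n\ge 3$ and $0\le m\le n-1$, $\mathscr P^m_{x_1,\dots,x_n}$ denotes the framed accordion triangulation with weights $x_1,\dots,x_n$ and hidden index $x_n$ whose diagonals from $x_n$ go to $(x_m,x_{m+1})$. For coprime $0<q<\Delta$ let $\frac{\Delta}{\Delta-q}=[k_1,\dots,k_s]$, $k_i\ge2$, be the Hirzebruch–Jung continued fraction. A *WW-decomposition* of it is a zero continued fraction $[b_1,\dots,b_s]=0$ obtained from $[k_1,\dots,k_s]$ by subtracting $1$ at two distinct positions; its hidden index is $3(s-1)-\sum b_i$. The singularity $\frac1\Delta(1,q)$ is a *basic wormhole singularity* if there are at least two different WW-decompositions and their (common) hidden index is greater than $1$. A framed triangulated polygon is a *basic wormhole triangulation* if $[b_1,\dots,b_s]$ is a WW-decomposition for some basic wormhole singularity; a *companion* of it is a framed triangulated polygon representing a different WW-decomposition for the same basic wormhole singularity. **Theorem.** Let $n\ge 2$. For $0\le m\le n-1$ define $k^{(m)}_i\in\{1,3\}$ ($i$ modulo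 $n$) by: if $n$ is odd, $k^{(m)}_i=1$ exactly for $i\equiv \frac{n-1}2+\lceil\frac m2\rceil$ and $i\equiv n+\lfloor\frac m2\rfloor$; if $n$ is even, $k^{(m)}_i=1$ exactly for $i\equiv \frac n2+\lfloor\frac m2\rfloor$ and $i\equiv n+\lfloor\frac m2\rfloor \pmod n$. Let $S_m$ be the system $$S_m:\quad y_i=x_{(n-i)+m}-k^{(m)}_i,\qquad 1\le i\le n .$$ 1. For all integers $x_1,\dots,x_n\ge3$ and $0\le m\le n-1$ there is exactly one triangulation $\mathscr P^m_{x_1,\dots,x_n}$, and its coherent graph satisfies $S_m$. 2. Let $\mathscr P$ be an accordion triangulation with a standard frame, with $n$ weights, and with coherent graph $([x_1,\dots,x_{n-1}\mid x_n],(y_1,\dots,y_n))$. Then $\mathscr P=\mathscr P^0_{x_1,\dots,x_n}$, and $\mathscr P$ is a basic wormhole triangulation if and only if for some $1\le m\le n-1$ the numbers $x_i,y_i$ satisfy the $2n$ equations $S_0\cup S_m$. 3. Let $1\le m\le n-1$. The system $S_0\cup S_m$ in the integer unknowns $x_1,\dots,x_n,y_1,\dots,y_n$ is inconsistent if and only if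 - ($n$ even) $\gcd(n,m)\nmid n-\lfloor\frac m2\rfloor$ and $\gcd(n,m)\nmid\frac n2-\lfloor\frac m2\rfloor$; - ($n$ odd) $\gcd(n,m)\nmid n-\lceil\frac m2\rceil$ and $\gcd(n,m)\nmid\frac{n-1}2-\lfloor\frac m2\rfloor$. 4. Let $1\le m\le n-1$ and suppose that $S_0\cup S_m$ is consistent. Then the values $x_1,\dots,x_{\gcd(n,m)}\in\mathbb Z$ can be prescribed arbitrarily and determine the solution uniquely; moreover, $(x,y)$ is a solution if and only if it satisfies $S_0$ and $$x_{i+jm}=x_i-\sum_{l=0}^{j-1}\bigl(k^{(0)}_{n-(i+lm)}-k^{(m)}_{n-(i+lm)}\bigr)\qquad\text{for } 1\le i\le\gcd(n,m),\ 1\le j\le \tfrac{n}{\gcd(n,m)} .$$ 5. Let $1\le m\le n-1$ and let $(x,y)$ be an integer solution of $S_0\cup S_m$ with $x_i\ge3$ for all $i$. Then $\mathscr P^0_{x_1,\dots,x_n}$ (whose frame is standard) and $\mathscr P^m_{x_1,\dots,x_n}$ both have the coherent graph $([x_1,\dots,x_{n-1}\mid x_n],(y_1,\dots,y_n))$, both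 are basic wormhole triangulations, and they are companions of each other. -/

import Mathlib

/-! ### Hirzebruch-Jung continued fractions and wormhole singularities -/

/-- The value `e₁ - 1/(e₂ - 1/(… - 1/e_r))`. -/
def hjValue : List ℕ → ℚ
  | [] => 0
  | [e] => e
  | e :: f :: l => e - 1 / hjValue (f :: l)

/-- The positive integers `e₁, …, e_r` admit a Hirzebruch-Jung continued fraction: all the proper
tails `[e_i, …, e_r]`, `i ≥ 2`, have positive value and the whole fraction has value `≥ 0`. -/
def AdmitsHJ (l : List ℕ) : Prop :=
  l ≠ [] ∧ (∀ e ∈ l, 0 < e) ∧ (∀ t, t <:+ l.tail → t ≠ [] → 0 < hjValue t) ∧ 0 ≤ hjValue l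

/-- A zero continued fraction. -/
def IsZeroFraction (l : List ℕ) : Prop := AdmitsHJ l ∧ hjValue l = 0

/-- `c` is a WW-decomposition of `[k₁, …, k_s]`, where all `k_i > 1`: it is a zero continued fraction
obtained by subtracting `1` from the entries at two distinct positions `α < β`. -/
def IsWWDecomposition (k c : List ℕ) : Prop :=
  (∀ e ∈ k, 1 < e) ∧
    (∃ α β, α < β ∧ β < k.length ∧ c = (k.modify α (fun e => e - 1)).modify β (fun e => e - 1)) ∧
    IsZeroFraction c

/-- The hidden index `b₀ = 3(s-1) - (b₁ + ⋯ + b_s)` of a zero continued fraction. -/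
def hiddenIndex (c : List ℕ) : ℤ := 3 * ((c.length : ℤ) - 1) - (c.sum : ℤ)

/-- `k` is the dual chain of the cyclic quotient singularity `1/Δ (1,q)`:
the Hirzebruch-Jung continued fraction of `Δ/(Δ-q)` with entries at least `2`. -/
def IsDualChain (Δ q : ℕ) (k : List ℕ) : Prop :=
  AdmitsHJ k ∧ (∀ e ∈ k, 2 ≤ e) ∧ hjValue k = (Δ : ℚ) / ((Δ : ℚ) - (q : ℚ))

/-- The cyclic quotient singularity `1/Δ (1,q)` is a wormhole singularity: the continued fraction of
`Δ/(Δ-q)` has at least two different WW-decompositions. -/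
def IsWormholeSingularity (Δ q : ℕ) : Prop :=
  0 < q ∧ q < Δ ∧ Nat.Coprime q Δ ∧
    ∃ k, IsDualChain Δ q k ∧
      ∃ c₁ c₂, c₁ ≠ c₂ ∧ IsWWDecomposition k c₁ ∧ IsWWDecomposition k c₂

/-- A basic wormhole singularity: a wormhole singularity for which the WW-index of the dual chain
(the hidden index of any of its WW-decompositions) is greater than `1`. -/
def IsBasicWormholeSingularity (Δ q : ℕ) : Prop :=
  IsWormholeSingularity Δ q ∧
    ∀ k c, IsDualChain Δ q k → IsWWDecomposition k c → 1 < hiddenIndex c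

/-! ### Framed triangulated polygons -/

/-- For four vertices of the convex polygon with vertices `0, 1, …, s` (in cyclic order), the chords
`ab` and `cd` cross in the interior of the polygon: one of `c, d` lies strictly between `a` and `b`,
and the other one strictly outside. -/
def ChordsCross {s : ℕ} (a b c d : ZMod (s + 1)) : Prop :=
  (min a.val b.val < c.val ∧ c.val < max a.val b.val ∧
      (d.val < min a.val b.val ∨ max a.val b.val < d.val)) ∨
    (min a.val b.val < d.val ∧ d.val < max a.val b.val ∧
      (c.val < min a.val b.val ∨ max a.val b.val < c.val))

/-- A framed triangulated `(s+1)`-gon, `s ≥ 2`. The vertices are `P₀, …, P_s` in counterclockwise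
order, labelled by `ZMod (s+1)` in such a way that the hidden vertex is `P₀`. The triangulation is a
maximal set of pairwise non-crossing diagonals. -/
structure FramedPolygon where
  s : ℕ
  two_le : 2 ≤ s
  /-- `diag.Adj u v`: the diagonal from `u` to `v` is drawn. -/
  diag : SimpleGraph (ZMod (s + 1))
  not_side : ∀ u v, diag.Adj u v → v ≠ u + 1 ∧ u ≠ v + 1
  noncrossing : ∀ a b c d, diag.Adj a b → diag.Adj c d → ¬ ChordsCross a b c d
  maximal : ∀ a b, a ≠ b → b ≠ a + 1 → a ≠ b + 1 →
    (∀ c d, diag.Adj c d → ¬ ChordsCross a b c d) → diag.Adj a b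

namespace FramedPolygon

/-- The index of a vertex: the number of diagonals from the vertex, plus one. -/
noncomputable def index (P : FramedPolygon) (v : ZMod (P.s + 1)) : ℕ :=
  (P.diag.neighborSet v).ncard + 1

/-- The entries `b₁, …, b_s` of the extended zero chain `[b₁, …, b_s ∣ b₀]` of `P`. -/
noncomputable def chain (P : FramedPolygon) : List ℕ :=
  (List.range P.s).map fun i => P.index ((i + 1 : ℕ) : ZMod (P.s + 1))

/-- `P` represents a WW-decomposition of the dual fraction of the singularity `1/Δ (1,q)`. -/
def Represents (P : FramedPolygon) (Δ q : ℕ) : Prop :=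
  ∃ k, IsDualChain Δ q k ∧ IsWWDecomposition k P.chain

/-- A basic wormhole triangulation: it represents one of the WW-decompositions of the dual fraction
of a basic wormhole singularity. -/
def IsBasicWormhole (P : FramedPolygon) : Prop :=
  ∃ Δ q, IsBasicWormholeSingularity Δ q ∧ P.Represents Δ q

/-- `Q` is a companion of `P`: both represent WW-decompositions of the dual fraction of the same
basic wormhole singularity, and these WW-decompositions are different. -/
def IsCompanion (P Q : FramedPolygon) : Prop :=
  ∃ Δ q, IsBasicWormholeSingularity Δ q ∧ P.Represents Δ q ∧ Q.Represents Δ q ∧ Q.chain ≠ P.chain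

/-- Accordion triangulations. There is a base vertex `a` such that the diagonals of `P` are
`ℓ_J = {L J, R J}`, `0 ≤ J ≤ s - 3`, where `ℓ₀` joins `a` to `a + 2` and each `ℓ_{J+1}` cuts off one
more triangle next to `ℓ_J` in the remaining polygon (whose vertices are `R J, R J + 1, …, L J`):
it joins `L J` to the neighbour `R J + 1` of `R J`, or `R J` to the neighbour `L J - 1` of `L J`.
This does not depend on the frame. -/
def IsAccordion (P : FramedPolygon) : Prop :=
  3 ≤ P.s ∧ ∃ (a : ZMod (P.s + 1)) (L R : ℕ → ZMod (P.s + 1)),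
    L 0 = a ∧ R 0 = a + 2 ∧
    (∀ J, J + 1 + 3 ≤ P.s →
      (L (J + 1) = L J ∧ R (J + 1) = R J + 1) ∨ (L (J + 1) = L J - 1 ∧ R (J + 1) = R J)) ∧
    ∀ u v, P.diag.Adj u v ↔
      ∃ J, J + 3 ≤ P.s ∧ ((u = L J ∧ v = R J) ∨ (u = R J ∧ v = L J))

/-! ### Weights and the coherent graph -/

/-- The positions `j ∈ {1, …, s+1}` of the entries greater than `2` in the vector
`(b₁, …, b_s, b₀)`, in increasing order; position `s + 1` is the hidden vertex. -/
noncomputable def weightPositions (P : FramedPolygon) : List ℕ :=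
  (List.range' 1 (P.s + 1)).filter fun j => 2 < P.index (j : ZMod (P.s + 1))

/-- The number of weights. -/
noncomputable def numWeights (P : FramedPolygon) : ℕ := P.weightPositions.length

/-- The position `j_i` of the `i`-th weight, `1 ≤ i ≤ n`. -/
noncomputable def pos (P : FramedPolygon) (i : ℕ) : ℕ := P.weightPositions.getD (i - 1) 0

/-- The `i`-th weight `x_i`, `1 ≤ i ≤ n`. -/
noncomputable def weight (P : FramedPolygon) (i : ℕ) : ℕ := P.index (P.pos i : ZMod (P.s + 1))

/-- The label `y_i`, `1 ≤ i ≤ n`, of the edge of the coherent graph from `x_i` to `x_{i+1}`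
(from `x_n` to `x₁` for `i = n`). -/
noncomputable def gap (P : FramedPolygon) (i : ℕ) : ℤ :=
  if i < P.numWeights then (P.pos (i + 1) : ℤ) - (P.pos i : ℤ) - 1
  else ((P.s : ℤ) + 1) - (P.numWeights : ℤ) -
    ∑ l ∈ Finset.Ico 1 P.numWeights, ((P.pos (l + 1) : ℤ) - (P.pos l : ℤ) - 1)

end FramedPolygon

/-- The representative in `{1, …, n}` of a residue modulo `n ≥ 1`. -/
def residueRep (n : ℕ) (i : ZMod n) : ℕ := if i.val = 0 then n else i.val

namespace FramedPolygon

/-- `P` has exactly the weights `x₁, …, x_n`, in this order (`x_n` is `x 0`). -/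
def HasWeights (P : FramedPolygon) (n : ℕ) (x : ZMod n → ℤ) : Prop :=
  P.numWeights = n ∧ ∀ i, x i = (P.weight (residueRep n i) : ℤ)

/-- The coherent graph of `P` is `([x₁, …, x_{n-1} ∣ x_n], (y₁, …, y_n))`. -/
def HasCoherentGraph (P : FramedPolygon) (n : ℕ) (x y : ZMod n → ℤ) : Prop :=
  P.HasWeights n x ∧ ∀ i, y i = P.gap (residueRep n i)

/-- For `P` with `n` weights: the diagonals from the weight `x_i` go to the pair `(x_j, x_{j+1})`,
that is, they are the diagonals which join `x_i` to the vertices on the boundary arc that runs in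
counterclockwise direction from `x_j` to `x_{j+1}` (end points included). The vertex `x_i` itself
and its two neighbours on the polygon are not joined to it by a diagonal. -/
def DiagonalsGoTo (P : FramedPolygon) (n : ℕ) (i j : ZMod n) : Prop :=
  ∀ v : ZMod (P.s + 1),
    P.diag.Adj (P.pos (residueRep n i) : ZMod (P.s + 1)) v ↔
      (v ≠ (P.pos (residueRep n i) : ZMod (P.s + 1)) ∧
        v ≠ (P.pos (residueRep n i) : ZMod (P.s + 1)) + 1 ∧
        v ≠ (P.pos (residueRep n i) : ZMod (P.s + 1)) - 1 ∧
        ∃ t : ℕ, (t : ℤ) ≤ P.gap (residueRep n j) + 1 ∧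
          v = ((P.pos (residueRep n j) + t : ℕ) : ZMod (P.s + 1)))

/-- The weight `x_i` is of type (I): its diagonals go to `(x_i, x_{i+1})` or to `(x_{i-1}, x_i)`. -/
def IsTypeI (P : FramedPolygon) (n : ℕ) (i : ZMod n) : Prop :=
  P.DiagonalsGoTo n i i ∨ P.DiagonalsGoTo n i (i - 1)

/-- The frame of `P` is a standard frame: the hidden vertex is a weight (hence the last weight `x_n`)
of type (I), and the first entry of the extended zero chain is `1`. -/
def HasStandardFrame (P : FramedPolygon) : Prop :=
  2 < P.index 0 ∧ P.IsTypeI P.numWeights 0 ∧ P.index 1 = 1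

/-- `P` is the framed accordion triangulation `𝒫^m_{x₁,…,x_n}`: the accordion triangulation with
weights `x₁, …, x_n` and hidden index `x_n` whose diagonals from `x_n` go to `(x_m, x_{m+1})`. -/
def IsRotation (P : FramedPolygon) (n m : ℕ) (x : ZMod n → ℤ) : Prop :=
  P.IsAccordion ∧ 2 < P.index 0 ∧ P.HasWeights n x ∧ P.DiagonalsGoTo n 0 (m : ZMod n)

end FramedPolygon

/-! ### The linear systems -/

/-- The constants `k_i^{(m)}`; the index `i` is taken modulo `n`. -/
def kConst (n m : ℕ) (i : ZMod n) : ℤ :=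
  if Even n then
    if i = ((n / 2 + m / 2 : ℕ) : ZMod n) ∨ i = ((n + m / 2 : ℕ) : ZMod n) then 1 else 3
  else
    if i = (((n - 1) / 2 + (m + 1) / 2 : ℕ) : ZMod n) ∨ i = ((n + m / 2 : ℕ) : ZMod n) then 1 else 3

/-- The system `S_m` : `y_i = x_{(n-i)+m} - k_i^{(m)}` for all `i` modulo `n`. -/
def SystemS (n m : ℕ) (x y : ZMod n → ℤ) : Prop :=
  ∀ i : ZMod n, y i = x ((n : ZMod n) - i + (m : ZMod n)) - kConst n m i

/-- The system `S₀ ∪ S_m` of `2n` linear equations in the unknown integers `x₁, …, x_n` and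
`y₁, …, y_n` is consistent. -/
def Consistent (n m : ℕ) : Prop :=
  ∃ x y : ZMod n → ℤ, SystemS n 0 x y ∧ SystemS n m x y

/-- The numbers `v_i = k^{(0)}_{n-i} - k^{(m)}_{n-i}`, with indices modulo `n`. -/
def vConst (n m : ℕ) (i : ZMod n) : ℤ :=
  kConst n 0 ((n : ZMod n) - i) - kConst n m ((n : ZMod n) - i)

/-! Geometry. An accordion triangulation is a strip: its diagonals `ℓ_0, …, ℓ_M`, `M = s - 3`, run
from one ear to the other, and each step moves one of the two endpoints along its side. So it is
encoded by a lattice path (`IsPath`, `IsStrip`). Diagonals with a common endpoint form a fan, and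
the weights are the centres of the fans with at least two diagonals. A vertex strictly inside the
far side of a fan carries one diagonal, so the far ends of the fan at `x_i` fill an arc between
consecutive weights `x_j`, `x_{j+1}`. Counting diagonals gives `y_j = x_i - 3`, or `y_j = x_i - 1`
if `x_i` itself bounds that arc.

At a turn of the strip the old and the new centre bound each other's arcs, which forces `i + j` to
be the same for both fans. Hence a single reflection `j = m - i` describes all fans
(`exists_fan_center`), and the hidden vertex, `i = 0`, shows the value of `m`. Since `k^{(m)}_j = 1`
holds exactly if `x_{m-j}` bounds the arc `j` (`kConst_eq_ite`), this is the system `S_m`. The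
weights and `m` then determine all arcs and all diagonals (`IsRotation.eq`). Conversely the
reflection dictates the order in which the centres occur along the strip (`fanIndex`), and the
lattice path with runs of lengths `x - 2` in this order realizes `𝒫^m_x` (`exists_isRotation`).

Wormholes. Zero continued fractions are studied through continuants and through the removal of ears,
`[…, a + 1, 1, b + 1, …] ↦ […, a, b, …]`, which preserves the hidden index away from the ends of the
chain. A zero chain with a single entry `1` has hidden index `1`; one with exactly two entries `1`
and hidden index at least `2` comes from an accordion (`dualChains_of_isZeroChain`). So a
WW-decomposition with hidden index at least `2` lowers two entries `2` to `1`, and the dual chain is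
recovered by turning every `1` back into `2`. For a hidden vertex that is a weight, the dual chain
with the hidden index carries the same information as the coherent graph. Companions of `𝒫^0_x` are
therefore the accordions `𝒫^m_x`, `m ≠ 0`, with the same coherent graph, and they exist iff `S_0 ∪
S_m` holds for some such `m`.

Linear algebra. `S_0` expresses `y` through `x`; what remains of `S_m` is a difference equation `x
(r + m) - x r = f r` on `ZMod n`. It is solvable iff `f` sums to zero over each class modulo `gcd n
m`, and its solutions form a torsor under the functions of the residue modulo `gcd n m`. Here `f` is
twice a difference of two pairs of point masses, so solvability means that two pairs of residues
agree modulo `gcd n m`. -/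

/-! ### The linear systems -/

/-- The first residue at which `kConst n m` takes the value `1`. -/
def oneA (n m : ℕ) : ℕ := if Even n then n / 2 + m / 2 else (n - 1) / 2 + (m + 1) / 2

/-- The second residue at which `kConst n m` takes the value `1`. -/
def oneB (n m : ℕ) : ℕ := n + m / 2

/-- The integer `oneB n m - oneA n m` lies strictly between `0` and `n`: it is `n / 2` for even `n`,
and `(n + 1) / 2` or `(n - 1) / 2` for odd `n`. -/
theorem oneA_ne_oneB {n : ℕ} (hn : 2 ≤ n) (m : ℕ) : (oneA n m : ZMod n) ≠ (oneB n m : ZMod n) := by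
  intro h
  rw [ZMod.natCast_eq_natCast_iff] at h
  unfold oneA oneB at h
  have h2 : (n : ℤ) ∣ ((n + m / 2 : ℕ) : ℤ) -
      ((if Even n then n / 2 + m / 2 else (n - 1) / 2 + (m + 1) / 2 : ℕ) : ℤ) := by
    exact (Nat.modEq_iff_dvd.mp h)
  obtain ⟨c, hc⟩ := h2
  have hc1 : 0 < (n : ℤ) * c := by
    rw [← hc]; split_ifs with he
    · omega
    · rw [Nat.not_even_iff] at he; omega
  have hc2 : (n : ℤ) * c < n := by
    rw [← hc]; split_ifs with he
    · omega
    · rw [Nat.not_even_iff] at he; omega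
  have h3 : 0 < c := by
    by_contra h3
    nlinarith
  nlinarith

/-- With point masses in place of a case distinction, the difference equation becomes a question
about transporting unit masses along the shift by `m`. -/
theorem kConst_eq {n : ℕ} (hn : 2 ≤ n) (m : ℕ) (i : ZMod n) :
    kConst n m i = 3 - 2 * (Pi.single (oneA n m : ZMod n) (1 : ℤ) : ZMod n → ℤ) i -
      2 * (Pi.single (oneB n m : ZMod n) (1 : ℤ) : ZMod n → ℤ) i := by
  have h := oneA_ne_oneB hn m
  unfold kConst
  have e : (if Even n then (if i = ((n / 2 + m / 2 : ℕ) : ZMod n) ∨ i = ((n + m / 2 : ℕ) : ZMod n)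
      then (1 : ℤ) else 3) else
      if i = (((n - 1) / 2 + (m + 1) / 2 : ℕ) : ZMod n) ∨ i = ((n + m / 2 : ℕ) : ZMod n)
      then 1 else 3) = if i = (oneA n m : ZMod n) ∨ i = (oneB n m : ZMod n) then 1 else 3 := by
    unfold oneA oneB
    split_ifs <;> simp_all
  rw [e]
  by_cases h1 : i = (oneA n m : ZMod n)
  · subst h1
    simp [h]
  · by_cases h2 : i = (oneB n m : ZMod n)
    · subst h2
      simp [h1]
    · simp [h1, h2]

/-! ### Coboundaries of the shift by `m` and the consistency criterion -/

/-- `f` is the difference of a function and its shift by `m`. -/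
def IsCoboundary (n m : ℕ) (f : ZMod n → ℤ) : Prop :=
  ∃ x : ZMod n → ℤ, ∀ r, x (r + m) - x r = f r

theorem IsCoboundary.add {n m : ℕ} {f g : ZMod n → ℤ} (hf : IsCoboundary n m f)
    (hg : IsCoboundary n m g) : IsCoboundary n m (fun r => f r + g r) := by
  obtain ⟨x, hx⟩ := hf
  obtain ⟨y, hy⟩ := hg
  refine ⟨fun r => x r + y r, fun r => ?_⟩
  have := hx r
  have := hy r
  simp only
  omega

/-- Telescoping: the point mass at `p + (j + 1) * m` has as coboundary the mass at `p + j * m` minus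
itself. -/
theorem isCoboundary_single_sub_single_mul (n m : ℕ) (p : ZMod n) (j : ℕ) :
    IsCoboundary n m (fun r => (Pi.single p (1 : ℤ) : ZMod n → ℤ) r -
      (Pi.single (p + j * m) (1 : ℤ) : ZMod n → ℤ) r) := by
  induction j with
  | zero => exact ⟨0, fun r => by simp⟩
  | succ j ih =>
    have h1 : IsCoboundary n m (fun r => (Pi.single (p + j * m) (1 : ℤ) : ZMod n → ℤ) r -
        (Pi.single (p + (j + 1 : ℕ) * m) (1 : ℤ) : ZMod n → ℤ) r) := by
      refine ⟨Pi.single (p + (j + 1 : ℕ) * m) (1 : ℤ), fun r => ?_⟩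
      have : (r + m = p + (j + 1 : ℕ) * m) ↔ r = p + j * m := by
        push_cast
        constructor
        · intro h
          linear_combination h
        · rintro rfl
          ring
      simp only [Pi.single_apply, this]
    have := ih.add h1
    convert this using 2
    ring

/-- A residue congruent to `p` modulo `gcd n m` is `p` plus a multiple of `m`. -/
theorem exists_eq_add_mul_of_castHom_eq {n : ℕ} [NeZero n] (m : ℕ) (p p' : ZMod n)
    (h : ZMod.castHom (Nat.gcd_dvd_left n m) (ZMod (n.gcd m)) p =
      ZMod.castHom (Nat.gcd_dvd_left n m) (ZMod (n.gcd m)) p') :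
    ∃ j : ℕ, p' = p + j * m := by
  obtain ⟨a, rfl⟩ := ZMod.intCast_surjective p
  obtain ⟨b, rfl⟩ := ZMod.intCast_surjective p'
  simp only [map_intCast] at h
  rw [ZMod.intCast_eq_intCast_iff_dvd_sub] at h
  obtain ⟨c, hc⟩ := h
  have hg := Nat.gcd_eq_gcd_ab n m
  -- By Bézout, `gcd n m * c` is congruent to `m * u` modulo `n`.
  set u := Nat.gcdB n m * c
  refine ⟨(u : ZMod n).val, ?_⟩
  rw [ZMod.natCast_val, ZMod.cast_id', id]
  have hb : b = a + u * m + n * (Nat.gcdA n m * c) := by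
    have : b = a + (n.gcd m : ℤ) * c := by omega
    rw [this, hg]; simp only [u]; ring
  rw [hb]
  push_cast
  simp

/-- Translation by `m` permutes each class modulo `gcd n m`, so `x` and its shift have the same sum
over the class. -/
theorem IsCoboundary.sum_fiber {n : ℕ} [NeZero n] {m : ℕ} {f : ZMod n → ℤ} (hf : IsCoboundary n m f)
    (c : ZMod (n.gcd m)) :
    ∑ r : ZMod n, (if ZMod.castHom (Nat.gcd_dvd_left n m) (ZMod (n.gcd m)) r = c then f r else 0)
      = 0 := by
  obtain ⟨x, hx⟩ := hf
  set φ := ZMod.castHom (Nat.gcd_dvd_left n m) (ZMod (n.gcd m))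
  have hm : φ (m : ZMod n) = 0 := by
    rw [map_natCast, ZMod.natCast_eq_zero_iff]
    exact Nat.gcd_dvd_right n m
  have h1 : ∑ r : ZMod n, (if φ r = c then x (r + m) else 0) =
      ∑ r : ZMod n, (if φ r = c then x r else 0) := by
    rw [← Equiv.sum_comp (Equiv.addRight (m : ZMod n)) (fun r => if φ r = c then x r else 0)]
    refine Finset.sum_congr rfl fun r _ => ?_
    simp [Equiv.coe_addRight, map_add, hm]
  rw [← sub_eq_zero, ← Finset.sum_sub_distrib] at h1
  refine Eq.trans (Finset.sum_congr rfl fun r _ => ?_) h1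
  split_ifs
  · exact (hx r).symm
  · simp

/-- `S_0` only defines `y`. Eliminating it at the index `-r` leaves a first-order difference
equation for `x` alone. -/
theorem system_iff {n m : ℕ} {x y : ZMod n → ℤ} (h0 : SystemS n 0 x y) :
    SystemS n m x y ↔ ∀ r, x (r + m) = x r - vConst n m r := by
  have h0' : ∀ r, y (-r) = x r - kConst n 0 (-r) := fun r => by
    have := h0 (-r)
    simpa using this
  unfold vConst
  constructor
  · intro h r
    have h1 := h (-r)
    have h2 := h0' r
    simp only [CharP.cast_eq_zero, zero_sub, neg_neg] at h1 ⊢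
    omega
  · intro h r
    have h1 := h (-r)
    have h2 := h0' (-r)
    simp only [CharP.cast_eq_zero, zero_sub, neg_neg] at h1 h2 ⊢
    omega

theorem consistent_iff_isCoboundary (n m : ℕ) :
    Consistent n m ↔ IsCoboundary n m (fun r => - vConst n m r) := by
  constructor
  · rintro ⟨x, y, h0, h⟩
    refine ⟨x, fun r => ?_⟩
    have := (system_iff h0).1 h r
    simp only
    omega
  · rintro ⟨x, hx⟩
    have h0 : SystemS n 0 x (fun i => x (-i) - kConst n 0 i) := fun i => by simp
    refine ⟨x, _, h0, (system_iff h0).2 fun r => ?_⟩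
    have := hx r
    simp only at this
    omega

theorem vConst_eq {n : ℕ} (hn : 2 ≤ n) (m : ℕ) (r : ZMod n) :
    - vConst n m r = 2 * (((Pi.single (-oneA n 0 : ZMod n) (1 : ℤ) : ZMod n → ℤ) r +
        (Pi.single (-oneB n 0 : ZMod n) (1 : ℤ) : ZMod n → ℤ) r) -
      ((Pi.single (-oneA n m : ZMod n) (1 : ℤ) : ZMod n → ℤ) r +
        (Pi.single (-oneB n m : ZMod n) (1 : ℤ) : ZMod n → ℤ) r)) := by
  unfold vConst
  rw [kConst_eq hn, kConst_eq hn]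
  simp only [Pi.single_apply, CharP.cast_eq_zero, zero_sub, neg_eq_iff_eq_neg]
  ring

theorem sum_fiber_single {n d : ℕ} [NeZero n] (h : d ∣ n) (c : ZMod d) (p : ZMod n) :
    ∑ r : ZMod n, (if ZMod.castHom h (ZMod d) r = c then
      (Pi.single p (1 : ℤ) : ZMod n → ℤ) r else 0) =
      if ZMod.castHom h (ZMod d) p = c then 1 else 0 := by
  rw [Finset.sum_eq_single p]
  · rw [Pi.single_eq_same]
  · intro b _ hb
    simp [hb]
  · simp

theorem IsCoboundary.two_mul {n m : ℕ} {f : ZMod n → ℤ} (hf : IsCoboundary n m f) :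
    IsCoboundary n m (fun r => 2 * f r) := by
  convert hf.add hf using 2
  ring

/-- Sums over the classes modulo `gcd n m` show that the unordered pairs `{oneA n 0, oneB n 0}` and
`{oneA n m, oneB n m}` must agree there; conversely congruent masses are matched by telescoping. -/
theorem consistent_iff_cast {n : ℕ} (hn : 2 ≤ n) (m : ℕ) :
    Consistent n m ↔
      ((oneA n 0 : ZMod (n.gcd m)) = oneA n m ∧ (oneB n 0 : ZMod (n.gcd m)) = oneB n m) ∨
      ((oneA n 0 : ZMod (n.gcd m)) = oneB n m ∧ (oneB n 0 : ZMod (n.gcd m)) = oneA n m) := by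
  have : NeZero n := ⟨by omega⟩
  rw [consistent_iff_isCoboundary]
  set φ := ZMod.castHom (Nat.gcd_dvd_left n m) (ZMod (n.gcd m)) with hφ
  constructor
  · intro h
    have key : ∀ c : ZMod (n.gcd m),
        ((if -(oneA n 0 : ZMod (n.gcd m)) = c then (1 : ℤ) else 0) +
          (if -(oneB n 0 : ZMod (n.gcd m)) = c then 1 else 0)) =
        ((if -(oneA n m : ZMod (n.gcd m)) = c then 1 else 0) +
          (if -(oneB n m : ZMod (n.gcd m)) = c then 1 else 0)) := by
      intro c
      have h1 := h.sum_fiber c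
      have h2 : ∀ r, (if φ r = c then - vConst n m r else 0) =
          2 * (((if φ r = c then (Pi.single (-oneA n 0 : ZMod n) (1 : ℤ) : ZMod n → ℤ) r else 0) +
            (if φ r = c then (Pi.single (-oneB n 0 : ZMod n) (1 : ℤ) : ZMod n → ℤ) r else 0)) -
            ((if φ r = c then (Pi.single (-oneA n m : ZMod n) (1 : ℤ) : ZMod n → ℤ) r else 0) +
            (if φ r = c then (Pi.single (-oneB n m : ZMod n) (1 : ℤ) : ZMod n → ℤ) r else 0))) := by
        intro r
        rw [vConst_eq hn]
        split_ifs <;> ring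
      rw [Finset.sum_congr rfl fun r _ => h2 r, ← Finset.mul_sum, Finset.sum_sub_distrib,
        Finset.sum_add_distrib, Finset.sum_add_distrib, sum_fiber_single, sum_fiber_single,
        sum_fiber_single, sum_fiber_single] at h1
      simp only [map_neg, map_natCast] at h1
      omega
    generalize (oneA n 0 : ZMod (n.gcd m)) = a at *
    generalize (oneB n 0 : ZMod (n.gcd m)) = b at *
    generalize (oneA n m : ZMod (n.gcd m)) = a' at *
    generalize (oneB n m : ZMod (n.gcd m)) = b' at *
    -- `key` compares multiplicities in two unordered pairs; its values at the four members decide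
    -- how they match.
    have ka := key (-a)
    have kb := key (-b)
    have ka' := key (-a')
    have kb' := key (-b')
    simp only [neg_inj] at ka kb ka' kb'
    by_cases h1 : a = a' <;> by_cases h2 : b = b' <;> by_cases h3 : a = b' <;>
      by_cases h4 : b = a' <;> by_cases h5 : a = b <;> by_cases h6 : a' = b' <;>
      simp_all [eq_comm]
  · have hs : ∀ k l : ℕ, (k : ZMod (n.gcd m)) = l → IsCoboundary n m
        (fun r => (Pi.single (-(k : ZMod n)) (1 : ℤ) : ZMod n → ℤ) r -
          (Pi.single (-(l : ZMod n)) (1 : ℤ) : ZMod n → ℤ) r) := by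
      intro k l h
      obtain ⟨j, hj⟩ := exists_eq_add_mul_of_castHom_eq m (-(k : ZMod n)) (-(l : ZMod n))
        (by simp only [map_neg, map_natCast, h])
      rw [hj]
      exact isCoboundary_single_sub_single_mul n m _ j
    have hv : (fun r => - vConst n m r) = _ := funext fun r => vConst_eq hn m r
    rw [hv]
    rintro (⟨h1, h2⟩ | ⟨h1, h2⟩)
    · convert ((hs _ _ h1).add (hs _ _ h2)).two_mul using 2
      ring
    · convert ((hs _ _ h1).add (hs _ _ h2)).two_mul using 2
      ring

theorem natCast_eq_natCast_iff_intDvd (d a b : ℕ) :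
    (a : ZMod d) = (b : ZMod d) ↔ (d : ℤ) ∣ (b : ℤ) - (a : ℤ) := by
  have := ZMod.intCast_eq_intCast_iff_dvd_sub (a : ℤ) (b : ℤ) d
  simpa using this

/-- Both congruences of the parallel matching say `g ∣ m / 2`. Those of the crossed matching differ
by a multiple of `n`, and each is equivalent to `g ∣ n / 2 - m / 2`. -/
theorem not_consistent_iff_of_even {n : ℕ} (hn : 2 ≤ n) (m : ℕ) (he : Even n) :
    ¬ Consistent n m ↔
        (¬ (Nat.gcd n m : ℤ) ∣ (n : ℤ) - ((m / 2 : ℕ) : ℤ)) ∧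
        ¬ (Nat.gcd n m : ℤ) ∣ ((n / 2 : ℕ) : ℤ) - ((m / 2 : ℕ) : ℤ) := by
  rw [consistent_iff_cast hn, ← not_or, not_iff_not]
  simp only [natCast_eq_natCast_iff_intDvd, oneA, oneB, he, if_true]
  have hgn : (Nat.gcd n m : ℤ) ∣ n := by exact_mod_cast Nat.gcd_dvd_left n m
  have hn2 : (n : ℤ) = 2 * ((n / 2 : ℕ) : ℤ) := by
    obtain ⟨k, rfl⟩ := he
    omega
  set g : ℤ := (Nat.gcd n m : ℤ)
  have hconv : ∀ {a b : ℤ}, g ∣ a → a = b → g ∣ b := fun h e => e ▸ h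
  push_cast at *
  constructor
  · rintro (⟨h1, h2⟩ | ⟨h1, h2⟩)
    · left
      have : (n : ℤ) - m / 2 = n - ((n : ℤ) + m / 2 - (n + 0 / 2)) := by ring
      rw [this]
      exact dvd_sub hgn h2
    · right
      have : (n : ℤ) / 2 - m / 2 = n - ((n : ℤ) + m / 2 - (n / 2 + 0 / 2)) := by
        simp only [Int.zero_ediv]; omega
      rw [this]
      exact dvd_sub hgn h1
  · rintro (h | h)
    · left
      have h' := dvd_sub hgn h
      have e : (n : ℤ) - (n - m / 2) = m / 2 := by ring
      rw [e] at h'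
      constructor
      · refine hconv (h') ?_
        simp
      · refine hconv (h') ?_
        simp
    · right
      constructor
      · refine hconv (dvd_sub hgn h) ?_
        omega
      · have := dvd_sub (dvd_neg.2 h) (dvd_zero g)
        refine hconv (this) ?_
        omega

/-- In each matching one congruence implies the other, because `m / 2 + (m + 1) / 2 = m` is
divisible by `g`. -/
theorem not_consistent_iff_of_odd {n : ℕ} (hn : 2 ≤ n) (m : ℕ) (ho : Odd n) :
    ¬ Consistent n m ↔
        (¬ (Nat.gcd n m : ℤ) ∣ (n : ℤ) - (((m + 1) / 2 : ℕ) : ℤ)) ∧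
        ¬ (Nat.gcd n m : ℤ) ∣ (((n - 1) / 2 : ℕ) : ℤ) - ((m / 2 : ℕ) : ℤ) := by
  rw [consistent_iff_cast hn, ← not_or, not_iff_not]
  have he : ¬ Even n := Nat.not_even_iff_odd.2 ho
  simp only [natCast_eq_natCast_iff_intDvd, oneA, oneB, he, if_false]
  have hgn : (Nat.gcd n m : ℤ) ∣ n := by exact_mod_cast Nat.gcd_dvd_left n m
  have hgm : (Nat.gcd n m : ℤ) ∣ m := by exact_mod_cast Nat.gcd_dvd_right n m
  have hm2 : ((m / 2 : ℕ) : ℤ) + (((m + 1) / 2 : ℕ) : ℤ) = m := by omega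
  have hodd : ((m / 2 : ℕ) : ℤ) = (((m + 1) / 2 : ℕ) : ℤ) ∨
    ((m / 2 : ℕ) : ℤ) + 1 = (((m + 1) / 2 : ℕ) : ℤ) := by omega
  have hn2 : (n : ℤ) = 2 * (((n - 1) / 2 : ℕ) : ℤ) + 1 := by
    obtain ⟨k, rfl⟩ := ho
    omega
  simp only [Nat.zero_div, Nat.zero_add, Nat.reduceDiv, Nat.add_zero, Nat.cast_add]
  generalize ((m / 2 : ℕ) : ℤ) = f at *
  generalize (((m + 1) / 2 : ℕ) : ℤ) = c at *
  generalize (((n - 1) / 2 : ℕ) : ℤ) = h at *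
  generalize (Nat.gcd n m : ℤ) = g at *
  have hconv : ∀ {a b : ℤ}, g ∣ a → a = b → g ∣ b := fun h e => e ▸ h
  have hgm' : g ∣ f + c := hm2 ▸ hgm
  constructor
  · rintro (⟨h1, h2⟩ | ⟨h1, h2⟩)
    · left
      refine hconv (dvd_sub hgn h1) ?_
      ring
    · right
      refine hconv (dvd_sub hgn h1) ?_
      omega
  · rintro (h1 | h1)
    · left
      have hc : g ∣ c := by
        refine hconv (dvd_sub hgn h1) ?_
        ring
      have hf : g ∣ f := by
        refine hconv (dvd_sub hgm' hc) ?_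
        ring
      constructor
      · refine hconv (hc) ?_
        ring
      · refine hconv (hf) ?_
        ring
    · right
      constructor
      · refine hconv (dvd_sub hgn h1) ?_
        omega
      · refine hconv (dvd_sub (dvd_add hgm' h1) hgn) ?_
        omega

/-! ### The parametric solution -/

/-- The classes modulo `gcd n m` are the orbits of the shift by `m`. Applied to the difference of
two solutions, this gives uniqueness. -/
theorem eq_of_shift_invariant {n : ℕ} [NeZero n] {m : ℕ} {d : ZMod n → ℤ} (hd : ∀ r, d (r + m) = d r)
    {p p' : ZMod n} (h : ZMod.castHom (Nat.gcd_dvd_left n m) (ZMod (n.gcd m)) p =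
      ZMod.castHom (Nat.gcd_dvd_left n m) (ZMod (n.gcd m)) p') : d p = d p' := by
  obtain ⟨j, rfl⟩ := exists_eq_add_mul_of_castHom_eq m p p' h
  induction j with
  | zero => simp
  | succ j ih =>
    rw [ih (by
      have hm : ZMod.castHom (Nat.gcd_dvd_left n m) (ZMod (n.gcd m)) (m : ZMod n) = 0 := by
        rw [map_natCast, ZMod.natCast_eq_zero_iff]
        exact Nat.gcd_dvd_right n m
      rw [map_add, map_mul, hm]; simp), ← hd]
    congr 1
    push_cast
    ring

theorem exists_rep_gcd {n : ℕ} [NeZero n] (m : ℕ) (r : ZMod n) :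
    ∃ i : Fin (n.gcd m), ZMod.castHom (Nat.gcd_dvd_left n m) (ZMod (n.gcd m)) r =
      ZMod.castHom (Nat.gcd_dvd_left n m) (ZMod (n.gcd m)) ((i.val + 1 : ℕ) : ZMod n) := by
  have hg : 0 < n.gcd m := Nat.gcd_pos_of_pos_left _ (NeZero.pos n)
  have : NeZero (n.gcd m) := ⟨hg.ne'⟩
  refine ⟨⟨(ZMod.castHom (Nat.gcd_dvd_left n m) (ZMod (n.gcd m)) r - 1).val, ZMod.val_lt _⟩, ?_⟩
  rw [map_natCast]
  push_cast
  rw [ZMod.natCast_val, ZMod.cast_id', id]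
  ring

/-- A given solution `x₀` is corrected by a function of the residue modulo `gcd n m`; such functions
are exactly the solutions of the homogeneous equation. -/
theorem existsUnique_solution {n : ℕ} (hn : 2 ≤ n) {m : ℕ} (hc : Consistent n m)
    (t : Fin (Nat.gcd n m) → ℤ) :
    ∃! p : (ZMod n → ℤ) × (ZMod n → ℤ), SystemS n 0 p.1 p.2 ∧ SystemS n m p.1 p.2 ∧
      ∀ i : Fin (Nat.gcd n m), p.1 ((i.val + 1 : ℕ) : ZMod n) = t i := by
  have : NeZero n := ⟨by omega⟩
  obtain ⟨x₀, y₀, h0, hm⟩ := hc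
  have hx₀ := (system_iff h0).1 hm
  set φ := ZMod.castHom (Nat.gcd_dvd_left n m) (ZMod (n.gcd m)) with hφ
  have hφm : φ (m : ZMod n) = 0 := by
    rw [map_natCast, ZMod.natCast_eq_zero_iff]
    exact Nat.gcd_dvd_right n m
  have hg : 0 < n.gcd m := Nat.gcd_pos_of_pos_left _ (NeZero.pos n)
  have : NeZero (n.gcd m) := ⟨hg.ne'⟩
  -- The shift by one appears because the free values are `x_1, …, x_g`, while `Fin` starts at `0`.
  let e : ZMod (n.gcd m) → Fin (n.gcd m) := fun c => ⟨(c - 1).val, ZMod.val_lt _⟩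
  have he : ∀ i : Fin (n.gcd m), e (φ ((i.val + 1 : ℕ) : ZMod n)) = i := by
    intro i
    apply Fin.ext
    simp only [e, map_natCast]
    push_cast
    rw [add_sub_cancel_right, ZMod.val_natCast, Nat.mod_eq_of_lt i.2]
  let x : ZMod n → ℤ := fun r => x₀ r + (t (e (φ r)) - x₀ (((e (φ r)).val + 1 : ℕ) : ZMod n))
  have hx : ∀ r, x (r + m) = x r - vConst n m r := by
    intro r
    simp only [x, map_add, hφm, add_zero, hx₀ r]
    ring
  have hs0 : SystemS n 0 x (fun i => x (-i) - kConst n 0 i) := fun i => by simp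
  refine ⟨(x, fun i => x (-i) - kConst n 0 i), ⟨hs0, (system_iff hs0).2 hx, fun i => ?_⟩, ?_⟩
  · simp only [x, he]
    ring
  · rintro ⟨x', y'⟩ ⟨h0', hm', ht'⟩
    have hx' := (system_iff h0').1 hm'
    simp only at h0' hm' ht' hx'
    have hxx : x' = x := by
      funext r
      have hd : ∀ r, (fun r => x' r - x r) (r + m) = (fun r => x' r - x r) r := fun r => by
        simp only [hx', hx]
        ring
      obtain ⟨i, hi⟩ := exists_rep_gcd m r
      have h1 := eq_of_shift_invariant (d := fun r => x' r - x r) hd hi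
      have h2 : x ((i.val + 1 : ℕ) : ZMod n) = t i := by
        simp only [x, he]
        ring
      rw [ht', h2] at h1
      omega
    subst hxx
    refine Prod.ext rfl (funext fun i => ?_)
    simpa using h0' i

theorem exists_index_of_residue {n : ℕ} [NeZero n] (m : ℕ) (r : ZMod n) :
    ∃ i j : ℕ, 1 ≤ i ∧ i ≤ n.gcd m ∧ j < n / n.gcd m ∧ r = ((i + j * m : ℕ) : ZMod n) := by
  have hn : 0 < n := NeZero.pos n
  have hg : 0 < n.gcd m := Nat.gcd_pos_of_pos_left _ hn
  obtain ⟨i, hi⟩ := exists_rep_gcd m r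
  obtain ⟨j, hj⟩ := exists_eq_add_mul_of_castHom_eq m _ _ hi.symm
  have hq : 0 < n / n.gcd m := Nat.div_pos (Nat.le_of_dvd hn (Nat.gcd_dvd_left n m)) hg
  refine ⟨i.val + 1, j % (n / n.gcd m), by omega, i.2, Nat.mod_lt _ hq, ?_⟩
  rw [hj]
  -- The shift by `m` has order dividing `n / gcd n m`, so `j` can be reduced modulo this number.
  have h1 : ((n / n.gcd m : ℕ) : ZMod n) * m = 0 := by
    have h2 : (n / n.gcd m) * m = n * (m / n.gcd m) := by
      obtain ⟨a, ha⟩ := Nat.gcd_dvd_left n m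
      obtain ⟨b, hb⟩ := Nat.gcd_dvd_right n m
      have ha' : n / n.gcd m = a := Nat.div_eq_of_eq_mul_right hg ha
      have hb' : m / n.gcd m = b := Nat.div_eq_of_eq_mul_right hg hb
      rw [ha', hb']
      calc a * m = a * (n.gcd m * b) := by rw [← hb]
        _ = n.gcd m * a * b := by ring
        _ = n * b := by rw [← ha]
    rw [← Nat.cast_mul, h2, Nat.cast_mul]
    simp
  have h3 : (j : ZMod n) * m = ((j % (n / n.gcd m) : ℕ) : ZMod n) * m := by
    conv_lhs => rw [← Nat.mod_add_div j (n / n.gcd m)]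
    push_cast
    rw [add_mul, mul_right_comm, h1]
    ring
  rw [h3]
  push_cast
  ring

/-- Iterating the difference equation gives the formula. Conversely, subtracting the formulas for
`j` and `j + 1` gives back one equation; the value `j = n / gcd n m` supplies the equation that
closes the orbit. -/
theorem solution_iff_parametric {n : ℕ} (hn : 2 ≤ n) (m : ℕ) (x y : ZMod n → ℤ) :
    SystemS n 0 x y ∧ SystemS n m x y ↔
      SystemS n 0 x y ∧
      ∀ i j : ℕ, 1 ≤ i → i ≤ Nat.gcd n m → 1 ≤ j → j ≤ n / Nat.gcd n m →
        x ((i + j * m : ℕ) : ZMod n) =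
          x (i : ZMod n) - ∑ l ∈ Finset.range j, vConst n m ((i + l * m : ℕ) : ZMod n) := by
  have : NeZero n := ⟨by omega⟩
  refine and_congr_right fun h0 => ?_
  rw [system_iff h0]
  constructor
  · intro h i j _ _ _ _
    induction j with
    | zero => simp
    | succ j ih =>
      have h1 : x ((i + j * m : ℕ) : ZMod n) =
          x (i : ZMod n) - ∑ l ∈ Finset.range j, vConst n m ((i + l * m : ℕ) : ZMod n) := by
        by_cases hj : j = 0
        · subst hj
          simp
        · exact ih (by omega) (by omega)
      rw [Finset.sum_range_succ, ← sub_sub, ← h1, ← h]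
      congr 1
      push_cast
      ring
  · intro h r
    obtain ⟨i, j, hi1, hi2, hj, rfl⟩ := exists_index_of_residue m r
    have h1 : x ((i + j * m : ℕ) : ZMod n) =
        x (i : ZMod n) - ∑ l ∈ Finset.range j, vConst n m ((i + l * m : ℕ) : ZMod n) := by
      by_cases hj : j = 0
      · subst hj
        simp
      · exact h i j hi1 hi2 (by omega) (by omega)
    have h2 := h i (j + 1) hi1 hi2 (by omega) (by omega)
    rw [Finset.sum_range_succ, ← sub_sub, ← h1] at h2
    rw [← h2]
    congr 1
    push_cast
    ring

/-! ### Continuants and zero continued fractions -/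

/-- Numerator and denominator of the continued fraction `[e₁, …, e_r]`. -/
def contPair : List ℕ → ℤ × ℤ
  | [] => (1, 0)
  | e :: t => ((e : ℤ) * (contPair t).1 - (contPair t).2, (contPair t).1)

/-- All nonempty tails of the list have positive continuant. -/
def ContPos : List ℕ → Prop
  | [] => True
  | e :: t => 0 < (contPair (e :: t)).1 ∧ ContPos t

/-- The proper tails have positive continuant, and the whole list has continuant zero. -/
def IsZeroChain (l : List ℕ) : Prop := (contPair l).1 = 0 ∧ ContPos l.tail

theorem contPair_cons (e : ℕ) (t : List ℕ) :
    contPair (e :: t) = ((e : ℤ) * (contPair t).1 - (contPair t).2, (contPair t).1) := rfl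

theorem ContPos.fst_pos {l : List ℕ} (h : ContPos l) : 0 < (contPair l).1 := by
  cases l with
  | nil => simp [contPair]
  | cons e t => exact h.1

theorem ContPos.snd_pos {l : List ℕ} (h : ContPos l) (hl : l ≠ []) : 0 < (contPair l).2 := by
  cases l with
  | nil => exact absurd rfl hl
  | cons e t => exact h.2.fst_pos

theorem ContPos.snd_nonneg {l : List ℕ} (h : ContPos l) : 0 ≤ (contPair l).2 := by
  cases l with
  | nil => simp [contPair]
  | cons e t => exact h.2.fst_pos.le

theorem ContPos.of_append {A T : List ℕ} (h : ContPos (A ++ T)) : ContPos T := by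
  induction A with
  | nil => exact h
  | cons a A ih => exact ih h.2

theorem hjValue_cons (e : ℕ) {t : List ℕ} (ht : t ≠ []) :
    hjValue (e :: t) = e - 1 / hjValue t := by
  cases t with
  | nil => exact absurd rfl ht
  | cons f l => rfl

theorem ContPos.hjValue_eq {l : List ℕ} (h : ContPos l) (hl : l ≠ []) :
    hjValue l = (contPair l).1 / (contPair l).2 := by
  induction l with
  | nil => exact absurd rfl hl
  | cons e t ih =>
    by_cases ht : t = []
    · subst ht
      simp [hjValue, contPair]
    · rw [hjValue_cons e ht, ih h.2 ht, contPair_cons]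
      have h1 : (0 : ℚ) < (contPair t).1 := by exact_mod_cast h.2.fst_pos
      have h2 : (0 : ℚ) < (contPair t).2 := by exact_mod_cast h.2.snd_pos ht
      push_cast
      field_simp

theorem ContPos.hjValue_cons_eq {e : ℕ} {t : List ℕ} (h : ContPos t) :
    hjValue (e :: t) = (contPair (e :: t)).1 / (contPair t).1 := by
  by_cases ht : t = []
  · subst ht
    simp [hjValue, contPair]
  · rw [hjValue_cons e ht, h.hjValue_eq ht, contPair_cons]
    have h1 : (0 : ℚ) < (contPair t).1 := by exact_mod_cast h.fst_pos
    have h2 : (0 : ℚ) < (contPair t).2 := by exact_mod_cast h.snd_pos ht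
    push_cast
    field_simp

/-- Each tail has as value a quotient of consecutive continuants; once the denominator is known to
be positive, the value has the sign of the numerator. -/
theorem contPos_iff_hjValue_pos (l : List ℕ) :
    ContPos l ↔ ∀ t, t <:+ l → t ≠ [] → 0 < hjValue t := by
  induction l with
  | nil => simp [ContPos]
  | cons e l ih =>
    have key : ContPos l → (0 < hjValue (e :: l) ↔ 0 < (contPair (e :: l)).1) := fun h => by
      have h1 : (0 : ℚ) < (contPair l).1 := by exact_mod_cast h.fst_pos
      rw [h.hjValue_cons_eq, div_pos_iff_of_pos_right h1]
      norm_cast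
    constructor
    · rintro ⟨h1, h2⟩ t ht hne
      rcases List.suffix_cons_iff.1 ht with rfl | h
      · exact (key h2).2 h1
      · exact ih.1 h2 t h hne
    · intro h
      have h2 := ih.2 fun t ht hne => h t (ht.trans (List.suffix_cons e l)) hne
      exact ⟨(key h2).1 (h _ List.suffix_rfl (by simp)), h2⟩

theorem isZeroFraction_iff (l : List ℕ) :
    IsZeroFraction l ↔ l ≠ [] ∧ (∀ e ∈ l, 0 < e) ∧ IsZeroChain l := by
  cases l with
  | nil => simp [IsZeroFraction, AdmitsHJ]
  | cons e t =>
    unfold IsZeroFraction AdmitsHJ IsZeroChain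
    rw [← contPos_iff_hjValue_pos, List.tail_cons]
    have key : ContPos t → (hjValue (e :: t) = 0 ↔ (contPair (e :: t)).1 = 0) := fun h => by
      have h1 : (0 : ℚ) < (contPair t).1 := by exact_mod_cast h.fst_pos
      rw [h.hjValue_cons_eq, div_eq_zero_iff]
      simp [h1.ne']
    constructor
    · rintro ⟨⟨h1, h2, h3, h4⟩, h5⟩
      exact ⟨h1, h2, (key h3).1 h5, h3⟩
    · rintro ⟨h1, h2, h3, h4⟩
      have := (key h4).2 h3
      exact ⟨⟨h1, h2, h4, this.ge⟩, this⟩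

/-- A prefix acts on `contPair` of the rest by a matrix, so a suffix can be exchanged for another
one with the same pair. -/
theorem contPair_append_congr {T T' : List ℕ} (h : contPair T = contPair T') (A : List ℕ) :
    contPair (A ++ T) = contPair (A ++ T') := by
  induction A with
  | nil => exact h
  | cons a A ih => simp only [List.cons_append, contPair_cons, ih]

theorem contPos_append_congr {T T' : List ℕ} (h : contPair T = contPair T')
    (hp : ContPos T → ContPos T') (A : List ℕ) : ContPos (A ++ T) → ContPos (A ++ T') := by
  induction A with
  | nil => exact hp
  | cons a A ih =>
    rintro ⟨h1, h2⟩
    refine ⟨?_, ih h2⟩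
    have := contPair_append_congr h (a :: A)
    rw [List.cons_append, List.cons_append] at this
    change 0 < (contPair (a :: (A ++ T'))).1
    rw [← this]
    exact h1

/-- There are two positivity hypotheses because an empty `A` leaves only the tail of `T` subject to
positivity. -/
theorem IsZeroChain.append_congr {T T' : List ℕ} (h : contPair T = contPair T')
    (hp : ContPos T → ContPos T') (hp0 : ContPos T.tail → (contPair T).1 = 0 → ContPos T'.tail)
    {A : List ℕ} (hz : IsZeroChain (A ++ T)) : IsZeroChain (A ++ T') := by
  refine ⟨by rw [← contPair_append_congr h]; exact hz.1, ?_⟩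
  cases A with
  | nil => exact hp0 hz.2 hz.1
  | cons a A => exact contPos_append_congr h hp A hz.2

/-- Arithmetic form of gluing a triangle to the side between two neighbouring vertices. -/
theorem contPair_blowUp (a b : ℕ) (T : List ℕ) :
    contPair ((a + 1) :: 1 :: (b + 1) :: T) = contPair (a :: b :: T) := by
  simp only [contPair_cons]
  push_cast
  ext <;> ring

theorem contPos_blowUp_tail (b : ℕ) (T : List ℕ) :
    ContPos (1 :: (b + 1) :: T) ↔ ContPos (b :: T) := by
  simp only [ContPos, contPair_cons]
  push_cast
  constructor
  · rintro ⟨h1, h2, h3⟩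
    exact ⟨by linarith, h3⟩
  · rintro ⟨h1, h3⟩
    have := h3.fst_pos
    exact ⟨by linarith, by linarith, h3⟩

theorem contPos_blowUp (a b : ℕ) (T : List ℕ) :
    ContPos ((a + 1) :: 1 :: (b + 1) :: T) ↔ ContPos (a :: b :: T) := by
  have h := contPair_blowUp a b T
  have h2 := contPos_blowUp_tail b T
  constructor
  · rintro ⟨h1, h3⟩
    exact ⟨h ▸ h1, h2.1 h3⟩
  · rintro ⟨h1, h3⟩
    exact ⟨h.symm ▸ h1, h2.2 h3⟩

theorem isZeroChain_blowUp (A : List ℕ) (a b : ℕ) (T : List ℕ) :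
    IsZeroChain (A ++ (a + 1) :: 1 :: (b + 1) :: T) ↔ IsZeroChain (A ++ a :: b :: T) :=
  ⟨IsZeroChain.append_congr (contPair_blowUp a b T) (contPos_blowUp a b T).1
    fun h _ => (contPos_blowUp_tail b T).1 h,
   IsZeroChain.append_congr (contPair_blowUp a b T).symm (contPos_blowUp a b T).2
    fun h _ => (contPos_blowUp_tail b T).2 h⟩

/-- A triangle is glued to the side between the hidden vertex and its successor. Only here and at
the other end of the chain does the hidden index grow. -/
theorem IsZeroChain.blowUp_head {b : ℕ} {T : List ℕ} (h : IsZeroChain (b :: T)) :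
    IsZeroChain (1 :: (b + 1) :: T) := by
  obtain ⟨h1, h2⟩ := h
  have h3 := ContPos.fst_pos h2
  simp only [IsZeroChain, List.tail_cons, ContPos, contPair_cons] at *
  push_cast
  exact ⟨by linarith, by linarith, h2⟩

theorem isZeroChain_blowUp_last (A : List ℕ) (a : ℕ) :
    IsZeroChain (A ++ [a + 1, 1]) ↔ IsZeroChain (A ++ [a]) := by
  have h : contPair [a + 1, 1] = contPair [a] := by
    simp [contPair]
  constructor
  · refine IsZeroChain.append_congr h ?_ ?_ <;> simp [ContPos, contPair]
  · refine IsZeroChain.append_congr h.symm ?_ ?_ <;> simp [ContPos, contPair]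

/-- If `p ≥ r > 0` and `a ≥ 2`, then `a * p - r ≥ p > 0`. -/
theorem contPair_append_of_two_le {A T : List ℕ} (hA : ∀ e ∈ A, 2 ≤ e)
    (hT : (contPair T).2 ≤ (contPair T).1) (hT' : 0 < (contPair T).1) :
    (contPair (A ++ T)).2 ≤ (contPair (A ++ T)).1 ∧ 0 < (contPair (A ++ T)).1 := by
  induction A with
  | nil => exact ⟨hT, hT'⟩
  | cons a A ih =>
    obtain ⟨h1, h2⟩ := ih fun e he => hA e (List.mem_cons_of_mem _ he)
    have ha : (2 : ℤ) ≤ a := by exact_mod_cast hA a List.mem_cons_self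
    rw [List.cons_append, contPair_cons]
    constructor <;> nlinarith

theorem contPair_of_two_le {A : List ℕ} (hA : ∀ e ∈ A, 2 ≤ e) :
    (contPair A).2 < (contPair A).1 := by
  induction A with
  | nil => simp [contPair]
  | cons a A ih =>
    have h1 := ih fun e he => hA e (List.mem_cons_of_mem _ he)
    have h2 := contPair_append_of_two_le (T := []) (fun e he => hA e (List.mem_cons_of_mem _ he))
      (by simp [contPair]) (by simp [contPair])
    rw [List.append_nil] at h2
    have ha : (2 : ℤ) ≤ a := by exact_mod_cast hA a List.mem_cons_self
    rw [contPair_cons]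
    nlinarith

theorem not_isZeroChain_of_two_le {A : List ℕ} (hA : ∀ e ∈ A, 2 ≤ e) : ¬ IsZeroChain A := by
  intro h
  have h2 := contPair_append_of_two_le (T := []) hA (by simp [contPair]) (by simp [contPair])
  rw [List.append_nil, h.1] at h2
  exact absurd h2.2 (lt_irrefl _)

theorem contPos_of_two_le {A : List ℕ} (hA : ∀ e ∈ A, 2 ≤ e) : ContPos A := by
  induction A with
  | nil => trivial
  | cons a A ih =>
    refine ⟨?_, ih fun e he => hA e (List.mem_cons_of_mem _ he)⟩
    have h2 := contPair_append_of_two_le (T := []) hA (by simp [contPair]) (by simp [contPair])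
    rw [List.append_nil] at h2
    exact h2.2

theorem contPair_one_one (C : List ℕ) : (contPair (1 :: 1 :: C)).1 = -(contPair C).2 := by
  simp only [contPair_cons]
  push_cast
  ring

/-- Two adjacent entries `1` occur only in `[1, 1]`. -/
theorem IsZeroChain.eq_nil_of_one_one {A C : List ℕ} (h : IsZeroChain (A ++ 1 :: 1 :: C)) :
    A = [] ∧ C = [] := by
  have hC := contPair_one_one C
  cases A with
  | nil =>
    refine ⟨rfl, ?_⟩
    by_contra hne
    have h1 := h.1
    rw [List.nil_append, hC] at h1
    have h2 : ContPos C := h.2.2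
    have := h2.snd_pos hne
    omega
  | cons a A =>
    exfalso
    have h2 : ContPos (1 :: 1 :: C) := ContPos.of_append h.2
    have h3 := h2.1
    rw [hC] at h3
    have := (h2.2.2).snd_nonneg
    omega

/-! ### Dual chains -/

/-- Dual chains: the indices along the two sides of an accordion triangulation, from the last
diagonal to the first one. -/
inductive DualChains : List ℕ → List ℕ → Prop
  | base : DualChains [2] [2]
  | stepR {rs ls : List ℕ} {l : ℕ} :
      DualChains rs (l :: ls) → DualChains (2 :: rs) ((l + 1) :: ls)
  | stepL {rs ls : List ℕ} {r : ℕ} :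
      DualChains (r :: rs) ls → DualChains ((r + 1) :: rs) (2 :: ls)

namespace DualChains

theorem symm {rs ls : List ℕ} (h : DualChains rs ls) : DualChains ls rs := by
  induction h with
  | base => exact base
  | stepR _ ih => exact stepL ih
  | stepL _ ih => exact stepR ih

theorem ne_nil {rs ls : List ℕ} (h : DualChains rs ls) : rs ≠ [] ∧ ls ≠ [] := by
  cases h <;> simp

theorem two_le {rs ls : List ℕ} (h : DualChains rs ls) :
    (∀ e ∈ rs, 2 ≤ e) ∧ ∀ e ∈ ls, 2 ≤ e := by
  induction h with
  | base => simp
  | stepR _ ih =>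
    simp only [List.mem_cons, forall_eq_or_imp] at *
    exact ⟨⟨le_rfl, ih.1⟩, by omega, ih.2.2⟩
  | stepL _ ih =>
    simp only [List.mem_cons, forall_eq_or_imp] at *
    exact ⟨⟨by omega, ih.1.2⟩, le_rfl, ih.2⟩

theorem sum_eq {rs ls : List ℕ} (h : DualChains rs ls) :
    rs.sum + ls.sum + 2 = 3 * (rs.length + ls.length) := by
  induction h with
  | base => simp
  | stepR _ ih =>
    simp only [List.sum_cons, List.length_cons] at *
    omega
  | stepL _ ih =>
    simp only [List.sum_cons, List.length_cons] at *
    omega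

/-- The constructors add triangles only past the last diagonal. The present rule adds one before the
first diagonal, which makes the relation invariant under reading the strip from its other ear. -/
theorem bottomR {rs ls : List ℕ} (h : DualChains rs ls) :
    ∀ (ls' : List ℕ) (l : ℕ), ls = ls' ++ [l] → DualChains (rs ++ [2]) (ls' ++ [l + 1]) := by
  induction h with
  | base =>
    intro ls' l h
    have h' : ([] : List ℕ) ++ [2] = ls' ++ [l] := h
    obtain ⟨rfl, h2⟩ := List.append_inj' h' rfl
    obtain rfl : 2 = l := by simpa using h2
    exact stepR (rs := [2]) base
  | @stepR rs ls l₀ h ih =>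
    intro ls' l he
    cases ls' with
    | nil =>
      obtain ⟨rfl, rfl⟩ : l₀ + 1 = l ∧ ls = [] := by simpa using he
      exact stepR (ls := []) (ih [] l₀ rfl)
    | cons x ls' =>
      obtain ⟨rfl, rfl⟩ : l₀ + 1 = x ∧ ls = ls' ++ [l] := by simpa using he
      exact stepR (ih (l₀ :: ls') l rfl)
  | @stepL rs ls r h ih =>
    intro ls' l he
    cases ls' with
    | nil =>
      have : ls = [] := by
        have := congrArg List.length he
        simpa using this
      exact absurd this h.ne_nil.2
    | cons x ls' =>
      obtain ⟨rfl, rfl⟩ : 2 = x ∧ ls = ls' ++ [l] := by simpa using he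
      have := ih ls' l rfl
      rw [List.cons_append] at this
      exact stepL this

theorem bottomL {rs ls rs' : List ℕ} {r : ℕ} (h : DualChains rs ls) (hr : rs = rs' ++ [r]) :
    DualChains (rs' ++ [r + 1]) (ls ++ [2]) :=
  (h.symm.bottomR rs' r hr).symm

theorem reverse {rs ls : List ℕ} (h : DualChains rs ls) : DualChains rs.reverse ls.reverse := by
  induction h with
  | base => exact base
  | stepR _ ih =>
    simp only [List.reverse_cons] at ih ⊢
    exact ih.bottomR _ _ rfl
  | stepL _ ih =>
    simp only [List.reverse_cons] at ih ⊢
    exact ih.bottomL rfl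

/-- Here the strip is cut at the vertex of its second side next to the first ear. That vertex
survives the removal of triangles at the opposite ear, so the induction goes through; the remaining
case of `isZeroChain` reduces to this one. -/
theorem isZeroChain_of_last {a b : List ℕ} (h : DualChains a b) :
    ∀ (Y : List ℕ) (x : ℕ), b = Y ++ [x] → IsZeroChain (Y.reverse ++ 1 :: a ++ [1]) := by
  induction h with
  | base =>
    intro Y x h
    have h' : ([] : List ℕ) ++ [2] = Y ++ [x] := h
    obtain ⟨rfl, -⟩ := List.append_inj' h' rfl
    simp [IsZeroChain, ContPos, contPair]
  | @stepR a b l h ih =>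
    intro Y x he
    cases Y with
    | nil =>
      obtain ⟨rfl, rfl⟩ : l + 1 = x ∧ b = [] := by simpa using he
      have := ih [] l rfl
      simpa using IsZeroChain.blowUp_head (b := 1) (T := a ++ [1]) (by simpa using this)
    | cons y Y =>
      obtain ⟨rfl, rfl⟩ : l + 1 = y ∧ b = Y ++ [x] := by simpa using he
      have := ih (l :: Y) x rfl
      have h2 := (isZeroChain_blowUp Y.reverse l 1 (a ++ [1])).2 (by simpa using this)
      simpa using h2
  | @stepL a b r h ih =>
    intro Y x he
    cases Y with
    | nil =>
      have : b = [] := by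
        have := congrArg List.length he
        simpa using this
      exact absurd this h.ne_nil.2
    | cons y Y =>
      obtain ⟨rfl, rfl⟩ : 2 = y ∧ b = Y ++ [x] := by simpa using he
      have := ih Y x rfl
      have h2 := (isZeroChain_blowUp Y.reverse 1 r (a ++ [1])).2 (by simpa using this)
      simpa using h2

/-- Cutting a cyclic accordion chain at a vertex on one of its sides yields a zero chain. -/
theorem isZeroChain {rs ls : List ℕ} (h : DualChains rs ls) :
    ∀ (X : List ℕ) (x : ℕ) (Y : List ℕ), ls = X ++ x :: Y →
      IsZeroChain (Y ++ 1 :: rs.reverse ++ 1 :: X) := by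
  induction h with
  | base =>
    intro X x Y h
    have h1 : X = [] ∧ Y = [] := by
      have := congrArg List.length h
      simp only [List.length_cons, List.length_nil, List.length_append] at this
      constructor <;> apply List.length_eq_zero_iff.1 <;> omega
    obtain ⟨rfl, rfl⟩ := h1
    simp [IsZeroChain, ContPos, contPair]
  | @stepR rs ls l h ih =>
    intro X x Y he
    cases X with
    | nil =>
      obtain ⟨rfl, rfl⟩ : l + 1 = x ∧ ls = Y := by simpa using he
      have := ih [] l ls rfl
      have h2 := (isZeroChain_blowUp_last (ls ++ 1 :: rs.reverse) 1).2 (by simpa using this)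
      simpa using h2
    | cons y X =>
      obtain ⟨rfl, rfl⟩ : l + 1 = y ∧ ls = X ++ x :: Y := by simpa using he
      have := ih (l :: X) x Y rfl
      have h2 := (isZeroChain_blowUp (Y ++ 1 :: rs.reverse) 1 l X).2 (by simpa using this)
      simpa using h2
  | @stepL rs ls r h ih =>
    intro X x Y he
    cases X with
    | nil =>
      obtain ⟨rfl, rfl⟩ : 2 = x ∧ ls = Y := by simpa using he
      -- Removing the last triangle would turn the cut vertex into an ear, out of reach of the
      -- induction hypothesis. After reversal it is the last vertex of its side.
      have := (stepL h).reverse.isZeroChain_of_last ls.reverse 2 (by simp)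
      simpa using this
    | cons y X =>
      obtain ⟨rfl, rfl⟩ : 2 = y ∧ ls = X ++ x :: Y := by simpa using he
      have := ih X x Y rfl
      have h2 := (isZeroChain_blowUp (Y ++ 1 :: rs.reverse) r 1 X).2 (by simpa using this)
      simpa using h2

theorem replicate_two (k : ℕ) : DualChains (List.replicate (k + 1) 2) [k + 2] := by
  induction k with
  | zero => exact base
  | succ k ih => exact stepR ih

end DualChains

/-! ### Zero chains with one or two entries `1` -/

/-- A triangulation has two ears, so with one visible ear the hidden vertex should be the other.
Arithmetically: the `1` is not at an end of the chain, and removing it lowers the length by `1` and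
the sum by `3`, so the hidden index is unchanged. A single `1` remains until `[1, 1]` is reached. -/
theorem hiddenIndex_eq_one_of_single_one (N : ℕ) : ∀ (A C : List ℕ), A.length + C.length = N →
    (∀ e ∈ A, 2 ≤ e) → (∀ e ∈ C, 2 ≤ e) → IsZeroChain (A ++ 1 :: C) →
    hiddenIndex (A ++ 1 :: C) = 1 := by
  induction N using Nat.strong_induction_on with
  | _ N ih =>
    intro A C hN hA hC hz
    rcases List.eq_nil_or_concat' A with rfl | ⟨A', a, rfl⟩
    · exfalso
      have h1 := hz.1
      have h2 := contPair_of_two_le hC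
      simp only [List.nil_append, contPair_cons] at h1
      push_cast at h1
      omega
    · cases C with
      | nil =>
        exfalso
        have ha : 2 ≤ a := hA a (by simp)
        have h1 := contPair_append_of_two_le (A := A') (T := [a, 1])
          (fun e he => hA e (by simp [he])) (by simp [contPair]; omega) (by simp [contPair]; omega)
        have h2 := hz.1
        rw [List.append_assoc] at h2
        simp only [List.cons_append, List.nil_append] at h2
        omega
      | cons g C' =>
        obtain ⟨a, rfl⟩ : ∃ a', a = a' + 1 := ⟨a - 1, by have := hA a (by simp); omega⟩
        obtain ⟨g, rfl⟩ : ∃ g', g = g' + 1 := ⟨g - 1, by have := hC g (by simp); omega⟩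
        have ha : 2 ≤ a + 1 := hA _ (by simp)
        have hg : 2 ≤ g + 1 := hC _ (by simp)
        have hA' : ∀ e ∈ A', 2 ≤ e := fun e he => hA e (by simp [he])
        have hC' : ∀ e ∈ C', 2 ≤ e := fun e he => hC e (by simp [he])
        have hz' := (isZeroChain_blowUp A' a g C').1 (by simpa using hz)
        simp only [List.length_append, List.length_cons, List.length_nil] at hN
        by_cases ha1 : a = 1
        · subst ha1
          by_cases hg1 : g = 1
          · subst hg1
            obtain ⟨rfl, rfl⟩ := hz'.eq_nil_of_one_one
            simp [hiddenIndex]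
          · have := ih (A'.length + (g :: C').length) (by simp only [List.length_cons]; omega) A'
              (g :: C') rfl hA' (by simpa using ⟨by omega, hC'⟩) hz'
            rw [← this]
            simp [hiddenIndex]
            ring
        · by_cases hg1 : g = 1
          · subst hg1
            have := ih ((A' ++ [a]).length + C'.length)
              (by simp only [List.length_append, List.length_cons, List.length_nil]; omega)
              (A' ++ [a]) C' rfl (by
                intro e he
                rcases List.mem_append.1 he with he | he
                · exact hA' e he
                · obtain rfl : e = a := by simpa using he
                  omega) hC' (by simpa using hz')
            rw [← this]
            simp [hiddenIndex]
            ring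
          · exfalso
            refine not_isZeroChain_of_two_le ?_ hz'
            intro e he
            simp only [List.mem_append, List.mem_cons] at he
            rcases he with he | rfl | rfl | he
            · exact hA' e he
            · omega
            · omega
            · exact hC' e he

/-- For `p ≥ r > 0`, an equality `b * p - r = p` with `b ≥ 2` is only possible if `b = 2` and `p =
r`. This is the case of a single fan centred at the hidden vertex. -/
theorem eq_replicate_of_contPair {B : List ℕ} (hB : ∀ e ∈ B, 2 ≤ e)
    (h : (contPair (B ++ [1])).1 = (contPair (B ++ [1])).2) : B = List.replicate B.length 2 := by
  induction B with
  | nil => rfl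
  | cons b B ih =>
    have hB' : ∀ e ∈ B, 2 ≤ e := fun e he => hB e (List.mem_cons_of_mem _ he)
    obtain ⟨h1, h2⟩ := contPair_append_of_two_le (T := [1]) hB' (by simp [contPair])
      (by simp [contPair])
    have hb : (2 : ℤ) ≤ b := by exact_mod_cast hB b List.mem_cons_self
    rw [List.cons_append, contPair_cons] at h
    simp only at h
    have h3 : (b : ℤ) = 2 := by nlinarith
    have h4 : b = 2 := by exact_mod_cast h3
    subst h4
    have h5 := ih hB' (by push_cast at h; linarith)
    rw [List.length_cons, List.replicate_succ, ← h5]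

/-- A zero chain with exactly two entries `1` and hidden index at least `2` comes from an
accordion. -/
theorem dualChains_of_isZeroChain (N : ℕ) : ∀ (A B C : List ℕ) (x : ℕ),
    A.length + B.length + C.length = N →
    (∀ e ∈ A, 2 ≤ e) → (∀ e ∈ B, 2 ≤ e) → (∀ e ∈ C, 2 ≤ e) →
    IsZeroChain (A ++ 1 :: B ++ 1 :: C) → hiddenIndex (A ++ 1 :: B ++ 1 :: C) = x → 2 ≤ x →
    DualChains B.reverse (C ++ x :: A) := by
  induction N using Nat.strong_induction_on with
  | _ N ih =>
    intro A B C x hN hA hB hC hz hx hx2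
    -- Adjacent entries `1` occur only in `[1, 1]`, which has hidden index `1`.
    have hBne : B ≠ [] := by
      rintro rfl
      obtain ⟨rfl, rfl⟩ := IsZeroChain.eq_nil_of_one_one (A := A) (C := C) (by simpa using hz)
      simp [hiddenIndex] at hx
      omega
    cases C with
    | cons g C' =>
      obtain ⟨B', b, rfl⟩ := (List.eq_nil_or_concat' B).resolve_left hBne
      obtain ⟨b, rfl⟩ : ∃ b', b = b' + 1 := ⟨b - 1, by have := hB b (by simp); omega⟩
      obtain ⟨g, rfl⟩ : ∃ g', g = g' + 1 := ⟨g - 1, by have := hC g (by simp); omega⟩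
      have hb : 2 ≤ b + 1 := hB _ (by simp)
      have hg : 2 ≤ g + 1 := hC _ (by simp)
      have hB' : ∀ e ∈ B', 2 ≤ e := fun e he => hB e (by simp [he])
      have hC' : ∀ e ∈ C', 2 ≤ e := fun e he => hC e (by simp [he])
      -- The ear between `B` and `C` is removed. If neither neighbour becomes `1`, a single `1` is
      -- left and the hidden index is `1`; if both do, two adjacent entries `1` occur in too long a
      -- chain. So exactly one does, and this is one step of an accordion.
      have hz' := (isZeroChain_blowUp (A ++ 1 :: B') b g C').1 (by simpa using hz)
      simp only [List.length_append, List.length_cons, List.length_nil] at hN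
      by_cases hb1 : b = 1
      · subst hb1
        by_cases hg1 : g = 1
        · subst hg1
          have := hz'.eq_nil_of_one_one
          simp at this
        · have := ih (A.length + B'.length + (g :: C').length)
            (by simp only [List.length_cons]; omega) A B' (g :: C') x rfl hA hB'
            (by simpa using ⟨by omega, hC'⟩) (by simpa using hz')
            (by rw [← hx]; simp [hiddenIndex]; ring) hx2
          simpa using this.stepR
      · by_cases hg1 : g = 1
        · subst hg1
          have := ih (A.length + (B' ++ [b]).length + C'.length)
            (by simp only [List.length_append, List.length_cons, List.length_nil]; omega)
            A (B' ++ [b]) C' x rfl hA (by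
              intro e he
              rcases List.mem_append.1 he with he | he
              · exact hB' e he
              · obtain rfl : e = b := by simpa using he
                omega) hC' (by simpa using hz') (by rw [← hx]; simp [hiddenIndex]; ring) hx2
          rw [List.reverse_append] at this ⊢
          exact DualChains.stepL this
        · exfalso
          have h1 := hiddenIndex_eq_one_of_single_one _ A (B' ++ b :: g :: C') rfl hA (by
            intro e he
            simp only [List.mem_append, List.mem_cons] at he
            rcases he with he | rfl | rfl | he
            · exact hB' e he
            · omega
            · omega
            · exact hC' e he) (by simpa using hz')
          have h2 : hiddenIndex (A ++ 1 :: (B' ++ b :: g :: C')) = x := by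
            rw [← hx]; simp [hiddenIndex]; ring
          omega
    | nil =>
      rcases List.eq_nil_or_concat' A with rfl | ⟨A', a, rfl⟩
      -- The hidden vertex is alone on its side, so all diagonals start from it and `B` consists of
      -- entries `2`.
      · obtain ⟨h1, h2⟩ := contPair_append_of_two_le (T := [1]) hB (by simp [contPair])
          (by simp [contPair])
        have h3 := hz.1
        simp only [List.nil_append, List.cons_append, contPair_cons] at h3
        have h4 := eq_replicate_of_contPair hB (by push_cast at h3; linarith)
        obtain ⟨k, hk⟩ : ∃ k, B.length = k + 1 := Nat.exists_eq_succ_of_ne_zero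
          fun h => hBne (List.length_eq_zero_iff.1 h)
        rw [hk] at h4
        subst h4
        have h5 : x = k + 2 := by
          have h6 : (x : ℤ) = k + 2 := by
            rw [← hx]; simp [hiddenIndex]; ring
          exact_mod_cast h6
        subst h5
        simpa using DualChains.replicate_two k
      · obtain ⟨b, B', rfl⟩ := List.exists_cons_of_ne_nil hBne
        obtain ⟨b, rfl⟩ : ∃ b', b = b' + 1 := ⟨b - 1, by have := hB b (by simp); omega⟩
        obtain ⟨a, rfl⟩ : ∃ a', a = a' + 1 := ⟨a - 1, by have := hA a (by simp); omega⟩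
        have hb : 2 ≤ b + 1 := hB _ (by simp)
        have ha : 2 ≤ a + 1 := hA _ (by simp)
        have hB' : ∀ e ∈ B', 2 ≤ e := fun e he => hB e (by simp [he])
        have hA' : ∀ e ∈ A', 2 ≤ e := fun e he => hA e (by simp [he])
        -- The second `1` ends the chain, so the other ear is removed instead, and the dual chains
        -- grow at their far ends.
        have hz' := (isZeroChain_blowUp A' a b (B' ++ [1])).1 (by simpa using hz)
        simp only [List.length_append, List.length_cons, List.length_nil] at hN
        by_cases ha1 : a = 1
        · subst ha1
          by_cases hb1 : b = 1
          · subst hb1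
            have := hz'.eq_nil_of_one_one
            simp at this
          · have := ih (A'.length + (b :: B').length + 0)
              (by simp only [List.length_cons]; omega) A' (b :: B') [] x rfl hA'
              (by simpa using ⟨by omega, hB'⟩) (by simp) (by simpa using hz')
              (by rw [← hx]; simp [hiddenIndex]; ring) hx2
            rw [List.reverse_cons] at this ⊢
            simpa using this.bottomL rfl
        · by_cases hb1 : b = 1
          · subst hb1
            have := ih ((A' ++ [a]).length + B'.length + 0)
              (by simp only [List.length_append, List.length_cons, List.length_nil]; omega)
              (A' ++ [a]) B' [] x rfl (by
                intro e he
                rcases List.mem_append.1 he with he | he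
                · exact hA' e he
                · obtain rfl : e = a := by simpa using he
                  omega) hB' (by simp) (by simpa using hz')
              (by rw [← hx]; simp [hiddenIndex]; ring) hx2
            simpa using this.bottomR (x :: A') a (by simp)
          · exfalso
            have h1 := hiddenIndex_eq_one_of_single_one _ (A' ++ a :: b :: B') [] rfl (by
              intro e he
              simp only [List.mem_append, List.mem_cons] at he
              rcases he with he | rfl | rfl | he
              · exact hA' e he
              · omega
              · omega
              · exact hB' e he) (by simp) (by simpa using hz')
            have h2 : hiddenIndex ((A' ++ a :: b :: B') ++ [1]) = x := by
              rw [← hx]; simp [hiddenIndex]; ring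
            omega

/-! ### Dual fractions and WW-decompositions -/

theorem one_lt_hjValue {k : List ℕ} (hk : ∀ e ∈ k, 2 ≤ e) (hne : k ≠ []) : 1 < hjValue k := by
  have hp := contPos_of_two_le hk
  rw [hp.hjValue_eq hne, one_lt_div (by exact_mod_cast hp.snd_pos hne)]
  exact_mod_cast contPair_of_two_le hk

/-- Thus the first entry is the ceiling of the value, which makes expansions with entries at least
`2` unique. -/
theorem hjValue_cons_le {e : ℕ} {t : List ℕ} (ht : ∀ e ∈ t, 2 ≤ e) :
    (e : ℚ) - 1 < hjValue (e :: t) ∧ hjValue (e :: t) ≤ e := by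
  by_cases hne : t = []
  · subst hne
    simp [hjValue]
  · rw [hjValue_cons e hne]
    have h1 := one_lt_hjValue ht hne
    have h2 : 0 < 1 / hjValue t := by positivity
    have h3 : 1 / hjValue t < 1 := by
      rw [div_lt_one (by linarith)]
      exact h1
    constructor <;> linarith

/-- A Hirzebruch-Jung continued fraction with entries at least `2` is determined by its value. -/
theorem eq_of_hjValue_eq {k k' : List ℕ} (hk : ∀ e ∈ k, 2 ≤ e) (hk' : ∀ e ∈ k', 2 ≤ e)
    (hne : k ≠ []) (hne' : k' ≠ []) (h : hjValue k = hjValue k') : k = k' := by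
  induction k generalizing k' with
  | nil => exact absurd rfl hne
  | cons e t ih =>
    cases k' with
    | nil => exact absurd rfl hne'
    | cons e' t' =>
      have ht : ∀ e ∈ t, 2 ≤ e := fun a ha => hk a (List.mem_cons_of_mem _ ha)
      have ht' : ∀ e ∈ t', 2 ≤ e := fun a ha => hk' a (List.mem_cons_of_mem _ ha)
      obtain ⟨a1, a2⟩ := hjValue_cons_le (e := e) ht
      obtain ⟨b1, b2⟩ := hjValue_cons_le (e := e') ht'
      have h1 : (e : ℚ) < e' + 1 := by linarith
      have h2 : (e' : ℚ) < e + 1 := by linarith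
      have he : e = e' := by
        have h1' : e < e' + 1 := by exact_mod_cast h1
        have h2' : e' < e + 1 := by exact_mod_cast h2
        omega
      subst he
      by_cases h3 : t = []
      · by_cases h4 : t' = []
        · rw [h3, h4]
        · exfalso
          subst h3
          rw [hjValue_cons e h4] at h
          have := one_lt_hjValue ht' h4
          have h2 : 0 < 1 / hjValue t' := by positivity
          simp only [hjValue] at h
          linarith
      · by_cases h4 : t' = []
        · exfalso
          subst h4
          rw [hjValue_cons e h3] at h
          have := one_lt_hjValue ht h3
          have h2 : 0 < 1 / hjValue t := by positivity
          simp only [hjValue] at h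
          linarith
        · rw [hjValue_cons e h3, hjValue_cons e h4] at h
          have h5 : (hjValue t)⁻¹ = (hjValue t')⁻¹ := by
            rw [← one_div, ← one_div]
            linarith
          rw [ih ht ht' h3 h4 (inv_inj.1 h5)]

theorem IsDualChain.unique {Δ q : ℕ} {k k' : List ℕ} (h : IsDualChain Δ q k)
    (h' : IsDualChain Δ q k') : k = k' :=
  eq_of_hjValue_eq h.2.1 h'.2.1 h.1.1 h'.1.1 (h.2.2.trans h'.2.2.symm)

theorem admitsHJ_of_two_le {k : List ℕ} (hk : ∀ e ∈ k, 2 ≤ e) (hne : k ≠ []) : AdmitsHJ k := by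
  refine ⟨hne, fun e he => by have := hk e he; omega, fun t ht htne => ?_, ?_⟩
  · refine zero_lt_one.trans (one_lt_hjValue (fun e he => hk e ?_) htne)
    exact List.mem_of_mem_tail (ht.subset he)
  · exact (zero_lt_one.trans (one_lt_hjValue hk hne)).le

/-- Every list with entries at least `2` is the dual chain of a cyclic quotient singularity. -/
theorem exists_isDualChain {k : List ℕ} (hk : ∀ e ∈ k, 2 ≤ e) (hne : k ≠ []) :
    ∃ Δ q : ℕ, 0 < q ∧ q < Δ ∧ Nat.Coprime q Δ ∧ IsDualChain Δ q k := by
  have h1 := one_lt_hjValue hk hne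
  set r := hjValue k with hr
  have hnum : 0 < r.num := Rat.num_pos.2 (by linarith)
  have hlt : (r.den : ℤ) < r.num := by
    have h2 : (1 : ℚ) < r.num / r.den := by rwa [Rat.num_div_den]
    rw [one_lt_div (by exact_mod_cast r.den_pos)] at h2
    exact_mod_cast h2
  have hna : (r.num.natAbs : ℤ) = r.num := Int.natAbs_of_nonneg hnum.le
  have hden := r.den_pos
  have hle : r.den ≤ r.num.natAbs := by omega
  refine ⟨r.num.natAbs, r.num.natAbs - r.den, by omega, by omega, ?_,
    admitsHJ_of_two_le hk hne, hk, ?_⟩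
  · rw [Nat.coprime_comm]
    have := r.reduced
    rw [Nat.coprime_self_sub_right hle]
    exact this
  · rw [Nat.cast_sub hle, sub_sub_cancel]
    have h3 : ((r.num.natAbs : ℕ) : ℚ) = (r.num : ℚ) := by
      rw [← hna, Int.cast_natCast, hna]
    rw [h3, Rat.num_div_den]

theorem modify_append_cons (f : ℕ → ℕ) (A : List ℕ) (x : ℕ) (B : List ℕ) :
    (A ++ x :: B).modify A.length f = A ++ f x :: B := by
  induction A with
  | nil => rfl
  | cons a A ih => simpa using ih

theorem exists_eq_append_cons {l : List ℕ} {α : ℕ} (h : α < l.length) :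
    ∃ A x B, l = A ++ x :: B ∧ A.length = α := by
  refine ⟨l.take α, l[α], l.drop (α + 1), ?_, by simp; omega⟩
  rw [List.getElem_cons_drop, List.take_append_drop]

/-- A WW-decomposition of `k`, with the two modified entries displayed. -/
theorem isWWDecomposition_iff (k c : List ℕ) :
    IsWWDecomposition k c ↔ (∀ e ∈ k, 1 < e) ∧ (∃ A x B y C, k = A ++ x :: B ++ y :: C ∧
      c = A ++ (x - 1) :: B ++ (y - 1) :: C) ∧ IsZeroFraction c := by
  unfold IsWWDecomposition
  refine and_congr_right fun _ => and_congr_left fun _ => ?_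
  constructor
  · rintro ⟨α, β, hαβ, hβ, rfl⟩
    obtain ⟨A, x, D, rfl, rfl⟩ := exists_eq_append_cons (hαβ.trans hβ)
    obtain ⟨β, rfl⟩ : ∃ b, β = A.length + 1 + b := ⟨β - (A.length + 1), by omega⟩
    obtain ⟨B, y, C, rfl, rfl⟩ := exists_eq_append_cons (l := D) (α := β)
      (by simp only [List.length_append, List.length_cons] at hβ; omega)
    refine ⟨A, x, B, y, C, by simp, ?_⟩
    rw [modify_append_cons]
    have := modify_append_cons (fun e => e - 1) (A ++ (x - 1) :: B) y C
    simp only [List.length_append, List.length_cons, List.append_assoc, List.cons_append] at this ⊢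
    rw [← this]
    congr 1
    omega
  · rintro ⟨A, x, B, y, C, rfl, rfl⟩
    refine ⟨A.length, A.length + 1 + B.length, by omega, by simp; omega, ?_⟩
    have h1 := modify_append_cons (fun e => e - 1) A x (B ++ y :: C)
    have h2 := modify_append_cons (fun e => e - 1) (A ++ (x - 1) :: B) y C
    simp only [List.length_append, List.length_cons, List.append_assoc, List.cons_append] at *
    rw [h1, ← h2]
    congr 1
    omega

theorem map_max_two_of_two_le {l : List ℕ} (h : ∀ e ∈ l, 2 ≤ e) : l.map (max 2) = l := by
  conv_rhs => rw [← List.map_id l]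
  exact List.map_congr_left fun e he => max_eq_right (h e he)

/-- Since the right-hand side involves only `k`, all WW-decompositions of a dual chain share their
hidden index. -/
theorem hiddenIndex_eq_of_isWWDecomposition {k c : List ℕ} (h : IsWWDecomposition k c) :
    hiddenIndex c = 3 * ((k.length : ℤ) - 1) - k.sum + 2 := by
  obtain ⟨hk, ⟨A, x, B, y, C, rfl, rfl⟩, -⟩ := (isWWDecomposition_iff k c).1 h
  have hx : 1 < x := hk x (by simp)
  have hy : 1 < y := hk y (by simp)
  simp only [hiddenIndex, List.length_append, List.length_cons, List.sum_append, List.sum_cons]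
  push_cast
  rw [Nat.cast_sub hx.le, Nat.cast_sub hy.le]
  push_cast
  ring

theorem isZeroFraction_of_dualChains {A B C : List ℕ} {x : ℕ}
    (h : DualChains B.reverse (C ++ x :: A)) : IsZeroFraction (A ++ 1 :: B ++ 1 :: C) := by
  rw [isZeroFraction_iff]
  refine ⟨by simp, fun e he => ?_, by simpa using h.isZeroChain C x A rfl⟩
  have h1 := h.two_le
  simp only [List.mem_append, List.mem_cons, List.mem_reverse] at he h1
  rcases he with (he | rfl | he) | rfl | he
  · have := h1.2 e (Or.inr (Or.inr he)); omega
  · omega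
  · have := h1.1 e he; omega
  · omega
  · have := h1.2 e (Or.inl he); omega

theorem hiddenIndex_of_dualChains {A B C : List ℕ} {x : ℕ}
    (h : DualChains B.reverse (C ++ x :: A)) : hiddenIndex (A ++ 1 :: B ++ 1 :: C) = x := by
  have := h.sum_eq
  simp only [hiddenIndex, List.length_append, List.length_cons, List.sum_append, List.sum_cons,
    List.length_reverse, List.sum_reverse] at *
  omega

theorem isWWDecomposition_of_dualChains {A B C : List ℕ} {x : ℕ}
    (h : DualChains B.reverse (C ++ x :: A)) :
    IsWWDecomposition ((A ++ 1 :: B ++ 1 :: C).map (max 2)) (A ++ 1 :: B ++ 1 :: C) := by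
  rw [isWWDecomposition_iff]
  refine ⟨fun e he => ?_, ⟨A, 2, B, 2, C, ?_, rfl⟩, isZeroFraction_of_dualChains h⟩
  · obtain ⟨a, -, rfl⟩ := List.mem_map.1 he
    exact lt_of_lt_of_le one_lt_two (le_max_left 2 a)
  · have h1 := h.two_le
    simp only [List.mem_append, List.mem_cons, List.mem_reverse] at h1
    rw [List.map_append, List.map_append, List.map_cons, List.map_cons,
      map_max_two_of_two_le fun e he => h1.2 e (Or.inr (Or.inr he)),
      map_max_two_of_two_le fun e he => h1.1 e he,
      map_max_two_of_two_le fun e he => h1.2 e (Or.inl he)]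
    rfl

/-- A WW-decomposition with hidden index at least `2` comes from an accordion, and `k` can be
recovered from it. -/
theorem exists_dualChains_of_isWWDecomposition {k c : List ℕ} {x : ℕ} (h : IsWWDecomposition k c)
    (hx : hiddenIndex c = x) (hx2 : 2 ≤ x) :
    c.map (max 2) = k ∧ ∃ A B C, c = A ++ 1 :: B ++ 1 :: C ∧ DualChains B.reverse (C ++ x :: A) := by
  obtain ⟨hk, ⟨A, u, B, v, C, rfl, rfl⟩, hz⟩ := (isWWDecomposition_iff k c).1 h
  obtain ⟨-, -, hz⟩ := (isZeroFraction_iff _).1 hz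
  have hA : ∀ e ∈ A, 2 ≤ e := fun e he => hk e (by simp [he])
  have hB : ∀ e ∈ B, 2 ≤ e := fun e he => hk e (by simp [he])
  have hC : ∀ e ∈ C, 2 ≤ e := fun e he => hk e (by simp [he])
  obtain ⟨u, rfl⟩ : ∃ u', u = u' + 1 := ⟨u - 1, by have := hk u (by simp); omega⟩
  obtain ⟨v, rfl⟩ : ∃ v', v = v' + 1 := ⟨v - 1, by have := hk v (by simp); omega⟩
  have hu : 1 < u + 1 := hk _ (by simp)
  have hv : 1 < v + 1 := hk _ (by simp)
  simp only [Nat.add_sub_cancel] at *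
  have hsplit : ∀ {A B : List ℕ} {u : ℕ}, (∀ e ∈ A, 2 ≤ e) → (∀ e ∈ B, 2 ≤ e) → 2 ≤ u →
      ∀ e ∈ A ++ u :: B, 2 ≤ e := by
    intro A B u hA hB hu e he
    simp only [List.mem_append, List.mem_cons] at he
    rcases he with he | rfl | he
    · exact hA e he
    · exact hu
    · exact hB e he
  -- With fewer than two entries `1` the chain would have hidden index `1` or would not be a zero
  -- chain. So both lowered entries were equal to `2`.
  by_cases hu1 : u = 1
  · by_cases hv1 : v = 1
    · subst hu1 hv1
      refine ⟨?_, A, B, C, rfl, dualChains_of_isZeroChain _ A B C x rfl hA hB hC hz hx hx2⟩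
      rw [List.map_append, List.map_append, List.map_cons, List.map_cons,
        map_max_two_of_two_le hA, map_max_two_of_two_le hB, map_max_two_of_two_le hC]
      rfl
    · exfalso
      subst hu1
      rw [List.append_assoc, List.cons_append] at hz hx
      have := hiddenIndex_eq_one_of_single_one _ A (B ++ v :: C) rfl hA
        (hsplit hB hC (by omega)) hz
      omega
  · exfalso
    by_cases hv1 : v = 1
    · subst hv1
      have := hiddenIndex_eq_one_of_single_one _ (A ++ u :: B) C rfl
        (hsplit hA hB (by omega)) hC hz
      omega
    · exact not_isZeroChain_of_two_le (hsplit (hsplit hA hB (by omega)) hC (by omega)) hz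

/-! ### Lattice paths and strips -/

/-- A lattice path with `M` steps: `q J` counts the steps of the first kind among the first `J`
steps, and `J - q J` those of the second kind. -/
structure IsPath (M : ℕ) (q : ℕ → ℕ) : Prop where
  zero : q 0 = 0
  step : ∀ J < M, q (J + 1) = q J ∨ q (J + 1) = q J + 1

namespace IsPath

variable {M : ℕ} {q : ℕ → ℕ}

/-- Both step counts, `q J` and `J - q J`, are monotone; the second inequality says this without
truncated subtraction. -/
theorem mono_lip (h : IsPath M q) {J J' : ℕ} (hJ : J ≤ J') (hM : J' ≤ M) :
    q J ≤ q J' ∧ q J' + J ≤ q J + J' := by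
  induction J' with
  | zero =>
    obtain rfl : J = 0 := by omega
    omega
  | succ n ih =>
    rcases Nat.lt_or_ge n J with h1 | h1
    · obtain rfl : J = n + 1 := by omega
      omega
    · have := ih h1 (by omega)
      have := h.step n (by omega)
      omega

theorem le_self (h : IsPath M q) {J : ℕ} (hM : J ≤ M) : q J ≤ J := by
  have := (h.mono_lip (Nat.zero_le J) hM).2
  rw [h.zero] at this
  omega

theorem exists_eq (h : IsPath M q) {k : ℕ} (hk : k ≤ q M) : ∃ J ≤ M, q J = k := by
  by_contra hne
  push Not at hne
  have : ∀ J ≤ M, q J < k := by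
    intro J
    induction J with
    | zero =>
      intro _
      have := hne 0 (Nat.zero_le _)
      rw [h.zero] at *
      omega
    | succ n ih =>
      intro hn
      have := ih (by omega)
      have := h.step n (by omega)
      have := hne (n + 1) hn
      omega
  have := this M le_rfl
  omega

theorem exists_sub_eq (h : IsPath M q) {k : ℕ} (hk : k ≤ M - q M) : ∃ J ≤ M, J - q J = k := by
  by_contra hne
  push Not at hne
  have : ∀ J ≤ M, J - q J < k := by
    intro J
    induction J with
    | zero =>
      intro _
      have := hne 0 (Nat.zero_le _)
      omega
    | succ n ih =>
      intro hn
      have := ih (by omega)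
      have := h.step n (by omega)
      have := hne (n + 1) hn
      have := h.le_self (J := n) (by omega)
      omega
  have := this M le_rfl
  omega

theorem of_succ (h : IsPath (M + 1) q) : IsPath M q :=
  ⟨h.zero, fun J hJ => h.step J (by omega)⟩

/-- The path read backwards, with the two kinds of steps exchanged. -/
theorem reverse (h : IsPath M q) : IsPath M fun J => (M - q M) - ((M - J) - q (M - J)) := by
  have hM := h.le_self (le_refl M)
  refine ⟨by simp, fun J hJ => ?_⟩
  have h1 := h.step (M - (J + 1)) (by omega)
  have h2 : M - (J + 1) + 1 = M - J := by omega
  rw [h2] at h1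
  have h3 := h.mono_lip (J := M - (J + 1)) (J' := M) (by omega) le_rfl
  have h4 := h.mono_lip (J := M - J) (J' := M) (by omega) le_rfl
  have h5 := h.le_self (J := M - (J + 1)) (by omega)
  have h6 := h.le_self (J := M - J) (by omega)
  omega

end IsPath

theorem add_natCast_inj {N : ℕ} (e : ZMod N) {s t : ℕ} (hs : s < N) (ht : t < N) :
    e + (s : ZMod N) = e + (t : ZMod N) ↔ s = t := by
  rw [add_right_inj, ZMod.natCast_eq_natCast_iff', Nat.mod_eq_of_lt hs, Nat.mod_eq_of_lt ht]

theorem exists_eq_add_natCast {N : ℕ} [NeZero N] (e v : ZMod N) :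
    ∃ t < N, v = e + (t : ZMod N) := by
  refine ⟨(v - e).val, ZMod.val_lt _, ?_⟩
  rw [ZMod.natCast_val, ZMod.cast_id', id]
  ring

theorem val_add_natCast {N : ℕ} [NeZero N] (e : ZMod N) {t : ℕ} (ht : t < N) :
    (e + (t : ZMod N)).val = e.val + t ∨
      ((e + (t : ZMod N)).val + N = e.val + t) := by
  rw [ZMod.val_add, ZMod.val_natCast, Nat.mod_eq_of_lt ht]
  have he := ZMod.val_lt e
  rcases Nat.lt_or_ge (e.val + t) N with h | h
  · left; exact Nat.mod_eq_of_lt h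
  · right
    rw [Nat.mod_eq_sub_mod h, Nat.mod_eq_of_lt (by omega)]
    omega

/-- Whether two chords cross can be tested after a rotation of the polygon. -/
theorem chordsCross_add_iff {s : ℕ} (e : ZMod (s + 1)) {a b c d : ℕ} (ha : a < s + 1)
    (hb : b < s + 1) (hc : c < s + 1) (hd : d < s + 1) :
    ChordsCross (e + (a : ZMod (s + 1))) (e + (b : ZMod (s + 1))) (e + (c : ZMod (s + 1)))
      (e + (d : ZMod (s + 1))) ↔
    (min a b < c ∧ c < max a b ∧ (d < min a b ∨ max a b < d)) ∨
    (min a b < d ∧ d < max a b ∧ (c < min a b ∨ max a b < c)) := by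
  unfold ChordsCross
  have h1 := val_add_natCast e ha
  have h2 := val_add_natCast e hb
  have h3 := val_add_natCast e hc
  have h4 := val_add_natCast e hd
  have h1' := ZMod.val_lt (e + (a : ZMod (s + 1)))
  have h2' := ZMod.val_lt (e + (b : ZMod (s + 1)))
  have h3' := ZMod.val_lt (e + (c : ZMod (s + 1)))
  have h4' := ZMod.val_lt (e + (d : ZMod (s + 1)))
  have he := ZMod.val_lt e
  generalize (e + (a : ZMod (s + 1))).val = a' at *
  generalize (e + (b : ZMod (s + 1))).val = b' at *
  generalize (e + (c : ZMod (s + 1))).val = c' at *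
  generalize (e + (d : ZMod (s + 1))).val = d' at *
  generalize e.val = e' at *
  rcases Nat.le_total a b with hab | hab <;> rcases Nat.le_total a' b' with hab' | hab' <;>
    simp only [hab, hab', min_eq_left, max_eq_right, min_eq_right, max_eq_left] <;>
    rcases h1 with h1 | h1 <;> rcases h2 with h2 | h2 <;> omega

/-- The diagonals of the strip of a lattice path, in coordinates which count the vertices from the
first ear. -/
def StripAdj (M : ℕ) (q : ℕ → ℕ) (s t : ℕ) : Prop :=
  ∃ J ≤ M, (s = 1 + q J ∧ t = M + 3 + q J - J) ∨ (t = 1 + q J ∧ s = M + 3 + q J - J)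

theorem StripAdj.symm {M : ℕ} {q : ℕ → ℕ} {s t : ℕ} (h : StripAdj M q s t) : StripAdj M q t s := by
  obtain ⟨J, hJ, h⟩ := h
  exact ⟨J, hJ, h.symm⟩

theorem StripAdj.bounds {M : ℕ} {q : ℕ → ℕ} (hq : IsPath M q) {s t : ℕ} (h : StripAdj M q s t) :
    s < M + 4 ∧ t < M + 4 ∧ (s + 2 ≤ t ∧ t ≤ s + M + 2 ∨ t + 2 ≤ s ∧ s ≤ t + M + 2) := by
  obtain ⟨J, hJ, h⟩ := h
  have h1 := hq.le_self hJ
  have h2 := hq.mono_lip hJ le_rfl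
  omega

theorem StripAdj.not_cross {M : ℕ} {q : ℕ → ℕ} (hq : IsPath M q) {a b c d : ℕ}
    (h : StripAdj M q a b) (h' : StripAdj M q c d) :
    ¬ ((min a b < c ∧ c < max a b ∧ (d < min a b ∨ max a b < d)) ∨
    (min a b < d ∧ d < max a b ∧ (c < min a b ∨ max a b < c))) := by
  obtain ⟨J, hJ, h⟩ := h
  obtain ⟨J', hJ', h'⟩ := h'
  have h1 := hq.le_self hJ
  have h1' := hq.le_self hJ'
  have h2 := hq.mono_lip hJ le_rfl
  have h2' := hq.mono_lip hJ' le_rfl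
  rcases Nat.le_total J J' with hJJ | hJJ
  · have h3 := hq.mono_lip hJJ hJ'
    omega
  · have h3 := hq.mono_lip hJJ hJ
    omega

/-- Maximality of the strip. A chord within one side is crossed by a diagonal at the vertex `a + 1`,
a chord from an ear by the first or last diagonal. Only chords between the two sides are left. -/
theorem StripAdj.of_not_cross {M : ℕ} {q : ℕ → ℕ} (hq : IsPath M q) {a b : ℕ} (hab : a + 2 ≤ b)
    (hb : b < M + 4) (hne : b ≠ a + M + 3)
    (h : ∀ c d, StripAdj M q c d →
      ¬ ((min a b < c ∧ c < max a b ∧ (d < min a b ∨ max a b < d)) ∨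
        (min a b < d ∧ d < max a b ∧ (c < min a b ∨ max a b < c)))) : StripAdj M q a b := by
  have hle := hq.le_self (le_refl M)
  have h' : ∀ J ≤ M, ¬ ((a < 1 + q J ∧ 1 + q J < b ∧ (M + 3 + q J - J < a ∨ b < M + 3 + q J - J)) ∨
      (a < M + 3 + q J - J ∧ M + 3 + q J - J < b ∧ (1 + q J < a ∨ b < 1 + q J))) := by
    intro J hJ
    have := h (1 + q J) (M + 3 + q J - J) ⟨J, hJ, Or.inl ⟨rfl, rfl⟩⟩
    rw [min_eq_left (by omega), max_eq_right (by omega)] at this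
    exact this
  have h0 := h' 0 (Nat.zero_le _)
  have hM := h' M le_rfl
  rw [hq.zero] at h0
  by_cases hb1 : b ≤ 1 + q M
  · obtain ⟨J, hJ, hJq⟩ := hq.exists_eq (k := a) (by omega)
    have := h' J hJ
    have := hq.mono_lip hJ le_rfl
    omega
  · by_cases ha1 : a ≤ 1 + q M
    · by_cases hb2 : b = 2 + q M
      · omega
      · by_cases ha0 : a = 0
        · omega
        -- A diagonal `ab` can only occur after `a - 1` steps of the first kind and `M + 3 - b` of
        -- the second. If the diagonal with this number were another one, it would cross `ab`.
        · have hJM : (a - 1) + (M + 3 - b) ≤ M := by omega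
          have hJ := h' ((a - 1) + (M + 3 - b)) hJM
          have h4 := hq.le_self hJM
          have h5 := hq.mono_lip hJM le_rfl
          refine ⟨_, hJM, Or.inl ⟨?_, ?_⟩⟩ <;> omega
    · by_cases ha2 : a = 2 + q M
      · omega
      · obtain ⟨J, hJ, hJq⟩ := hq.exists_sub_eq (k := M + 3 - a - 1) (by omega)
        have := h' J hJ
        have := hq.mono_lip hJ le_rfl
        have := hq.le_self hJ
        omega

/-! ### Accordion triangulations as strips of lattice paths -/

namespace FramedPolygon

/-- The triangulation `P` is the strip of the lattice path `q` with `M` steps, whose first ear is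
the vertex `e`. -/
structure IsStrip (P : FramedPolygon) (M : ℕ) (e : ZMod (P.s + 1)) (q : ℕ → ℕ) : Prop where
  s_eq : P.s = M + 3
  path : IsPath M q
  adj_iff : ∀ s t : ℕ, s < M + 4 → t < M + 4 →
    (P.diag.Adj (e + (s : ZMod (P.s + 1))) (e + (t : ZMod (P.s + 1))) ↔ StripAdj M q s t)

theorem exists_isStrip_of_isAccordion {P : FramedPolygon} (h : P.IsAccordion) :
    ∃ M e q, P.IsStrip M e q := by
  obtain ⟨hs, a, L, R, hL0, hR0, hstep, hadj⟩ := h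
  obtain ⟨M, hM⟩ : ∃ M, P.s = M + 3 := ⟨P.s - 3, by omega⟩
  -- `q J` counts the moves of `R` among the first `J` steps; the ear cut off by the first diagonal
  -- is `a + 1`.
  let q : ℕ → ℕ := fun J => Nat.rec 0
    (fun J r => if L (J + 1) = L J ∧ R (J + 1) = R J + 1 then r + 1 else r) J
  have hq1 : ∀ J, (L (J + 1) = L J ∧ R (J + 1) = R J + 1) → q (J + 1) = q J + 1 := fun J hJ => by
    simp only [q, hJ, and_self, if_true]
  have hq2 : ∀ J, ¬ (L (J + 1) = L J ∧ R (J + 1) = R J + 1) → q (J + 1) = q J := fun J hJ => by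
    simp only [q, hJ, if_false]
  have hpath : IsPath M q := by
    refine ⟨rfl, fun J _ => ?_⟩
    by_cases hJ : L (J + 1) = L J ∧ R (J + 1) = R J + 1
    · exact Or.inr (hq1 J hJ)
    · exact Or.inl (hq2 J hJ)
  have hN : ((M + 4 : ℕ) : ZMod (P.s + 1)) = 0 := by
    have : M + 4 = P.s + 1 := by omega
    rw [this]
    exact ZMod.natCast_self _
  have key : ∀ J ≤ M, R J = (a + 1) + ((1 + q J : ℕ) : ZMod (P.s + 1)) ∧
      L J = (a + 1) + ((M + 3 + q J - J : ℕ) : ZMod (P.s + 1)) := by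
    intro J hJ
    induction J with
    | zero =>
      refine ⟨?_, ?_⟩
      · rw [hR0, hpath.zero]
        push_cast
        ring
      · rw [hL0, hpath.zero]
        push_cast at hN ⊢
        linear_combination -hN
    | succ J ih =>
      obtain ⟨i1, i2⟩ := ih (by omega)
      have hle := hpath.le_self (J := J) (by omega)
      have hstep := hstep J (by omega)
      by_cases hc : L (J + 1) = L J ∧ R (J + 1) = R J + 1
      · rw [hq1 J hc, hc.1, hc.2, i1, i2]
        refine ⟨by push_cast; ring, ?_⟩
        congr 2
        omega
      · obtain ⟨c1, c2⟩ := hstep.resolve_left hc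
        rw [hq2 J hc, c1, c2, i1, i2]
        refine ⟨rfl, ?_⟩
        have : M + 3 + q J - J = M + 3 + q J - (J + 1) + 1 := by omega
        rw [this]
        push_cast
        ring
  refine ⟨M, a + 1, q, hM, hpath, fun s t hs' ht' => ?_⟩
  rw [hadj]
  have hlt : ∀ J ≤ M, 1 + q J < P.s + 1 ∧ M + 3 + q J - J < P.s + 1 := fun J hJ => by
    have := hpath.le_self hJ
    omega
  constructor
  · rintro ⟨J, hJ, h⟩
    have hJM : J ≤ M := by omega
    obtain ⟨k1, k2⟩ := key J hJM
    obtain ⟨l1, l2⟩ := hlt J hJM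
    rw [k1, k2, add_natCast_inj _ (by omega) l2, add_natCast_inj _ (by omega) l1,
      add_natCast_inj _ (by omega) l2, add_natCast_inj _ (by omega) l1] at h
    exact ⟨J, hJM, h.symm.imp id And.symm⟩
  · rintro ⟨J, hJM, h⟩
    refine ⟨J, by omega, ?_⟩
    obtain ⟨k1, k2⟩ := key J hJM
    rw [k1, k2]
    rcases h with ⟨rfl, rfl⟩ | ⟨rfl, rfl⟩
    · exact Or.inr ⟨rfl, rfl⟩
    · exact Or.inl ⟨rfl, rfl⟩

/-- The strip of a lattice path as a framed triangulated polygon. -/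
def strip (M : ℕ) (e : ZMod (M + 3 + 1)) (q : ℕ → ℕ) (hq : IsPath M q) : FramedPolygon where
  s := M + 3
  two_le := by omega
  diag :=
    { Adj := fun u v => StripAdj M q (u - e).val (v - e).val
      symm := ⟨fun _ _ h => h.symm⟩
      loopless := ⟨fun u h => by
        have := h.bounds hq
        omega⟩ }
  not_side := by
    have key : ∀ u v : ZMod (M + 3 + 1), StripAdj M q (u - e).val (v - e).val → v ≠ u + 1 := by
      intro u v h huv
      have h1 := h.bounds hq
      have h2 := val_add_natCast (u - e) (t := 1) (by omega)
      have h3 : u - e + ((1 : ℕ) : ZMod (M + 3 + 1)) = v - e := by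
        rw [huv]
        push_cast
        ring
      rw [h3] at h2
      omega
    exact fun u v h => ⟨key u v h, key v u h.symm⟩
  noncrossing := by
    intro a b c d hab hcd
    obtain ⟨a, ha, rfl⟩ := exists_eq_add_natCast e a
    obtain ⟨b, hb, rfl⟩ := exists_eq_add_natCast e b
    obtain ⟨c, hc, rfl⟩ := exists_eq_add_natCast e c
    obtain ⟨d, hd, rfl⟩ := exists_eq_add_natCast e d
    rw [chordsCross_add_iff e ha hb hc hd]
    simp only [add_sub_cancel_left, ZMod.val_natCast, Nat.mod_eq_of_lt, ha, hb, hc, hd] at hab hcd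
    exact hab.not_cross hq hcd
  maximal := by
    have key : ∀ a b : ℕ, a < M + 3 + 1 → b < M + 3 + 1 → a < b →
        e + (b : ZMod (M + 3 + 1)) ≠ e + (a : ZMod (M + 3 + 1)) + 1 →
        e + (a : ZMod (M + 3 + 1)) ≠ e + (b : ZMod (M + 3 + 1)) + 1 →
        (∀ c d, StripAdj M q (c - e).val (d - e).val → ¬ ChordsCross (e + (a : ZMod (M + 3 + 1)))
          (e + (b : ZMod (M + 3 + 1))) c d) → StripAdj M q a b := by
      intro a b ha hb hab h1 h2 h
      refine StripAdj.of_not_cross hq ?_ hb ?_ ?_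
      · have : b ≠ a + 1 := by
          rintro rfl
          exact h1 (by push_cast; ring)
        omega
      · rintro rfl
        obtain rfl : a = 0 := by omega
        refine h2 ?_
        have hN : ((M + 3 + 1 : ℕ) : ZMod (M + 3 + 1)) = 0 := ZMod.natCast_self _
        push_cast at hN ⊢
        linear_combination -hN
      · intro c d hcd
        have hb' := hcd.bounds hq
        rw [← chordsCross_add_iff e ha hb hb'.1 hb'.2.1]
        refine h _ _ ?_
        simpa only [add_sub_cancel_left, ZMod.val_natCast, Nat.mod_eq_of_lt hb'.1,
          Nat.mod_eq_of_lt hb'.2.1] using hcd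
    intro a b hne h1 h2 h
    obtain ⟨a, ha, rfl⟩ := exists_eq_add_natCast e a
    obtain ⟨b, hb, rfl⟩ := exists_eq_add_natCast e b
    simp only [add_sub_cancel_left, ZMod.val_natCast, Nat.mod_eq_of_lt, ha, hb]
    rcases Nat.lt_trichotomy a b with hab | rfl | hab
    · exact key a b ha hb hab h1 h2 h
    · exact absurd rfl hne
    · refine (key b a hb ha hab h2 h1 fun c d hcd => ?_).symm
      have := h c d hcd
      unfold ChordsCross at this ⊢
      rwa [min_comm, max_comm]

theorem isStrip_strip (M : ℕ) (e : ZMod (M + 3 + 1)) (q : ℕ → ℕ) (hq : IsPath M q) :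
    (strip M e q hq).IsStrip M e q := by
  refine ⟨rfl, hq, fun s t hs ht => ?_⟩
  change StripAdj M q (e + (s : ZMod (M + 3 + 1)) - e).val (e + (t : ZMod (M + 3 + 1)) - e).val ↔ _
  rw [add_sub_cancel_left, add_sub_cancel_left, ZMod.val_natCast, ZMod.val_natCast,
    Nat.mod_eq_of_lt hs, Nat.mod_eq_of_lt ht]

variable {P : FramedPolygon} {M : ℕ} {e : ZMod (P.s + 1)} {q : ℕ → ℕ}

namespace IsStrip

theorem natCast_eq_zero (h : P.IsStrip M e q) : ((M + 4 : ℕ) : ZMod (P.s + 1)) = 0 := by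
  have : M + 4 = P.s + 1 := by rw [h.s_eq]
  rw [this]
  exact ZMod.natCast_self _

theorem inj (h : P.IsStrip M e q) {s t : ℕ} (hs : s < M + 4) (ht : t < M + 4) :
    e + (s : ZMod (P.s + 1)) = e + (t : ZMod (P.s + 1)) ↔ s = t := by
  have := h.s_eq
  exact add_natCast_inj e (by omega) (by omega)

theorem exists_eq (h : P.IsStrip M e q) (v : ZMod (P.s + 1)) :
    ∃ t < M + 4, v = e + (t : ZMod (P.s + 1)) := by
  obtain ⟨t, ht, rfl⟩ := exists_eq_add_natCast e v
  have := h.s_eq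
  exact ⟨t, by omega, rfl⟩

theorem adj_iff' (h : P.IsStrip M e q) {s : ℕ} (hs : s < M + 4) (v : ZMod (P.s + 1)) :
    P.diag.Adj (e + (s : ZMod (P.s + 1))) v ↔
      ∃ t < M + 4, v = e + (t : ZMod (P.s + 1)) ∧ StripAdj M q s t := by
  constructor
  · intro ha
    obtain ⟨t, ht, rfl⟩ := h.exists_eq v
    exact ⟨t, ht, rfl, (h.adj_iff s t hs ht).1 ha⟩
  · rintro ⟨t, ht, rfl, ha⟩
    exact (h.adj_iff s t hs ht).2 ha

theorem isAccordion (h : P.IsStrip M e q) : P.IsAccordion := by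
  have hs := h.s_eq
  have hN := h.natCast_eq_zero
  refine ⟨by omega, e - 1, fun J => e + ((M + 3 + q J - J : ℕ) : ZMod (P.s + 1)),
    fun J => e + ((1 + q J : ℕ) : ZMod (P.s + 1)), ?_, ?_, ?_, ?_⟩
  · simp only [h.path.zero]
    push_cast at hN ⊢
    linear_combination hN
  · simp only [h.path.zero]
    push_cast
    ring
  · intro J hJ
    have hle := h.path.le_self (J := J) (by omega)
    rcases h.path.step J (by omega) with hq | hq
    · right
      refine ⟨?_, by simp only [hq]⟩
      have : M + 3 + q J - J = M + 3 + q J - (J + 1) + 1 := by omega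
      simp only [hq]
      rw [this]
      push_cast
      ring
    · left
      refine ⟨?_, ?_⟩
      · simp only [hq]
        congr 2
        omega
      · simp only [hq]
        push_cast
        ring
  · intro u v
    obtain ⟨s, hs', rfl⟩ := h.exists_eq u
    obtain ⟨t, ht', rfl⟩ := h.exists_eq v
    rw [h.adj_iff s t hs' ht']
    constructor
    · rintro ⟨J, hJ, h1⟩
      refine ⟨J, by omega, ?_⟩
      rcases h1 with ⟨rfl, rfl⟩ | ⟨rfl, rfl⟩
      · exact Or.inr ⟨rfl, rfl⟩
      · exact Or.inl ⟨rfl, rfl⟩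
    · rintro ⟨J, hJ, h1⟩
      have hJM : J ≤ M := by omega
      have := h.path.le_self hJM
      rw [h.inj hs' (by omega), h.inj ht' (by omega), h.inj hs' (by omega),
        h.inj ht' (by omega)] at h1
      exact ⟨J, hJM, h1.symm.imp id And.symm⟩

/-- Reading a strip from its other ear exchanges the two sides. -/
theorem reverse (h : P.IsStrip M e q) :
    P.IsStrip M (e + ((2 + q M : ℕ) : ZMod (P.s + 1)))
      (fun J => (M - q M) - ((M - J) - q (M - J))) := by
  have hN := h.natCast_eq_zero
  refine ⟨h.s_eq, h.path.reverse, fun s t hs ht => ?_⟩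
  have hM := h.path.le_self (le_refl M)
  have hcoord : ∀ s < M + 4, ∃ s' < M + 4, (s' = s + (2 + q M) ∨ s' + (M + 4) = s + (2 + q M)) ∧
      e + ((2 + q M : ℕ) : ZMod (P.s + 1)) + (s : ZMod (P.s + 1)) = e + (s' : ZMod (P.s + 1)) := by
    intro s hs
    rcases Nat.lt_or_ge (s + (2 + q M)) (M + 4) with h1 | h1
    · refine ⟨s + (2 + q M), h1, Or.inl rfl, ?_⟩
      push_cast
      ring
    · refine ⟨s + (2 + q M) - (M + 4), by omega, Or.inr (by omega), ?_⟩
      rw [Nat.cast_sub h1, hN]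
      push_cast
      ring
  obtain ⟨s', hs', h1, e1⟩ := hcoord s hs
  obtain ⟨t', ht', h2, e2⟩ := hcoord t ht
  rw [e1, e2, h.adj_iff s' t' hs' ht']
  unfold StripAdj
  beta_reduce
  constructor
  · rintro ⟨J, hJ, h3⟩
    refine ⟨M - J, by omega, ?_⟩
    have h4 : M - (M - J) = J := by omega
    have h5 := h.path.le_self hJ
    have h6 := h.path.mono_lip hJ le_rfl
    rw [h4]
    omega
  · rintro ⟨J, hJ, h3⟩
    refine ⟨M - J, by omega, ?_⟩
    have h5 := h.path.le_self (J := M - J) (by omega)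
    have h6 := h.path.mono_lip (J := M - J) (by omega) le_rfl
    omega

theorem adj_right_iff (h : P.IsStrip M e q) {k : ℕ} (hk : k ≤ q M) (v : ZMod (P.s + 1)) :
    P.diag.Adj (e + ((1 + k : ℕ) : ZMod (P.s + 1))) v ↔
      ∃ J ≤ M, q J = k ∧ v = e + ((M + 3 + q J - J : ℕ) : ZMod (P.s + 1)) := by
  have hM := h.path.le_self (le_refl M)
  rw [h.adj_iff' (by omega)]
  constructor
  · rintro ⟨t, ht, rfl, J, hJ, h1⟩
    have h5 := h.path.le_self hJ
    have h6 := h.path.mono_lip hJ le_rfl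
    rcases h1 with ⟨h1, rfl⟩ | h1
    · exact ⟨J, hJ, by omega, rfl⟩
    · omega
  · rintro ⟨J, hJ, rfl, rfl⟩
    have h5 := h.path.le_self hJ
    exact ⟨_, by omega, rfl, J, hJ, Or.inl ⟨rfl, rfl⟩⟩

theorem adj_left_iff (h : P.IsStrip M e q) {k : ℕ} (hk : k ≤ M - q M) (v : ZMod (P.s + 1)) :
    P.diag.Adj (e + ((M + 3 - k : ℕ) : ZMod (P.s + 1))) v ↔
      ∃ J ≤ M, J - q J = k ∧ v = e + ((1 + q J : ℕ) : ZMod (P.s + 1)) := by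
  have hM := h.path.le_self (le_refl M)
  rw [h.adj_iff' (by omega)]
  constructor
  · rintro ⟨t, ht, rfl, J, hJ, h1⟩
    have h5 := h.path.le_self hJ
    have h6 := h.path.mono_lip hJ le_rfl
    rcases h1 with h1 | ⟨rfl, h1⟩
    · omega
    · exact ⟨J, hJ, by omega, rfl⟩
  · rintro ⟨J, hJ, rfl, rfl⟩
    have h5 := h.path.le_self hJ
    exact ⟨_, by omega, rfl, J, hJ, Or.inr ⟨rfl, by omega⟩⟩

/-- The number of diagonals at a vertex of the first side. -/
theorem index_right (h : P.IsStrip M e q) {k : ℕ} (hk : k ≤ q M) :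
    P.index (e + ((1 + k : ℕ) : ZMod (P.s + 1))) =
      ((Finset.range (M + 1)).filter fun J => q J = k).card + 1 := by
  unfold index
  congr 1
  have : P.diag.neighborSet (e + ((1 + k : ℕ) : ZMod (P.s + 1))) =
      (fun J : ℕ => e + ((M + 3 + q J - J : ℕ) : ZMod (P.s + 1))) ''
        ((Finset.range (M + 1)).filter fun J => q J = k : Finset ℕ) := by
    ext v
    rw [SimpleGraph.mem_neighborSet, h.adj_right_iff hk]
    simp only [Finset.coe_filter, Finset.mem_range, Set.mem_image, Set.mem_ofPred_eq]
    exact ⟨fun ⟨J, h1, h2, h3⟩ => ⟨J, ⟨by omega, h2⟩, h3.symm⟩,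
      fun ⟨J, ⟨h1, h2⟩, h3⟩ => ⟨J, by omega, h2, h3.symm⟩⟩
  rw [this, Set.InjOn.ncard_image, Set.ncard_coe_finset]
  intro J hJ J' hJ' he
  simp only [Finset.coe_filter, Finset.mem_range, Set.mem_ofPred_eq] at hJ hJ'
  have h1 := h.path.le_self (J := J) (by omega)
  have h2 := h.path.le_self (J := J') (by omega)
  simp only at he
  rw [h.inj (by omega) (by omega)] at he
  omega

/-- The number of diagonals at a vertex of the second side. -/
theorem index_left (h : P.IsStrip M e q) {k : ℕ} (hk : k ≤ M - q M) :
    P.index (e + ((M + 3 - k : ℕ) : ZMod (P.s + 1))) =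
      ((Finset.range (M + 1)).filter fun J => J - q J = k).card + 1 := by
  unfold index
  congr 1
  have : P.diag.neighborSet (e + ((M + 3 - k : ℕ) : ZMod (P.s + 1))) =
      (fun J : ℕ => e + ((1 + q J : ℕ) : ZMod (P.s + 1))) ''
        ((Finset.range (M + 1)).filter fun J => J - q J = k : Finset ℕ) := by
    ext v
    rw [SimpleGraph.mem_neighborSet, h.adj_left_iff hk]
    simp only [Finset.coe_filter, Finset.mem_range, Set.mem_image, Set.mem_ofPred_eq]
    exact ⟨fun ⟨J, h1, h2, h3⟩ => ⟨J, ⟨by omega, h2⟩, h3.symm⟩,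
      fun ⟨J, ⟨h1, h2⟩, h3⟩ => ⟨J, by omega, h2, h3.symm⟩⟩
  rw [this, Set.InjOn.ncard_image, Set.ncard_coe_finset]
  intro J hJ J' hJ' he
  simp only [Finset.coe_filter, Finset.mem_range, Set.mem_ofPred_eq] at hJ hJ'
  have h1 := h.path.le_self (J := J) (by omega)
  have h2 := h.path.le_self (J := J') (by omega)
  simp only at he
  rw [h.inj (by omega) (by omega)] at he
  omega

theorem index_eq_one {s : ℕ} (h : P.IsStrip M e q) (hs : s < M + 4)
    (hno : ∀ t, ¬ StripAdj M q s t) : P.index (e + (s : ZMod (P.s + 1))) = 1 := by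
  unfold index
  have : P.diag.neighborSet (e + (s : ZMod (P.s + 1))) = ∅ := by
    ext v
    rw [SimpleGraph.mem_neighborSet, h.adj_iff' hs]
    simp [hno]
  rw [this, Set.ncard_empty]

theorem index_first (h : P.IsStrip M e q) : P.index (e + ((0 : ℕ) : ZMod (P.s + 1))) = 1 := by
  refine h.index_eq_one (by omega) ?_
  rintro t ⟨J, hJ, h1⟩
  have := h.path.le_self hJ
  omega

theorem index_last (h : P.IsStrip M e q) :
    P.index (e + ((2 + q M : ℕ) : ZMod (P.s + 1))) = 1 := by
  have hM := h.path.le_self (le_refl M)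
  refine h.index_eq_one (by omega) ?_
  rintro t ⟨J, hJ, h1⟩
  have h5 := h.path.le_self hJ
  have h6 := h.path.mono_lip hJ le_rfl
  omega

end IsStrip

end FramedPolygon

/-! ### The indices of a strip -/

/-- The indices of the vertices on the first side of a strip, from the last to the first. -/
def sideR (M : ℕ) (q : ℕ → ℕ) : List ℕ :=
  (List.range (q M + 1)).reverse.map fun k =>
    ((Finset.range (M + 1)).filter fun J => q J = k).card + 1

/-- The indices of the vertices on the second side of a strip, from the last to the first. -/
def sideL (M : ℕ) (q : ℕ → ℕ) : List ℕ :=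
  (List.range (M - q M + 1)).reverse.map fun k =>
    ((Finset.range (M + 1)).filter fun J => J - q J = k).card + 1

theorem sideR_congr {M : ℕ} {q q' : ℕ → ℕ} (h : ∀ J ≤ M, q J = q' J) : sideR M q = sideR M q' := by
  unfold sideR
  rw [h M le_rfl]
  refine List.map_congr_left fun k _ => ?_
  congr 2
  refine Finset.filter_congr fun J hJ => ?_
  rw [h J (by simpa [Nat.lt_succ_iff] using hJ)]

theorem sideL_congr {M : ℕ} {q q' : ℕ → ℕ} (h : ∀ J ≤ M, q J = q' J) : sideL M q = sideL M q' := by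
  unfold sideL
  rw [h M le_rfl]
  refine List.map_congr_left fun k _ => ?_
  congr 2
  refine Finset.filter_congr fun J hJ => ?_
  rw [h J (by simpa [Nat.lt_succ_iff] using hJ)]

/-- The entry at the top of a list of fibre cardinalities grows by one with each further step. -/
theorem map_card_grow (M K : ℕ) (f : ℕ → ℕ) (hf : f (M + 1) = K) :
    ∃ l ls, ((List.range (K + 1)).reverse.map fun k =>
        ((Finset.range (M + 1)).filter fun J => f J = k).card + 1) = l :: ls ∧
      ((List.range (K + 1)).reverse.map fun k =>
        ((Finset.range (M + 1 + 1)).filter fun J => f J = k).card + 1) = (l + 1) :: ls := by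
  simp only [List.range_succ, List.reverse_append, List.reverse_cons, List.reverse_nil,
    List.nil_append, List.cons_append, List.map_cons]
  refine ⟨_, _, rfl, ?_⟩
  congr 1
  · rw [Finset.range_add_one, Finset.filter_insert, if_pos hf, Finset.card_insert_of_notMem]
    simp
  · refine List.map_congr_left fun k hk => ?_
    rw [List.mem_reverse, List.mem_range] at hk
    rw [Finset.range_add_one (n := M + 1), Finset.filter_insert, if_neg (by omega)]

/-- A new value of `f` adds a new entry `2`. -/
theorem map_card_new (M K : ℕ) (f : ℕ → ℕ) (hf : f (M + 1) = K + 1) (hlt : ∀ J ≤ M, f J ≤ K) :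
    ((List.range (K + 1 + 1)).reverse.map fun k =>
        ((Finset.range (M + 1 + 1)).filter fun J => f J = k).card + 1) =
      2 :: ((List.range (K + 1)).reverse.map fun k =>
        ((Finset.range (M + 1)).filter fun J => f J = k).card + 1) := by
  rw [List.range_succ (n := K + 1), List.reverse_append, List.reverse_cons, List.reverse_nil,
    List.nil_append, List.cons_append, List.nil_append, List.map_cons]
  congr 1
  · rw [Finset.range_add_one, Finset.filter_insert, if_pos hf, Finset.filter_false_of_mem]
    · simp
    · intro J hJ
      have := hlt J (by simpa [Nat.lt_succ_iff] using hJ)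
      omega
  · refine List.map_congr_left fun k hk => ?_
    rw [List.mem_reverse, List.mem_range] at hk
    rw [Finset.range_add_one (n := M + 1), Finset.filter_insert, if_neg (by omega)]

/-- The new diagonal opens a new vertex on the first side, with one diagonal and hence index `2`,
and adds one to the current vertex of the second side. -/
theorem side_stepR {M : ℕ} {q : ℕ → ℕ} (h : IsPath (M + 1) q) (hq : q (M + 1) = q M + 1) :
    sideR (M + 1) q = 2 :: sideR M q ∧
      ∃ l ls, sideL M q = l :: ls ∧ sideL (M + 1) q = (l + 1) :: ls := by
  unfold sideR sideL
  rw [hq]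
  have h1 : M + 1 - (q M + 1) = M - q M := by omega
  rw [h1]
  exact ⟨map_card_new M (q M) q hq fun J hJ => (h.mono_lip hJ (by omega)).1,
    map_card_grow M (M - q M) (fun J => J - q J) (by rw [hq]; omega)⟩

theorem side_stepL {M : ℕ} {q : ℕ → ℕ} (h : IsPath (M + 1) q) (hq : q (M + 1) = q M) :
    sideL (M + 1) q = 2 :: sideL M q ∧
      ∃ r rs, sideR M q = r :: rs ∧ sideR (M + 1) q = (r + 1) :: rs := by
  unfold sideR sideL
  have hM := h.le_self (J := M) (by omega)
  have h1 : M + 1 - q (M + 1) = M - q M + 1 := by omega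
  rw [h1, hq]
  refine ⟨map_card_new M (M - q M) (fun J => J - q J) (by rw [hq]; omega) fun J hJ => ?_,
    map_card_grow M (q M) q hq⟩
  have := (h.mono_lip hJ (by omega)).2
  omega

theorem dualChains_side {M : ℕ} {q : ℕ → ℕ} (h : IsPath M q) :
    DualChains (sideR M q) (sideL M q) := by
  induction M with
  | zero =>
    have h1 : sideR 0 q = [2] := by simp [sideR, h.zero, Finset.filter_singleton]
    have h2 : sideL 0 q = [2] := by simp [sideL, h.zero, Finset.filter_singleton]
    rw [h1, h2]
    exact DualChains.base
  | succ M ih =>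
    have ih := ih h.of_succ
    rcases h.step M (by omega) with hq | hq
    · obtain ⟨h1, r, rs, h2, h3⟩ := side_stepL h hq
      rw [h1, h3]
      rw [h2] at ih
      exact ih.stepL
    · obtain ⟨h1, l, ls, h2, h3⟩ := side_stepR h hq
      rw [h1, h3]
      rw [h2] at ih
      exact ih.stepR

theorem IsPath.extend {M : ℕ} {q : ℕ → ℕ} (h : IsPath M q) {r : ℕ} (hr : r = q M ∨ r = q M + 1) :
    IsPath (M + 1) fun J => if J ≤ M then q J else r := by
  refine ⟨by simp [h.zero], fun J hJ => ?_⟩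
  rcases Nat.lt_or_ge J M with h1 | h1
  · have := h.step J h1
    rwa [if_pos (by omega), if_pos (by omega)]
  · obtain rfl : J = M := by omega
    rwa [if_neg (by omega), if_pos le_rfl]

theorem DualChains.exists_path {rs ls : List ℕ} (h : DualChains rs ls) :
    ∃ M q, IsPath M q ∧ sideR M q = rs ∧ sideL M q = ls := by
  induction h with
  | base =>
    exact ⟨0, fun _ => 0, ⟨rfl, by simp⟩, by simp [sideR], by simp [sideL]⟩
  | stepR _ ih =>
    obtain ⟨M, q, hq, h1, h2⟩ := ih
    have hq' := hq.extend (r := q M + 1) (Or.inr rfl)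
    have hc : ∀ J ≤ M, (if J ≤ M then q J else q M + 1) = q J := fun J hJ => if_pos hJ
    obtain ⟨h3, l, ls, h4, h5⟩ := side_stepR hq' (by simp)
    refine ⟨M + 1, _, hq', ?_, ?_⟩
    · rw [h3, sideR_congr hc, h1]
    · rw [h5]
      rw [sideL_congr hc, h2] at h4
      simp_all
  | stepL _ ih =>
    obtain ⟨M, q, hq, h1, h2⟩ := ih
    have hq' := hq.extend (r := q M) (Or.inl rfl)
    have hc : ∀ J ≤ M, (if J ≤ M then q J else q M) = q J := fun J hJ => if_pos hJ
    obtain ⟨h3, r, rs, h4, h5⟩ := side_stepL hq' (by simp)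
    refine ⟨M + 1, _, hq', ?_, ?_⟩
    · rw [h5]
      rw [sideR_congr hc, h1] at h4
      simp_all
    · rw [h3, sideL_congr hc, h2]

/-! ### The zero chain of a strip, and the strip of a pair of dual chains -/

namespace FramedPolygon

variable {P : FramedPolygon} {M : ℕ} {e : ZMod (P.s + 1)} {q : ℕ → ℕ}

theorem index_zero_cons_chain (P : FramedPolygon) :
    P.index 0 :: P.chain = (List.range (P.s + 1)).map fun i => P.index ((i : ℕ) : ZMod (P.s + 1)) := by
  rw [List.range_succ_eq_map, List.map_cons, List.map_map, Nat.cast_zero]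
  rfl

theorem index_zero_cons_chain_eq_rotate (P : FramedPolygon) (e : ZMod (P.s + 1)) :
    P.index 0 :: P.chain = ((List.range (P.s + 1)).map fun t => P.index
      (e + ((t : ℕ) : ZMod (P.s + 1)))).rotate (0 - e).val := by
  rw [index_zero_cons_chain]
  refine List.ext_getElem (by simp) fun i h1 h2 => ?_
  rw [List.getElem_rotate]
  simp only [List.getElem_map, List.getElem_range, List.length_map, List.length_range]
  congr 1
  rw [ZMod.natCast_mod]
  push_cast
  rw [ZMod.natCast_val, ZMod.cast_id', id]
  ring

theorem IsStrip.map_index (h : P.IsStrip M e q) :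
    ((List.range (P.s + 1)).map fun t => P.index (e + ((t : ℕ) : ZMod (P.s + 1)))) =
      1 :: (sideR M q).reverse ++ 1 :: sideL M q := by
  have hM := h.path.le_self (le_refl M)
  have h1 : List.range (P.s + 1) = 0 :: (List.range (q M + 1)).map (fun k => 1 + k) ++
      (2 + q M) :: (List.range (M - q M + 1)).reverse.map (fun k => M + 3 - k) := by
    refine List.ext_getElem (by simp [h.s_eq]; omega) fun i h1 h2 => ?_
    rw [List.getElem_range, List.getElem_append]
    split_ifs with hi
    · cases i with
      | zero => rfl
      | succ i => simp [add_comm]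
    · simp only [List.length_cons, List.length_map, List.length_range] at hi
      obtain ⟨j, rfl⟩ : ∃ j, i = q M + 1 + 1 + j := ⟨i - (q M + 1 + 1), by omega⟩
      simp only [List.length_cons, List.length_map, List.length_range, Nat.add_sub_cancel_left]
      cases j with
      | zero => simp; omega
      | succ j =>
        simp only [List.length_range, h.s_eq] at h1
        simp only [List.getElem_cons_succ, List.getElem_map, List.getElem_reverse,
          List.getElem_range, List.length_range]
        omega
  rw [h1, List.map_append, List.map_cons, List.map_cons, h.index_first, h.index_last]
  unfold sideR sideL
  rw [← List.map_reverse, List.reverse_reverse, List.map_map, List.map_map]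
  congr 1
  · congr 1
    refine List.map_congr_left fun k hk => ?_
    rw [List.mem_range] at hk
    exact h.index_right (by omega)
  · congr 1
    refine List.map_congr_left fun k hk => ?_
    rw [List.mem_reverse, List.mem_range] at hk
    exact h.index_left (by omega)

/-- The chain of an accordion triangulation whose hidden vertex is not an ear. -/
theorem IsStrip.exists_chain_eq (h : P.IsStrip M e q) (h0 : P.index 0 ≠ 1) :
    ∃ A B C, P.chain = A ++ 1 :: B ++ 1 :: C ∧ DualChains B.reverse (C ++ P.index 0 :: A) := by
  have hd := dualChains_side h.path
  have hrot := index_zero_cons_chain_eq_rotate P e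
  rw [h.map_index] at hrot
  generalize (sideR M q) = rs at *
  generalize (sideL M q) = ls at *
  generalize P.index 0 = x at *
  generalize P.chain = c at *
  have hsplit : ∃ U V, 1 :: rs.reverse ++ 1 :: ls = U ++ x :: V ∧ c = V ++ U := by
    rw [← List.rotate_mod, List.rotate_eq_drop_append_take
      (Nat.mod_lt _ (by simp)).le] at hrot
    set l := 1 :: rs.reverse ++ 1 :: ls with hl
    have hlt := Nat.mod_lt (0 - e).val (y := l.length) (by simp [hl])
    generalize (0 - e).val % l.length = r at *
    rw [List.drop_eq_getElem_cons hlt, List.cons_append, List.cons.injEq] at hrot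
    refine ⟨l.take r, l.drop (r + 1), ?_, hrot.2⟩
    rw [hrot.1, List.getElem_cons_drop, List.take_append_drop]
  obtain ⟨U, V, hUV, rfl⟩ := hsplit
  -- The hidden vertex lies on the second side in the first case, and on the first side in the
  -- second, where the sides are exchanged and reversed.
  rcases List.append_eq_append_iff.1 hUV with ⟨W, rfl, hW⟩ | ⟨W, hU, hW⟩
  · cases W with
    | nil =>
      rw [List.nil_append, List.cons.injEq] at hW
      exact absurd hW.1.symm h0
    | cons w X =>
      obtain ⟨rfl, rfl⟩ : 1 = w ∧ ls = X ++ x :: V := by simpa using hW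
      exact ⟨V, rs.reverse, X, by simp, by simpa using hd⟩
  · cases W with
    | nil =>
      rw [List.nil_append, List.cons.injEq] at hW
      exact absurd hW.1 h0
    | cons w W =>
      obtain ⟨rfl, rfl⟩ : x = w ∧ V = W ++ 1 :: ls := by simpa using hW
      cases U with
      | nil =>
        rw [List.nil_append, List.cons.injEq] at hU
        exact absurd hU.1.symm h0
      | cons u X =>
        obtain ⟨rfl, hX⟩ : 1 = u ∧ rs.reverse = X ++ x :: W := by simpa using hU
        refine ⟨W, ls, X, by simp, ?_⟩
        rw [← hX]
        exact hd.symm.reverse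

/-- Every pair of dual chains is realized by an accordion triangulation with a prescribed frame. -/
theorem exists_polygon_of_dualChains {A B C : List ℕ} {x : ℕ}
    (h : DualChains B.reverse (C ++ x :: A)) :
    ∃ P : FramedPolygon, P.IsAccordion ∧ P.index 0 = x ∧ P.chain = A ++ 1 :: B ++ 1 :: C := by
  obtain ⟨M, q, hq, h1, h2⟩ := h.exists_path
  have hlen : (1 :: B ++ 1 :: (C ++ x :: A)).length = M + 4 := by
    have := (isStrip_strip M 0 q hq).map_index
    rw [h1, h2, List.reverse_reverse] at this
    rw [← this]
    simp [strip]
  -- The first ear has to be the entry `1` following `A`; the additional `1` accounts for the hidden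
  -- vertex.
  set e : ZMod (M + 3 + 1) := ((A.length + 1 : ℕ) : ZMod (M + 3 + 1))
  have hs := isStrip_strip M e q hq
  refine ⟨strip M e q hq, hs.isAccordion, ?_⟩
  have hrot := index_zero_cons_chain_eq_rotate (strip M e q hq) e
  rw [hs.map_index, h1, h2, List.reverse_reverse] at hrot
  have hval : (0 - e).val = (1 :: B ++ 1 :: C).length := by
    have hlt : (1 :: B ++ 1 :: C).length < M + 3 + 1 := by
      simp only [List.length_append, List.length_cons] at hlen ⊢
      omega
    have : 0 - e = (((1 :: B ++ 1 :: C).length : ℕ) : ZMod (M + 3 + 1)) := by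
      rw [sub_eq_iff_eq_add, ← Nat.cast_add]
      symm
      rw [ZMod.natCast_eq_zero_iff]
      refine dvd_of_eq ?_
      simp only [List.length_append, List.length_cons] at hlen ⊢
      omega
    rw [this, ZMod.val_natCast, Nat.mod_eq_of_lt hlt]
  change _ = List.rotate _ (0 - e).val at hrot
  rw [hval] at hrot
  have e1 : 1 :: B ++ 1 :: (C ++ x :: A) = (1 :: B ++ 1 :: C) ++ (x :: A) := by simp
  rw [e1, List.rotate_append_length_eq] at hrot
  simpa using hrot

end FramedPolygon

namespace FramedPolygon

/-! ### The cyclic order of the weights -/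

variable {P : FramedPolygon} {n : ℕ}

/-- The position of the `k`-th weight, with the hidden vertex at position `0`. -/
noncomputable def wpos (P : FramedPolygon) (k : ℕ) : ℕ := if k = 0 then 0 else P.pos k

/-- The vertex of the weight `x_i`. -/
noncomputable def wvert (P : FramedPolygon) (n : ℕ) (i : ZMod n) : ZMod (P.s + 1) :=
  (P.wpos i.val : ZMod (P.s + 1))

/-- The length of the boundary arc from the weight `x_i` to the weight `x_{i+1}`. -/
noncomputable def arc (P : FramedPolygon) (n : ℕ) (i : ZMod n) : ℕ :=
  P.wpos (i.val + 1) - P.wpos i.val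

theorem mem_weightPositions (P : FramedPolygon) (j : ℕ) :
    j ∈ P.weightPositions ↔ 1 ≤ j ∧ j ≤ P.s + 1 ∧ 2 < P.index (j : ZMod (P.s + 1)) := by
  unfold weightPositions
  rw [List.mem_filter, List.mem_range']
  simp only [decide_eq_true_eq]
  constructor
  · rintro ⟨⟨i, hi, rfl⟩, h⟩
    exact ⟨by omega, by omega, h⟩
  · rintro ⟨h1, h2, h3⟩
    exact ⟨⟨j - 1, by omega, by omega⟩, h3⟩

theorem pairwise_weightPositions (P : FramedPolygon) : P.weightPositions.Pairwise (· < ·) :=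
  (List.pairwise_lt_range' (s := 1) (n := P.s + 1) (step := 1)).filter _

theorem pos_eq_getElem {k : ℕ} (hk : k < P.numWeights) :
    P.pos (k + 1) = P.weightPositions[k]'hk := by
  unfold pos
  rw [Nat.add_sub_cancel, List.getD_eq_getElem _ _ hk]

theorem pos_lt_pos {k l : ℕ} (hk : 1 ≤ k) (hkl : k < l) (hl : l ≤ P.numWeights) :
    P.pos k < P.pos l := by
  obtain ⟨k, rfl⟩ : ∃ k', k = k' + 1 := ⟨k - 1, by omega⟩
  obtain ⟨l, rfl⟩ : ∃ l', l = l' + 1 := ⟨l - 1, by omega⟩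
  rw [pos_eq_getElem (by omega), pos_eq_getElem (by omega)]
  exact List.pairwise_iff_getElem.1 P.pairwise_weightPositions k l _ _ (by omega)

theorem pos_mem {k : ℕ} (hk : 1 ≤ k) (hk' : k ≤ P.numWeights) : P.pos k ∈ P.weightPositions := by
  obtain ⟨k, rfl⟩ : ∃ k', k = k' + 1 := ⟨k - 1, by omega⟩
  rw [pos_eq_getElem (by omega)]
  exact List.getElem_mem _

theorem exists_pos_eq {j : ℕ} (hj : j ∈ P.weightPositions) :
    ∃ k, 1 ≤ k ∧ k ≤ P.numWeights ∧ P.pos k = j := by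
  obtain ⟨k, hk, rfl⟩ := List.getElem_of_mem hj
  exact ⟨k + 1, by omega, hk, pos_eq_getElem hk⟩

theorem last_mem_weightPositions (h0 : 2 < P.index 0) : P.s + 1 ∈ P.weightPositions := by
  rw [mem_weightPositions]
  refine ⟨by omega, le_rfl, ?_⟩
  rwa [ZMod.natCast_self]

theorem numWeights_pos (h0 : 2 < P.index 0) : 0 < P.numWeights :=
  List.length_pos_of_mem (last_mem_weightPositions h0)

theorem pos_last (h0 : 2 < P.index 0) : P.pos P.numWeights = P.s + 1 := by
  obtain ⟨k, hk, hk', h⟩ := exists_pos_eq (last_mem_weightPositions h0)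
  rcases hk'.lt_or_eq with h1 | rfl
  · have h2 := pos_lt_pos hk h1 le_rfl
    have h3 := (mem_weightPositions P _).1 (pos_mem (P := P) (k := P.numWeights) (by omega) le_rfl)
    omega
  · exact h

theorem wpos_zero (P : FramedPolygon) : P.wpos 0 = 0 := rfl

theorem wpos_of_pos {k : ℕ} (hk : 1 ≤ k) : P.wpos k = P.pos k := if_neg (by omega)

theorem wpos_last (h0 : 2 < P.index 0) : P.wpos P.numWeights = P.s + 1 := by
  rw [wpos_of_pos (numWeights_pos h0), pos_last h0]

theorem wpos_lt_wpos {k l : ℕ} (hkl : k < l) (hl : l ≤ P.numWeights) : P.wpos k < P.wpos l := by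
  rw [wpos_of_pos (k := l) (by omega)]
  rcases Nat.eq_zero_or_pos k with rfl | hk
  · have := (mem_weightPositions P _).1 (pos_mem (P := P) (k := l) (by omega) hl)
    rw [wpos_zero]
    omega
  · rw [wpos_of_pos hk]
    exact pos_lt_pos hk hkl hl

theorem wpos_lt (h0 : 2 < P.index 0) {k : ℕ} (hk : k < P.numWeights) : P.wpos k < P.s + 1 := by
  rw [← wpos_last h0]
  exact wpos_lt_wpos hk le_rfl

theorem two_lt_index_iff (h0 : 2 < P.index 0) {j : ℕ} (hj : j < P.s + 1) :
    2 < P.index (j : ZMod (P.s + 1)) ↔ ∃ k < P.numWeights, P.wpos k = j := by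
  rcases Nat.eq_zero_or_pos j with rfl | hj0
  · rw [Nat.cast_zero]
    exact ⟨fun _ => ⟨0, numWeights_pos h0, rfl⟩, fun _ => h0⟩
  · constructor
    · intro h
      obtain ⟨k, hk, hk', h1⟩ := exists_pos_eq ((mem_weightPositions P j).2 ⟨hj0, by omega, h⟩)
      refine ⟨k, ?_, by rw [wpos_of_pos hk, h1]⟩
      rcases hk'.lt_or_eq with h2 | rfl
      · exact h2
      · rw [pos_last h0] at h1
        omega
    · rintro ⟨k, hk, rfl⟩
      have hk1 : 1 ≤ k := by
        rcases Nat.eq_zero_or_pos k with rfl | h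
        · rw [wpos_zero] at hj0
          omega
        · exact h
      rw [wpos_of_pos hk1]
      exact ((mem_weightPositions P _).1 (pos_mem hk1 hk.le)).2.2

set_option linter.unusedSectionVars false

variable [NeZero n]

theorem natCast_pos_residueRep (h0 : 2 < P.index 0) (hn : P.numWeights = n) (i : ZMod n) :
    (P.pos (residueRep n i) : ZMod (P.s + 1)) = P.wvert n i := by
  unfold residueRep wvert
  split_ifs with h
  · rw [h, wpos_zero, ← hn, pos_last h0, ZMod.natCast_self, Nat.cast_zero]
  · rw [wpos_of_pos (by omega)]

theorem arc_pos (hn : P.numWeights = n) (i : ZMod n) : 0 < P.arc n i := by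
  have := ZMod.val_lt i
  have := wpos_lt_wpos (P := P) (k := i.val) (l := i.val + 1) (by omega) (by omega)
  unfold arc
  omega

theorem sum_Ico_sub (f : ℕ → ℤ) (n : ℕ) (hn : 1 ≤ n) :
    ∑ l ∈ Finset.Ico 1 n, (f (l + 1) - f l - 1) = f n - f 1 - ((n : ℤ) - 1) := by
  induction n, hn using Nat.le_induction with
  | base => simp
  | succ n hn ih =>
    rw [Finset.sum_Ico_succ_top hn, ih]
    push_cast
    ring

theorem gap_residueRep (h0 : 2 < P.index 0) (hn : P.numWeights = n) (i : ZMod n) :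
    P.gap (residueRep n i) = (P.arc n i : ℤ) - 1 := by
  have hi := ZMod.val_lt i
  have hlt := wpos_lt_wpos (P := P) (k := i.val) (l := i.val + 1) (by omega) (by omega)
  unfold gap residueRep arc
  rw [Nat.cast_sub hlt.le]
  by_cases h : i.val = 0
  · rw [if_pos h, if_neg (by omega), sum_Ico_sub (fun l => (P.pos l : ℤ)) _ (by omega), pos_last h0,
      h, wpos_zero, wpos_of_pos (by omega)]
    push_cast
    ring
  · rw [if_neg h, if_pos (by omega), wpos_of_pos (by omega), wpos_of_pos (by omega)]

theorem val_add_one_cases (i : ZMod n) :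
    (i.val + 1 < n ∧ (i + 1).val = i.val + 1) ∨ (i.val + 1 = n ∧ (i + 1).val = 0) := by
  have hi := ZMod.val_lt i
  have h1 : (i + 1).val = (i.val + 1) % n := by
    have h2 := ZMod.val_add i ((1 : ℕ) : ZMod n)
    rw [Nat.cast_one] at h2
    rw [h2, ← Nat.cast_one, ZMod.val_natCast, Nat.add_mod_mod]
  rcases Nat.lt_or_ge (i.val + 1) n with h | h
  · exact Or.inl ⟨h, by rw [h1, Nat.mod_eq_of_lt h]⟩
  · have : i.val + 1 = n := by omega
    exact Or.inr ⟨this, by rw [h1, this, Nat.mod_self]⟩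

theorem wvert_add_one (h0 : 2 < P.index 0) (hn : P.numWeights = n) (i : ZMod n) :
    P.wvert n (i + 1) = P.wvert n i + (P.arc n i : ZMod (P.s + 1)) := by
  have hi := ZMod.val_lt i
  have hlt := wpos_lt_wpos (P := P) (k := i.val) (l := i.val + 1) (by omega) (by omega)
  unfold wvert arc
  rw [← Nat.cast_add, Nat.add_sub_cancel' hlt.le]
  rcases val_add_one_cases i with ⟨h, h'⟩ | ⟨h, h'⟩
  · rw [h']
  · rw [h', h, ← hn, wpos_last h0, wpos_zero, ZMod.natCast_self, Nat.cast_zero]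

theorem wvert_zero (P : FramedPolygon) (n : ℕ) : P.wvert n 0 = 0 := by
  cases n <;> simp [wvert, wpos_zero]

theorem two_lt_index_wvert (h0 : 2 < P.index 0) (hn : P.numWeights = n) (i : ZMod n) :
    2 < P.index (P.wvert n i) := by
  have hi : i.val < P.numWeights := hn ▸ ZMod.val_lt i
  exact (two_lt_index_iff h0 (wpos_lt h0 hi)).2 ⟨_, hi, rfl⟩

theorem exists_wvert_eq (h0 : 2 < P.index 0) (hn : P.numWeights = n) {v : ZMod (P.s + 1)}
    (hv : 2 < P.index v) : ∃ i, P.wvert n i = v := by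
  obtain ⟨t, ht, rfl⟩ := exists_eq_add_natCast 0 v
  rw [zero_add] at hv
  obtain ⟨k, hk, hkt⟩ := (two_lt_index_iff h0 ht).1 hv
  refine ⟨(k : ZMod n), ?_⟩
  unfold wvert
  rw [ZMod.val_natCast, Nat.mod_eq_of_lt (hn ▸ hk), hkt, zero_add]

/-- The half-open arcs from `x_i` to `x_{i+1}` are disjoint. -/
theorem wvert_add_inj (h0 : 2 < P.index 0) (hn : P.numWeights = n) {i j : ZMod n} {t u : ℕ}
    (ht : t < P.arc n i) (hu : u < P.arc n j)
    (h : P.wvert n i + (t : ZMod (P.s + 1)) = P.wvert n j + (u : ZMod (P.s + 1))) :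
    i = j ∧ t = u := by
  have hi : i.val < P.numWeights := hn ▸ ZMod.val_lt i
  have hj : j.val < P.numWeights := hn ▸ ZMod.val_lt j
  unfold arc at ht hu
  unfold wvert at h
  rw [← Nat.cast_add, ← Nat.cast_add] at h
  have hle : ∀ k < P.numWeights, P.wpos (k + 1) ≤ P.s + 1 := fun k hk => by
    rw [← wpos_last h0]
    rcases Nat.lt_or_ge (k + 1) P.numWeights with h | h
    · exact (wpos_lt_wpos h le_rfl).le
    · have : k + 1 = P.numWeights := by omega
      rw [this]
  have h1 := hle _ hi
  have h2 := hle _ hj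
  rw [ZMod.natCast_eq_natCast_iff', Nat.mod_eq_of_lt (by omega), Nat.mod_eq_of_lt (by omega)] at h
  have hij : i.val = j.val := by
    have hmono : ∀ k l, k < l → l < P.numWeights → P.wpos (k + 1) ≤ P.wpos l := fun k l h1 h2 => by
      rcases Nat.lt_or_ge (k + 1) l with h | h
      · exact (wpos_lt_wpos h h2.le).le
      · have : k + 1 = l := by omega
        rw [this]
    rcases Nat.lt_trichotomy i.val j.val with h3 | h3 | h3
    · have := hmono _ _ h3 hj
      omega
    · exact h3
    · have := hmono _ _ h3 hi
      omega
  have hij' := ZMod.val_injective n hij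
  subst hij'
  exact ⟨rfl, by omega⟩

theorem wvert_injective (h0 : 2 < P.index 0) (hn : P.numWeights = n) :
    Function.Injective (P.wvert n) := fun i j h =>
  (wvert_add_inj (t := 0) (u := 0) h0 hn (arc_pos hn i) (arc_pos hn j) (by simpa using h)).1

theorem index_wvert_add_le (h0 : 2 < P.index 0) (hn : P.numWeights = n) {i : ZMod n} {t : ℕ}
    (ht0 : 0 < t) (ht : t < P.arc n i) : P.index (P.wvert n i + (t : ZMod (P.s + 1))) ≤ 2 := by
  by_contra hlt
  obtain ⟨j, hj⟩ := exists_wvert_eq h0 hn (not_le.1 hlt)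
  have := (wvert_add_inj (t := 0) (u := t) h0 hn (arc_pos hn j) ht (by simpa using hj)).2
  omega

/-- The next weight after `x_i` is the first vertex of index greater than `2`. -/
theorem eq_arc_of_first (h0 : 2 < P.index 0) (hn : P.numWeights = n) {i : ZMod n} {d : ℕ}
    (hd : 0 < d) (hw : 2 < P.index (P.wvert n i + (d : ZMod (P.s + 1))))
    (hno : ∀ t, 0 < t → t < d → P.index (P.wvert n i + (t : ZMod (P.s + 1))) ≤ 2) :
    P.arc n i = d ∧ P.wvert n (i + 1) = P.wvert n i + (d : ZMod (P.s + 1)) := by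
  have h1 : P.arc n i = d := by
    rcases Nat.lt_trichotomy (P.arc n i) d with h | h | h
    · have h2 := hno _ (arc_pos hn i) h
      rw [← wvert_add_one h0 hn] at h2
      have := two_lt_index_wvert h0 hn (i + 1)
      omega
    · exact h
    · have := index_wvert_add_le h0 hn hd h
      omega
  exact ⟨h1, by rw [wvert_add_one h0 hn, h1]⟩

theorem diagonalsGoTo_iff (h0 : 2 < P.index 0) (hn : P.numWeights = n) (i j : ZMod n) :
    P.DiagonalsGoTo n i j ↔ ∀ v, P.diag.Adj (P.wvert n i) v ↔
      (v ≠ P.wvert n i ∧ v ≠ P.wvert n i + 1 ∧ v ≠ P.wvert n i - 1 ∧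
        ∃ t ≤ P.arc n j, v = P.wvert n j + (t : ZMod (P.s + 1))) := by
  unfold DiagonalsGoTo
  rw [natCast_pos_residueRep h0 hn, gap_residueRep h0 hn]
  simp only [Nat.cast_add, natCast_pos_residueRep h0 hn, sub_add_cancel, Nat.cast_le]

theorem weight_residueRep (h0 : 2 < P.index 0) (hn : P.numWeights = n) (i : ZMod n) :
    P.weight (residueRep n i) = P.index (P.wvert n i) := by
  unfold weight
  rw [natCast_pos_residueRep h0 hn]

theorem exists_two_adj {v : ZMod (P.s + 1)} (hv : 2 < P.index v) :
    ∃ a b, a ≠ b ∧ P.diag.Adj v a ∧ P.diag.Adj v b := by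
  unfold index at hv
  have h1 : 1 < (P.diag.neighborSet v).ncard := by omega
  obtain ⟨a, ha, b, hb, hab⟩ := (Set.one_lt_ncard (Set.toFinite _)).1 h1
  exact ⟨a, b, hab, ha, hb⟩

/-- Distinct arcs share at most end points, whereas the at least two diagonals from a weight end in
both arcs. -/
theorem diagonalsGoTo_unique (h0 : 2 < P.index 0) (hn : P.numWeights = n) (hn2 : 2 ≤ n)
    {i j j' : ZMod n} (h : P.DiagonalsGoTo n i j) (h' : P.DiagonalsGoTo n i j') : j = j' := by
  rw [diagonalsGoTo_iff h0 hn] at h h'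
  obtain ⟨a, b, hab, ha, hb⟩ := exists_two_adj (two_lt_index_wvert h0 hn i)
  by_contra hne
  have key : ∀ v, P.diag.Adj (P.wvert n i) v → (v = P.wvert n j ∧ j = j' + 1) ∨
      (v = P.wvert n j' ∧ j' = j + 1) := by
    intro v hv
    obtain ⟨-, -, -, t, ht, hvt⟩ := (h v).1 hv
    obtain ⟨-, -, -, t', ht', hvt'⟩ := (h' v).1 hv
    rcases ht.lt_or_eq with h1 | rfl
    · rcases ht'.lt_or_eq with h2 | rfl
      · exact absurd (wvert_add_inj h0 hn h1 h2 (hvt.symm.trans hvt')).1 hne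
      · rw [← wvert_add_one h0 hn] at hvt'
        obtain ⟨h3, rfl⟩ := wvert_add_inj (u := 0) h0 hn h1 (arc_pos hn (j' + 1))
          (by rw [← hvt, hvt', Nat.cast_zero, add_zero])
        left
        exact ⟨by simpa using hvt, h3⟩
    · rw [← wvert_add_one h0 hn] at hvt
      rcases ht'.lt_or_eq with h2 | rfl
      · obtain ⟨h3, rfl⟩ := wvert_add_inj (u := 0) h0 hn h2 (arc_pos hn (j + 1))
          (by rw [← hvt', hvt, Nat.cast_zero, add_zero])
        right
        exact ⟨by simpa using hvt', h3⟩
      · rw [← wvert_add_one h0 hn, hvt] at hvt'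
        exact absurd (add_right_cancel (wvert_injective h0 hn hvt')) hne
  -- Arcs which follow each other in both orders force `n = 2`. Then `x_i` is one of the two common
  -- end points, which would make it adjacent to itself.
  have hcard : j = j' + 1 → j' = j + 1 → a = P.wvert n i ∨ b = P.wvert n i := by
    intro e1 e2
    have h2 : (2 : ZMod n) = 0 := by
      linear_combination -e1 - e2
    have hn' : n = 2 := by
      have : ((2 : ℕ) : ZMod n) = 0 := by exact_mod_cast h2
      rw [ZMod.natCast_eq_zero_iff] at this
      have := Nat.le_of_dvd (by omega) this
      omega
    have hall : ∀ k : ZMod n, k = j ∨ k = j' := by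
      have key2 : ∀ k l : ZMod 2, k = l + 1 ∨ k = l := by decide
      subst hn'
      intro k
      rw [e1]
      exact key2 k j'
    rcases key a ha with ⟨ea, -⟩ | ⟨ea, -⟩ <;> rcases key b hb with ⟨eb, -⟩ | ⟨eb, -⟩
    · exact absurd (ea.trans eb.symm) hab
    · rcases hall i with rfl | rfl
      · exact Or.inl ea
      · exact Or.inr eb
    · rcases hall i with rfl | rfl
      · exact Or.inr eb
      · exact Or.inl ea
    · exact absurd (ea.trans eb.symm) hab
  have ha' : a ≠ P.wvert n i := ha.ne'
  have hb' : b ≠ P.wvert n i := hb.ne'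
  rcases key a ha with ⟨ea, fa⟩ | ⟨ea, fa⟩ <;> rcases key b hb with ⟨eb, fb⟩ | ⟨eb, fb⟩
  · exact hab (ea.trans eb.symm)
  · exact (hcard fa fb).elim ha' hb'
  · exact (hcard fb fa).elim ha' hb'
  · exact hab (ea.trans eb.symm)

end FramedPolygon

/-! ### Fans and the arcs they go to -/

/-- Applied to the position of one endpoint of the `J`-th diagonal, this yields the range of
diagonals of the fan through it. -/
theorem exists_extent (p : ℕ → ℕ) {M J : ℕ} (hJ : J ≤ M) :
    ∃ J₁ J₂, J₁ ≤ J ∧ J ≤ J₂ ∧ J₂ ≤ M ∧ (∀ K, J₁ ≤ K → K ≤ J₂ → p K = p J) ∧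
      (J₁ = 0 ∨ p (J₁ - 1) ≠ p J) ∧ (J₂ = M ∨ p (J₂ + 1) ≠ p J) := by
  have hdown : ∀ J, ∃ J₁ ≤ J, (∀ K, J₁ ≤ K → K ≤ J → p K = p J) ∧
      (J₁ = 0 ∨ p (J₁ - 1) ≠ p J) := by
    intro J
    induction J with
    | zero => exact ⟨0, le_rfl, fun K h1 h2 => by rw [Nat.le_zero.1 h2], Or.inl rfl⟩
    | succ J ih =>
      by_cases h : p J = p (J + 1)
      · obtain ⟨J₁, h1, h2, h3⟩ := ih
        refine ⟨J₁, by omega, fun K hK hK' => ?_, h ▸ h3⟩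
        rcases hK'.lt_or_eq with h4 | rfl
        · rw [h2 K hK (by omega), h]
        · rfl
      · exact ⟨J + 1, le_rfl, fun K h1 h2 => by rw [le_antisymm h2 h1], Or.inr (by simpa using h)⟩
  have hup : ∀ d, ∀ J, J + d = M → ∃ J₂, J ≤ J₂ ∧ J₂ ≤ M ∧ (∀ K, J ≤ K → K ≤ J₂ → p K = p J) ∧
      (J₂ = M ∨ p (J₂ + 1) ≠ p J) := by
    intro d
    induction d with
    | zero =>
      intro J hJ
      exact ⟨J, le_rfl, by omega, fun K h1 h2 => by rw [le_antisymm h2 h1], Or.inl (by omega)⟩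
    | succ d ih =>
      intro J hJ
      by_cases h : p (J + 1) = p J
      · obtain ⟨J₂, h1, h2, h3, h4⟩ := ih (J + 1) (by omega)
        refine ⟨J₂, by omega, h2, fun K hK hK' => ?_, h ▸ h4⟩
        rcases hK.lt_or_eq with h5 | rfl
        · rw [h3 K h5 hK', h]
        · rfl
      · exact ⟨J, le_rfl, by omega, fun K h1 h2 => by rw [le_antisymm h2 h1], Or.inr h⟩
  obtain ⟨J₁, h1, h2, h3⟩ := hdown J
  obtain ⟨J₂, h4, h5, h6, h7⟩ := hup (M - J) J (by omega)
  refine ⟨J₁, J₂, h1, h4, h5, fun K hK hK' => ?_, h3, h7⟩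
  rcases Nat.le_total K J with h | h
  · exact h2 K hK h
  · exact h6 K h hK'

namespace FramedPolygon

/-- The diagonals from the weight `x_i` go to the arc `(x_j, x_{j+1})`, whose length is determined
by `x_i`. -/
structure Fan (P : FramedPolygon) (n : ℕ) (i j : ZMod n) : Prop where
  goes : P.DiagonalsGoTo n i j
  -- An arc of length `a` has `a + 1` vertices, and `x_i` has one diagonal less than its index. If
  -- `x_i` bounds the arc, then `x_i` and one polygon neighbour are not far ends of diagonals; this
  -- accounts for the difference of `2`.
  arc_eq : (P.arc n j = P.index (P.wvert n i) ∧ (i = j ∨ i = j + 1)) ∨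
    (P.arc n j + 2 = P.index (P.wvert n i) ∧ i ≠ j ∧ i ≠ j + 1)

namespace IsStrip

variable {P : FramedPolygon} {M : ℕ} {e : ZMod (P.s + 1)} {q : ℕ → ℕ}

theorem index_right_le (h : P.IsStrip M e q) {J : ℕ} (hJ : J ≤ M)
    (hprev : 0 < J → q (J - 1) < q J) (hnext : J < M → q J < q (J + 1)) :
    P.index (e + ((1 + q J : ℕ) : ZMod (P.s + 1))) ≤ 2 := by
  rw [h.index_right (h.path.mono_lip hJ le_rfl).1]
  have : ((Finset.range (M + 1)).filter fun K => q K = q J) ⊆ {J} := by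
    intro K hK
    simp only [Finset.mem_filter, Finset.mem_range, Finset.mem_singleton] at hK ⊢
    rcases Nat.lt_trichotomy K J with h1 | h1 | h1
    · have := (h.path.mono_lip (J := K) (J' := J - 1) (by omega) (by omega)).1
      have := hprev (by omega)
      omega
    · exact h1
    · have := (h.path.mono_lip (J := J + 1) (J' := K) (by omega) (by omega)).1
      have := hnext (by omega)
      omega
  have := Finset.card_le_card this
  rw [Finset.card_singleton] at this
  omega

theorem two_lt_index_right (h : P.IsStrip M e q) {J : ℕ} (hJ : J < M) (hq : q (J + 1) = q J) :
    2 < P.index (e + ((1 + q J : ℕ) : ZMod (P.s + 1))) := by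
  rw [h.index_right (h.path.mono_lip hJ.le le_rfl).1]
  have : ({J, J + 1} : Finset ℕ) ⊆ (Finset.range (M + 1)).filter fun K => q K = q J := by
    intro K hK
    simp only [Finset.mem_filter, Finset.mem_range, Finset.mem_insert, Finset.mem_singleton] at hK ⊢
    rcases hK with rfl | rfl
    · exact ⟨by omega, rfl⟩
    · exact ⟨by omega, hq⟩
  have := Finset.card_le_card this
  rw [Finset.card_pair (by omega)] at this
  omega

theorem two_lt_index_left (h : P.IsStrip M e q) {J : ℕ} (hJ : J < M) (hq : q (J + 1) = q J + 1) :
    2 < P.index (e + ((M + 3 + q J - J : ℕ) : ZMod (P.s + 1))) := by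
  have hle := h.path.le_self hJ.le
  have hlip := h.path.mono_lip hJ.le le_rfl
  have e1 : M + 3 + q J - J = M + 3 - (J - q J) := by omega
  rw [e1, h.index_left (by omega)]
  have : ({J, J + 1} : Finset ℕ) ⊆ (Finset.range (M + 1)).filter fun K => K - q K = J - q J := by
    intro K hK
    simp only [Finset.mem_filter, Finset.mem_range, Finset.mem_insert, Finset.mem_singleton] at hK ⊢
    rcases hK with rfl | rfl
    · exact ⟨by omega, rfl⟩
    · exact ⟨by omega, by omega⟩
  have := Finset.card_le_card this
  rw [Finset.card_pair (by omega)] at this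
  omega

variable {n : ℕ} [NeZero n]

/-- The fan of a weight on the second side of a strip. -/
theorem exists_fan_left (h : P.IsStrip M e q) (h0 : 2 < P.index 0) (hn : P.numWeights = n)
    (hn2 : 2 ≤ n) {J : ℕ} (hJ : J < M) (hq : q (J + 1) = q J + 1) {i : ZMod n}
    (hi : P.wvert n i = e + ((M + 3 + q J - J : ℕ) : ZMod (P.s + 1))) :
    ∃ j, P.Fan n i j ∧
      (J + 1 < M → q (J + 2) = q (J + 1) →
        P.wvert n (j + 1) = e + ((1 + q (J + 1) : ℕ) : ZMod (P.s + 1))) ∧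
      (0 < J → q J = q (J - 1) → P.wvert n j = e + ((1 + q J : ℕ) : ZMod (P.s + 1))) ∧
      (J = 0 → j = i) ∧ (J + 1 = M → j + 1 = i) := by
  have hN := h.natCast_eq_zero
  have hleJ := h.path.le_self hJ.le
  have hlipJ := h.path.mono_lip hJ.le le_rfl
  have hMle := h.path.le_self (le_refl M)
  -- The fan consists of the diagonals `J₁, …, J₂`, since `K - q K` locates the endpoint on the
  -- second side. Their far ends are consecutive vertices, and all but the outermost have index `2`.
  obtain ⟨J₁, J₂, a1, a2, a3, a4, a5, a6⟩ := exists_extent (fun K => K - q K) hJ.le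
  have a4' : ∀ K, J₁ ≤ K → K ≤ J₂ → q K + J = q J + K := fun K h1 h2 => by
    have := a4 K h1 h2
    have := h.path.le_self (J := K) (by omega)
    omega
  have hJJ₂ : J + 1 ≤ J₂ := by
    by_contra hlt
    obtain rfl : J₂ = J := by omega
    rcases a6 with h1 | h1
    · omega
    · apply h1
      simp only [hq]
      omega
  have hout : ∀ K ≤ M, K - q K = J - q J → J₁ ≤ K ∧ K ≤ J₂ := by
    intro K hK he
    have hleK := h.path.le_self hK
    constructor
    · by_contra hlt
      rcases a5 with h1 | h1
      · omega
      · have l1 := h.path.mono_lip (J := K) (J' := J₁ - 1) (by omega) (by omega)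
        have l2 := h.path.mono_lip (J := J₁ - 1) (J' := J) (by omega) (by omega)
        apply h1
        omega
    · by_contra hlt
      rcases a6 with h1 | h1
      · omega
      · have l1 := h.path.mono_lip (J := J₂ + 1) (J' := K) (by omega) (by omega)
        have l2 := h.path.mono_lip (J := J) (J' := J₂ + 1) (by omega) (by omega)
        have l3 := h.path.le_self (J := J₂ + 1) (by omega)
        apply h1
        omega
  have e1 : M + 3 + q J - J = M + 3 - (J - q J) := by omega
  rw [e1] at hi
  have hidx : P.index (P.wvert n i) = J₂ - J₁ + 2 := by
    rw [hi, h.index_left (by omega)]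
    have : ((Finset.range (M + 1)).filter fun K => K - q K = J - q J) = Finset.Icc J₁ J₂ := by
      ext K
      simp only [Finset.mem_filter, Finset.mem_range, Finset.mem_Icc]
      exact ⟨fun hK => hout K (by omega) hK.2, fun hK => ⟨by omega, a4 K hK.1 hK.2⟩⟩
    rw [this, Nat.card_Icc]
    omega
  have hadj : ∀ v, P.diag.Adj (P.wvert n i) v ↔
      ∃ t ≤ J₂ - J₁, v = e + ((1 + q J₁ + t : ℕ) : ZMod (P.s + 1)) := by
    intro v
    rw [hi, h.adj_left_iff (by omega)]
    have q1 := a4' J₁ le_rfl (by omega)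
    constructor
    · rintro ⟨K, hK, hK', rfl⟩
      obtain ⟨b1, b2⟩ := hout K hK hK'
      have := a4' K b1 b2
      refine ⟨K - J₁, by omega, ?_⟩
      congr 2
      omega
    · rintro ⟨t, ht, rfl⟩
      refine ⟨J₁ + t, by omega, a4 _ (by omega) (by omega), ?_⟩
      have := a4' (J₁ + t) (by omega) (by omega)
      congr 2
      omega
  have hside : ∀ v, P.diag.Adj (P.wvert n i) v → v ≠ P.wvert n i ∧ v ≠ P.wvert n i + 1 ∧
      v ≠ P.wvert n i - 1 := fun v hv => by
    obtain ⟨s1, s2⟩ := P.not_side _ _ hv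
    refine ⟨hv.ne', s1, fun hc => s2 ?_⟩
    rw [hc]
    ring
  have hinner : ∀ K, J₁ < K ∨ K = 0 → J₁ ≤ K → K < J₂ →
      P.index (e + ((1 + q K : ℕ) : ZMod (P.s + 1))) ≤ 2 := by
    intro K hK hK' hK2
    refine h.index_right_le (by omega) (fun hK0 => ?_) fun _ => ?_
    · have := a4' (K - 1) (by omega) (by omega)
      have := a4' K (by omega) (by omega)
      omega
    · have := a4' (K + 1) (by omega) (by omega)
      have := a4' K (by omega) (by omega)
      omega
  have q1 := a4' J₁ le_rfl (by omega)
  have q2 := a4' J₂ (by omega) le_rfl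
  have hle1 := h.path.le_self (J := J₁) (by omega)
  have hlip2 := h.path.mono_lip (J := J₂) (J' := M) a3 le_rfl
  -- the vertex at the end of the fan
  have hend : J₂ < M → 2 < P.index (e + ((1 + q J₂ : ℕ) : ZMod (P.s + 1))) := fun hlt => by
    refine h.two_lt_index_right hlt ?_
    rcases a6 with h1 | h1
    · omega
    · have := h.path.step J₂ hlt
      have := h.path.le_self (J := J₂) (by omega)
      have := h.path.le_self (J := J₂ + 1) (by omega)
      omega
  by_cases hstart : J₁ = 0
  · -- the fan contains the first diagonal
    subst hstart
    have hz := h.path.zero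
    have hk : J - q J = 0 := by omega
    rw [hk, Nat.sub_zero] at hi
    -- Here `x_i` is the vertex just before the first ear: the arc starts at `x_i` and passes the
    -- ear, which has coordinate `0`.
    have hi1 : ∀ t : ℕ, P.wvert n i + ((t + 1 : ℕ) : ZMod (P.s + 1)) =
        e + (t : ZMod (P.s + 1)) := by
      intro t
      rw [hi]
      push_cast at hN ⊢
      linear_combination hN
    have hinner' : ∀ t, 0 < t → t < J₂ + 2 → P.index (P.wvert n i + (t : ZMod (P.s + 1))) ≤ 2 := by
      intro t ht ht'
      obtain ⟨t, rfl⟩ : ∃ t', t = t' + 1 := ⟨t - 1, by omega⟩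
      rw [hi1]
      rcases Nat.eq_zero_or_pos t with rfl | ht0
      · rw [h.index_first]
        omega
      · have := hinner (t - 1) (by omega) (by omega) (by omega)
        have e2 : 1 + q (t - 1) = t := by
          have := a4' (t - 1) (by omega) (by omega)
          omega
        rwa [e2] at this
    rcases a3.lt_or_eq with hlt | rfl
    · have e2 : 1 + q J₂ = J₂ + 1 := by omega
      have hw := hend hlt
      rw [e2, ← hi1] at hw
      obtain ⟨harc, hnext⟩ := eq_arc_of_first (P := P) h0 hn (d := J₂ + 1 + 1) (by omega) hw hinner'
      refine ⟨i, ⟨(diagonalsGoTo_iff h0 hn i i).2 fun v => ?_, Or.inl ⟨by omega, Or.inl rfl⟩⟩,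
        fun hJM hqJ => ?_, fun hJ0 hqJ => ?_, fun _ => rfl, fun hJM => by omega⟩
      · constructor
        · intro hv
          obtain ⟨s1, s2, s3⟩ := hside v hv
          obtain ⟨t, ht, rfl⟩ := (hadj v).1 hv
          refine ⟨s1, s2, s3, t + 1 + 1, by omega, ?_⟩
          rw [hi1, hz]
          congr 2
          omega
        · rintro ⟨s1, s2, s3, t, ht, rfl⟩
          rw [hadj]
          have t0 : t ≠ 0 := by
            rintro rfl
            simp at s1
          have t1 : t ≠ 1 := by
            rintro rfl
            simp at s2
          refine ⟨t - 2, by omega, ?_⟩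
          obtain ⟨t, rfl⟩ : ∃ t', t = t' + 1 + 1 := ⟨t - 2, by omega⟩
          rw [hi1, hz]
          congr 2
          omega
      · have hJ2 : J₂ = J + 1 := by
          by_contra hne
          have := a4' (J + 2) (by omega) (by omega)
          omega
        rw [hnext, hi1]
        congr 2
        have := a4' (J + 1) (by omega) (by omega)
        omega
      · have := a4' (J - 1) (by omega) (by omega)
        omega
    -- A fan containing all diagonals leaves `x_i` as the only weight.
    · exfalso
      have hw : 2 < P.index (P.wvert n i + ((J₂ + 4 : ℕ) : ZMod (P.s + 1))) := by
        rw [hN, add_zero]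
        exact two_lt_index_wvert h0 hn i
      obtain ⟨-, hnext⟩ := eq_arc_of_first (P := P) h0 hn (by omega) hw (by
        intro t ht ht'
        rcases Nat.lt_or_ge t (J₂ + 2) with h1 | h1
        · exact hinner' t ht h1
        · obtain ⟨t, rfl⟩ : ∃ t', t = t' + 1 := ⟨t - 1, by omega⟩
          rw [hi1]
          rcases Nat.lt_or_ge t (J₂ + 2) with h2 | h2
          · have e3 : t = 1 + q J₂ := by omega
            rw [e3]
            refine h.index_right_le le_rfl (fun _ => ?_) fun h3 => by omega
            have := a4' (J₂ - 1) (by omega) (by omega)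
            omega
          · have e3 : t = 2 + q J₂ := by omega
            rw [e3, h.index_last]
            omega)
      rw [hN, add_zero] at hnext
      have h1 := wvert_injective h0 hn hnext
      have h2 : ((1 : ℕ) : ZMod n) = 0 := by simpa using h1
      rw [ZMod.natCast_eq_zero_iff] at h2
      have := Nat.le_of_dvd one_pos h2
      omega
  · have hw1 : 2 < P.index (e + ((1 + q J₁ : ℕ) : ZMod (P.s + 1))) := by
      have hstep : q (J₁ - 1 + 1) = q (J₁ - 1) := by
        rcases a5 with h1 | h1
        · omega
        · have h2 := h.path.step (J₁ - 1) (by omega)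
          have := h.path.le_self (J := J₁ - 1) (by omega)
          rw [Nat.sub_add_cancel (by omega)] at h2 ⊢
          omega
      have h2 := h.two_lt_index_right (J := J₁ - 1) (by omega) hstep
      rwa [← hstep, Nat.sub_add_cancel (by omega)] at h2
    obtain ⟨j, hj⟩ := exists_wvert_eq h0 hn hw1
    have hj1 : ∀ t : ℕ, P.wvert n j + (t : ZMod (P.s + 1)) =
        e + ((1 + q J₁ + t : ℕ) : ZMod (P.s + 1)) := by
      intro t
      rw [hj]
      push_cast
      ring
    have hij : i ≠ j := by
      rintro rfl
      rw [hi, h.inj (by omega) (by omega)] at hj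
      omega
    have hqJ0 : 0 < J → q J = q (J - 1) → q J₁ = q J := fun hJ0 hqJ => by
      have : J₁ = J := by
        by_contra hne
        have := a4' (J - 1) (by omega) (by omega)
        omega
      rw [this]
    rcases a3.lt_or_eq with hlt | rfl
    · have hw := hend hlt
      have e2 : 1 + q J₂ = 1 + q J₁ + (J₂ - J₁) := by omega
      rw [e2, ← hj1] at hw
      obtain ⟨harc, hnext⟩ := eq_arc_of_first (P := P) h0 hn (by omega) hw (by
        intro t ht ht'
        have := hinner (J₁ + t) (by omega) (by omega) (by omega)
        have e3 : 1 + q (J₁ + t) = 1 + q J₁ + t := by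
          have := a4' (J₁ + t) (by omega) (by omega)
          omega
        rwa [e3, ← hj1] at this)
      have hij' : i ≠ j + 1 := by
        rintro rfl
        rw [hi, hj1, h.inj (by omega) (by omega)] at hnext
        omega
      refine ⟨j, ⟨(diagonalsGoTo_iff h0 hn i j).2 fun v => ?_, Or.inr ⟨by omega, hij, hij'⟩⟩,
        fun hJM hqJ => ?_, fun hJ0 hqJ => ?_, fun hJ0 => by omega, fun hJM => by omega⟩
      · constructor
        · intro hv
          obtain ⟨s1, s2, s3⟩ := hside v hv
          obtain ⟨t, ht, rfl⟩ := (hadj v).1 hv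
          exact ⟨s1, s2, s3, t, by omega, (hj1 t).symm⟩
        · rintro ⟨s1, s2, s3, t, ht, rfl⟩
          rw [hadj]
          exact ⟨t, by omega, hj1 t⟩
      · have hJ2 : J₂ = J + 1 := by
          by_contra hne
          have := a4' (J + 2) (by omega) (by omega)
          omega
        rw [hnext, hj1, ← e2, hJ2]
      · rw [hj, hqJ0 hJ0 hqJ]
    -- The fan contains the last diagonal: its last far end is followed by the other ear and then by
    -- `x_i`, which ends the arc.
    · have hadd : P.wvert n j + ((J₂ + 2 - J₁ : ℕ) : ZMod (P.s + 1)) = P.wvert n i := by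
        rw [hj1, hi]
        congr 2
        omega
      have hw : 2 < P.index (P.wvert n j + ((J₂ + 2 - J₁ : ℕ) : ZMod (P.s + 1))) := by
        rw [hadd]
        exact two_lt_index_wvert h0 hn i
      obtain ⟨harc, hnext⟩ := eq_arc_of_first (P := P) h0 hn (by omega) hw (by
        intro t ht ht'
        rcases Nat.lt_or_ge (J₁ + t) J₂ with h1 | h1
        · have := hinner (J₁ + t) (by omega) (by omega) (by omega)
          have e3 : 1 + q (J₁ + t) = 1 + q J₁ + t := by
            have := a4' (J₁ + t) (by omega) (by omega)
            omega
          rwa [e3, ← hj1] at this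
        · rw [hj1]
          rcases h1.lt_or_eq with h2 | h2
          · have e3 : 1 + q J₁ + t = 2 + q J₂ := by omega
            rw [e3, h.index_last]
            omega
          · have e3 : 1 + q J₁ + t = 1 + q J₂ := by omega
            rw [e3]
            refine h.index_right_le le_rfl (fun _ => ?_) fun h3 => by omega
            have := a4' (J₂ - 1) (by omega) (by omega)
            omega)
      rw [hadd] at hnext
      have hji := wvert_injective h0 hn hnext
      refine ⟨j, ⟨(diagonalsGoTo_iff h0 hn i j).2 fun v => ?_,
          Or.inl ⟨by omega, Or.inr hji.symm⟩⟩,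
        fun hJM hqJ => ?_, fun hJ0 hqJ => ?_, fun hJ0 => by omega, fun hJM => hji⟩
      · constructor
        · intro hv
          obtain ⟨s1, s2, s3⟩ := hside v hv
          obtain ⟨t, ht, rfl⟩ := (hadj v).1 hv
          exact ⟨s1, s2, s3, t, by omega, (hj1 t).symm⟩
        · rintro ⟨s1, s2, s3, t, ht, rfl⟩
          rw [hadj]
          refine ⟨t, ?_, hj1 t⟩
          have t1 : t ≠ J₂ + 2 - J₁ := by
            rintro rfl
            exact s1 hadd
          have t2 : t ≠ J₂ + 1 - J₁ := by
            rintro rfl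
            apply s3
            rw [← hadd]
            have : J₂ + 2 - J₁ = J₂ + 1 - J₁ + 1 := by omega
            rw [this]
            push_cast
            ring
          omega
      · have := a4' (J + 2) (by omega) (by omega)
        omega
      · rw [hj, hqJ0 hJ0 hqJ]

/-- The fan of a weight on the first side of a strip. -/
theorem exists_fan_right (h : P.IsStrip M e q) (h0 : 2 < P.index 0) (hn : P.numWeights = n)
    (hn2 : 2 ≤ n) {J : ℕ} (hJ : J < M) (hq : q (J + 1) = q J) {i : ZMod n}
    (hi : P.wvert n i = e + ((1 + q J : ℕ) : ZMod (P.s + 1))) :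
    ∃ j, P.Fan n i j ∧
      (J + 1 < M → q (J + 2) = q (J + 1) + 1 →
        P.wvert n j = e + ((M + 3 + q (J + 1) - (J + 1) : ℕ) : ZMod (P.s + 1))) ∧
      (0 < J → q J = q (J - 1) + 1 →
        P.wvert n (j + 1) = e + ((M + 3 + q J - J : ℕ) : ZMod (P.s + 1))) ∧
      (J = 0 → j + 1 = i) ∧ (J + 1 = M → j = i) := by
  have hN := h.natCast_eq_zero
  have hMle := h.path.le_self (le_refl M)
  -- Read from its other ear, the strip has this side as its second one. The equation describes `q'`
  -- without truncated subtraction.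
  obtain ⟨q', hrev, hq'⟩ : ∃ q', P.IsStrip M (e + ((2 + q M : ℕ) : ZMod (P.s + 1))) q' ∧
      ∀ K K', K + K' = M → q' K' + K + q M = M + q K := by
    refine ⟨_, h.reverse, fun K K' hK => ?_⟩
    have e1 : M - K' = K := by omega
    have h1 := h.path.le_self (J := K) (by omega)
    have h2 := h.path.mono_lip (J := K) (J' := M) (by omega) le_rfl
    rw [e1]
    omega
  have hleft : ∀ K K', K + K' = M → e + ((2 + q M : ℕ) : ZMod (P.s + 1)) +
      ((M + 3 + q' K' - K' : ℕ) : ZMod (P.s + 1)) = e + ((1 + q K : ℕ) : ZMod (P.s + 1)) := by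
    intro K K' hK
    have h1 := hq' K K' hK
    have e2 : M + 3 + q' K' - K' + (2 + q M) = (1 + q K) + (M + 4) := by omega
    rw [add_assoc, ← Nat.cast_add, Nat.add_comm (2 + q M), e2, Nat.cast_add (1 + q K), hN,
      add_zero]
  have hright : ∀ K K', K + K' = M → e + ((2 + q M : ℕ) : ZMod (P.s + 1)) +
      ((1 + q' K' : ℕ) : ZMod (P.s + 1)) = e + ((M + 3 + q K - K : ℕ) : ZMod (P.s + 1)) := by
    intro K K' hK
    have h1 := hq' K K' hK
    have e2 : (2 + q M) + (1 + q' K') = M + 3 + q K - K := by omega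
    rw [add_assoc, ← Nat.cast_add, e2]
  obtain ⟨J', hJ'⟩ : ∃ J', J + 1 + J' = M := ⟨M - (J + 1), by omega⟩
  have r1 := hq' (J + 1) J' hJ'
  have r2 := hq' J (J' + 1) (by omega)
  obtain ⟨j, hfan, c1, c2, c3, c4⟩ := hrev.exists_fan_left h0 hn hn2 (J := J') (i := i) (by omega)
    (by omega) (by rw [hleft (J + 1) J' hJ', hi, hq])
  refine ⟨j, hfan, fun hJM hqJ => ?_, fun hJ0 hqJ => ?_, fun hJ0 => c4 (by omega),
    fun hJM => c3 (by omega)⟩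
  · have r3 := hq' (J + 2) (J' - 1) (by omega)
    rw [c2 (by omega) (by omega), hright (J + 1) J' hJ']
  · have r3 := hq' (J - 1) (J' + 2) (by omega)
    rw [c1 (by omega) (by omega), hright J (J' + 1) (by omega)]

/-- Every weight of a strip is the centre of a fan with at least two diagonals. -/
theorem exists_center (h : P.IsStrip M e q) {v : ZMod (P.s + 1)} (hv : 2 < P.index v) :
    ∃ J < M, (q (J + 1) = q J + 1 ∧ v = e + ((M + 3 + q J - J : ℕ) : ZMod (P.s + 1))) ∨
      (q (J + 1) = q J ∧ v = e + ((1 + q J : ℕ) : ZMod (P.s + 1))) := by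
  have hMle := h.path.le_self (le_refl M)
  obtain ⟨t, ht, rfl⟩ := h.exists_eq v
  rcases Nat.eq_zero_or_pos t with rfl | ht0
  · rw [h.index_first] at hv
    omega
  rcases Nat.lt_trichotomy t (2 + q M) with h1 | rfl | h1
  · obtain ⟨k, rfl⟩ : ∃ k, t = 1 + k := ⟨t - 1, by omega⟩
    rw [h.index_right (by omega)] at hv
    obtain ⟨J, hJ, J', hJ', hne⟩ := Finset.one_lt_card.1 (by omega :
      1 < ((Finset.range (M + 1)).filter fun J => q J = k).card)
    simp only [Finset.mem_filter, Finset.mem_range] at hJ hJ'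
    wlog hlt : J < J' generalizing J J'
    · exact this J' J hne.symm hJ' hJ (by omega)
    · refine ⟨J, by omega, Or.inr ⟨?_, by rw [hJ.2]⟩⟩
      have := h.path.mono_lip (J := J + 1) (J' := J') (by omega) (by omega)
      have := h.path.mono_lip (J := J) (J' := J + 1) (by omega) (by omega)
      omega
  · rw [h.index_last] at hv
    omega
  · obtain ⟨k, hk, rfl⟩ : ∃ k, k ≤ M - q M ∧ t = M + 3 - k := ⟨M + 3 - t, by omega, by omega⟩
    rw [h.index_left hk] at hv
    obtain ⟨J, hJ, J', hJ', hne⟩ := Finset.one_lt_card.1 (by omega :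
      1 < ((Finset.range (M + 1)).filter fun J => J - q J = k).card)
    simp only [Finset.mem_filter, Finset.mem_range] at hJ hJ'
    wlog hlt : J < J' generalizing J J'
    · exact this J' J hne.symm hJ' hJ (by omega)
    · have s1 := h.path.mono_lip (J := J + 1) (J' := J') (by omega) (by omega)
      have s2 := h.path.mono_lip (J := J) (J' := J + 1) (by omega) (by omega)
      have s3 := h.path.le_self (J := J) (by omega)
      have s4 := h.path.le_self (J := J') (by omega)
      refine ⟨J, by omega, Or.inl ⟨by omega, ?_⟩⟩
      congr 2
      omega

end IsStrip

end FramedPolygon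

/-! ### The reflection of the weights and the system `S_m` -/

/-- The geometric meaning of the constants: `x_{m-j}` bounds the arc from `x_j` to `x_{j+1}`. The
two conditions are `2j = m` and `2j + 1 = m`. For odd `n` each has one solution; for even `n` the
one of the right parity has two. -/
theorem kConst_eq_ite {n m : ℕ} (hn : 2 ≤ n) (hm : m ≤ n - 1) (j : ZMod n) :
    kConst n m j = if (m : ZMod n) - j = j ∨ (m : ZMod n) - j = j + 1 then 1 else 3 := by
  have : NeZero n := ⟨by omega⟩
  have h1 : kConst n m j = if j = (oneA n m : ZMod n) ∨ j = (oneB n m : ZMod n) then 1 else 3 := by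
    rw [kConst_eq hn]
    have hne := oneA_ne_oneB hn m
    by_cases h1 : j = (oneA n m : ZMod n)
    · subst h1
      simp [hne]
    · by_cases h2 : j = (oneB n m : ZMod n)
      · subst h2
        simp [h1]
      · simp [h1, h2]
  rw [h1]
  refine if_congr ?_ rfl rfl
  have e1 : (m : ZMod n) - j = j ↔ (m : ZMod n) = ((2 * j.val : ℕ) : ZMod n) := by
    push_cast
    rw [ZMod.natCast_val, ZMod.cast_id', id, sub_eq_iff_eq_add, two_mul]
  have e2 : (m : ZMod n) - j = j + 1 ↔ (m : ZMod n) = ((2 * j.val + 1 : ℕ) : ZMod n) := by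
    push_cast
    rw [ZMod.natCast_val, ZMod.cast_id', id, sub_eq_iff_eq_add]
    constructor <;> intro h <;> linear_combination h
  have e3 : ∀ k : ℕ, j = (k : ZMod n) ↔ ((j.val : ℕ) : ZMod n) = (k : ZMod n) := fun k => by
    rw [ZMod.natCast_val, ZMod.cast_id', id]
  have hlt := ZMod.val_lt j
  rw [e1, e2, e3, e3]
  generalize j.val = a at *
  have hmod : ∀ x y : ℕ, (x : ZMod n) = (y : ZMod n) ↔ ∃ c : ℤ, (y : ℤ) - x = n * c := fun x y => by
    rw [natCast_eq_natCast_iff_intDvd]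
    rfl
  rw [hmod, hmod, hmod, hmod]
  unfold oneA oneB
  have hpar : (Even n ∧ n = 2 * (n / 2)) ∨ (¬ Even n ∧ n = 2 * ((n - 1) / 2) + 1) := by
    rcases Nat.even_or_odd n with h | h
    · left; exact ⟨h, by obtain ⟨k, hk⟩ := h; omega⟩
    · right; exact ⟨Nat.not_even_iff_odd.2 h, by obtain ⟨k, hk⟩ := h; omega⟩
  have small : ∀ c : ℤ, -(n : ℤ) < n * c → n * c < 2 * (n : ℤ) → c = 0 ∨ c = 1 := by
    intro c h1 h2
    have h3 : -1 < c := by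
      by_contra h
      nlinarith
    have h4 : c < 2 := by
      by_contra h
      nlinarith
    omega
  constructor
  · rintro (⟨c, hc⟩ | ⟨c, hc⟩)
    · rcases hpar with ⟨he, hp⟩ | ⟨he, hp⟩
      · rw [if_pos he] at hc
        rcases Nat.mod_two_eq_zero_or_one m with hm2 | hm2
        · exact Or.inl ⟨1 - 2 * c, by rw [mul_sub, mul_left_comm, ← hc]; push_cast; omega⟩
        · exact Or.inr ⟨1 - 2 * c, by rw [mul_sub, mul_left_comm, ← hc]; push_cast; omega⟩
      · rw [if_neg he] at hc
        rcases Nat.mod_two_eq_zero_or_one m with hm2 | hm2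
        · exact Or.inr ⟨1 - 2 * c, by rw [mul_sub, mul_left_comm, ← hc]; push_cast; omega⟩
        · exact Or.inl ⟨1 - 2 * c, by rw [mul_sub, mul_left_comm, ← hc]; push_cast; omega⟩
    · rcases Nat.mod_two_eq_zero_or_one m with hm2 | hm2
      · exact Or.inl ⟨2 - 2 * c, by rw [mul_sub, mul_left_comm, ← hc]; push_cast; omega⟩
      · exact Or.inr ⟨2 - 2 * c, by rw [mul_sub, mul_left_comm, ← hc]; push_cast; omega⟩
  · rintro (⟨c, hc⟩ | ⟨c, hc⟩)
    · rcases small c (by omega) (by omega) with rfl | rfl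
      · exact Or.inr ⟨1, by push_cast at hc ⊢; omega⟩
      · rcases hpar with ⟨he, hp⟩ | ⟨he, hp⟩
        · exact Or.inl ⟨0, by rw [if_pos he]; push_cast at hc ⊢; omega⟩
        · exact Or.inl ⟨0, by rw [if_neg he]; push_cast at hc ⊢; omega⟩
    · rcases small c (by omega) (by omega) with rfl | rfl
      · exact Or.inr ⟨1, by push_cast at hc ⊢; omega⟩
      · rcases hpar with ⟨he, hp⟩ | ⟨he, hp⟩
        · exact Or.inl ⟨0, by rw [if_pos he]; push_cast at hc ⊢; omega⟩
        · exact Or.inl ⟨0, by rw [if_neg he]; push_cast at hc ⊢; omega⟩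

namespace FramedPolygon

set_option linter.unusedSectionVars false

variable {P : FramedPolygon} {n : ℕ} [NeZero n]

namespace IsStrip

variable {M : ℕ} {e : ZMod (P.s + 1)} {q : ℕ → ℕ}

/-- The centre of the fan which contains the diagonals `J` and `J + 1`. -/
noncomputable def center (P : FramedPolygon) (M : ℕ) (e : ZMod (P.s + 1)) (q : ℕ → ℕ) (J : ℕ) :
    ZMod (P.s + 1) :=
  if q (J + 1) = q J then e + ((1 + q J : ℕ) : ZMod (P.s + 1))
  else e + ((M + 3 + q J - J : ℕ) : ZMod (P.s + 1))

theorem center_of_eq {J : ℕ} (hq : q (J + 1) = q J) :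
    center P M e q J = e + ((1 + q J : ℕ) : ZMod (P.s + 1)) := if_pos hq

theorem center_of_eq_add {J : ℕ} (hq : q (J + 1) = q J + 1) :
    center P M e q J = e + ((M + 3 + q J - J : ℕ) : ZMod (P.s + 1)) := if_neg (by omega)

theorem two_lt_index_center (h : P.IsStrip M e q) {J : ℕ} (hJ : J < M) :
    2 < P.index (center P M e q J) := by
  rcases h.path.step J hJ with hq | hq
  · rw [center_of_eq hq]
    exact h.two_lt_index_right hJ hq
  · rw [center_of_eq_add hq]
    exact h.two_lt_index_left hJ hq

/-- The centres of consecutive fans: their cyclic positions are related by reflections. -/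
theorem exists_fan_center (h : P.IsStrip M e q) (h0 : 2 < P.index 0) (hn : P.numWeights = n)
    (hn2 : 2 ≤ n) : ∃ m : ZMod n,
      (∀ J < M, ∀ i, P.wvert n i = center P M e q J → P.Fan n i (m - i)) ∧
      (∀ i, 0 < M → P.wvert n i = center P M e q 0 →
        (q 1 = 1 → m = i + i) ∧ (q 1 = 0 → m + 1 = i + i)) ∧
      ∀ J, J + 1 < M → ∀ i i', P.wvert n i = center P M e q J →
        P.wvert n i' = center P M e q (J + 1) →
        (q (J + 1) = q J + 1 → q (J + 2) = q (J + 1) → i + i' = m + 1) ∧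
        (q (J + 1) = q J → q (J + 2) = q (J + 1) + 1 → i + i' = m) ∧
        (q (J + 1) = q J → q (J + 2) = q (J + 1) → i = i') ∧
        (q (J + 1) = q J + 1 → q (J + 2) = q (J + 1) + 1 → i = i') := by
  have hz := h.path.zero
  rcases Nat.eq_zero_or_pos M with rfl | hM
  · exact ⟨0, fun J hJ => by omega, fun i hM => by omega, fun J hJ => by omega⟩
  obtain ⟨i₀, hi₀⟩ := exists_wvert_eq h0 hn (h.two_lt_index_center hM)
  have hfan : ∀ J < M, ∀ i, P.wvert n i = center P M e q J → ∃ j, P.Fan n i j := by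
    intro J hJ i hi
    rcases h.path.step J hJ with hq | hq
    · rw [center_of_eq hq] at hi
      obtain ⟨j, hj, -⟩ := h.exists_fan_right h0 hn hn2 hJ hq hi
      exact ⟨j, hj⟩
    · rw [center_of_eq_add hq] at hi
      obtain ⟨j, hj, -⟩ := h.exists_fan_left h0 hn hn2 hJ hq hi
      exact ⟨j, hj⟩
  obtain ⟨j₀, hj₀⟩ := hfan 0 hM i₀ hi₀
  -- At a turn each of the two centres bounds the arc of the other, both at the end or both at the
  -- start. Hence the sum of the centre and the arc is the same for both fans.
  have hturn : ∀ J, J + 1 < M → ∀ i i' j, P.wvert n i = center P M e q J →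
        P.wvert n i' = center P M e q (J + 1) → P.Fan n i j → P.Fan n i' (i + j - i') ∧
        (q (J + 1) = q J + 1 → q (J + 2) = q (J + 1) → i' = j + 1) ∧
        (q (J + 1) = q J → q (J + 2) = q (J + 1) + 1 → i' = j) ∧
        (q (J + 1) = q J → q (J + 2) = q (J + 1) → i = i') ∧
        (q (J + 1) = q J + 1 → q (J + 2) = q (J + 1) + 1 → i = i') := by
    intro J hJ i i' j hi hi' hj
    have huniq : ∀ {i j j'}, P.Fan n i j → P.Fan n i j' → j = j' := fun h1 h2 =>
      diagonalsGoTo_unique h0 hn hn2 h1.goes h2.goes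
    have hst : q (J + 2) = q (J + 1) ∨ q (J + 2) = q (J + 1) + 1 := h.path.step (J + 1) (by omega)
    rcases h.path.step J (by omega) with hq | hq <;> rcases hst with hq' | hq'
    · have : i = i' := by
        rw [center_of_eq hq] at hi
        rw [center_of_eq hq', hq] at hi'
        exact wvert_injective h0 hn (hi.trans hi'.symm)
      subst this
      refine ⟨by rwa [add_sub_cancel_left], fun a b => by omega, fun a b => by omega,
        fun _ _ => rfl, fun _ _ => rfl⟩
    · rw [center_of_eq hq] at hi
      rw [center_of_eq_add hq'] at hi'
      obtain ⟨k, hk, c1, -, -, -⟩ := h.exists_fan_right h0 hn hn2 (by omega) hq hi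
      have hk' := huniq hk hj
      subst hk'
      have h1 := wvert_injective h0 hn (hi'.trans (c1 hJ hq').symm)
      obtain ⟨l, hl, -, d2, -, -⟩ := h.exists_fan_left h0 hn hn2 hJ hq' hi'
      have h2 := wvert_injective h0 hn
        ((d2 (by omega) (by rw [Nat.add_sub_cancel]; exact hq)).trans (hi.trans (by rw [hq])).symm)
      refine ⟨?_, fun a b => by omega, fun a b => h1, fun a b => by omega, fun a b => by omega⟩
      have h3 : i + k - i' = l := by
        rw [h1, h2]
        ring
      rwa [h3]
    · rw [center_of_eq_add hq] at hi
      rw [center_of_eq hq'] at hi'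
      obtain ⟨k, hk, c1, -, -, -⟩ := h.exists_fan_left h0 hn hn2 (by omega) hq hi
      have hk' := huniq hk hj
      subst hk'
      have h1 := wvert_injective h0 hn (hi'.trans (c1 hJ hq').symm)
      obtain ⟨l, hl, -, d2, -, -⟩ := h.exists_fan_right h0 hn hn2 hJ hq' hi'
      have h2 := wvert_injective h0 hn
        ((d2 (by omega) (by rw [Nat.add_sub_cancel]; exact hq)).trans (hi.trans (by
          congr 2
          omega)).symm)
      refine ⟨?_, fun a b => h1, fun a b => by omega, fun a b => by omega, fun a b => by omega⟩
      have h3 : i + k - i' = l := by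
        rw [h1, ← h2]
        ring
      rwa [h3]
    · have : i = i' := by
        rw [center_of_eq_add hq] at hi
        rw [center_of_eq_add hq'] at hi'
        refine wvert_injective h0 hn (hi.trans (hi'.trans ?_).symm)
        congr 2
        omega
      subst this
      refine ⟨by rwa [add_sub_cancel_left], fun a b => by omega, fun a b => by omega,
        fun _ _ => rfl, fun _ _ => rfl⟩
  have hall : ∀ J < M, ∀ i, P.wvert n i = center P M e q J → P.Fan n i (i₀ + j₀ - i) := by
    intro J
    induction J with
    | zero =>
      intro _ i hi
      have := wvert_injective h0 hn (hi.trans hi₀.symm)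
      subst this
      rwa [add_sub_cancel_left]
    | succ J ih =>
      intro hJ i hi
      obtain ⟨i', hi'⟩ := exists_wvert_eq h0 hn (h.two_lt_index_center (J := J) (by omega))
      have := (hturn J hJ i' i _ hi' hi (ih (by omega) i' hi')).1
      rwa [add_sub_cancel] at this
  refine ⟨i₀ + j₀, hall, fun i hM hi => ?_, fun J hJ i i' hi hi' => ?_⟩
  · have hii := wvert_injective h0 hn (hi.trans hi₀.symm)
    subst hii
    constructor
    · intro hq
      have hq' : q (0 + 1) = q 0 + 1 := by rw [hz]; exact hq
      rw [center_of_eq_add hq'] at hi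
      obtain ⟨k, hk, -, -, c3, -⟩ := h.exists_fan_left h0 hn hn2 hM hq' hi
      rw [diagonalsGoTo_unique h0 hn hn2 hj₀.goes hk.goes, c3 rfl]
    · intro hq
      have hq' : q (0 + 1) = q 0 := by rw [hz]; exact hq
      rw [center_of_eq hq'] at hi
      obtain ⟨k, hk, -, -, c3, -⟩ := h.exists_fan_right h0 hn hn2 hM hq' hi
      rw [diagonalsGoTo_unique h0 hn hn2 hj₀.goes hk.goes, add_assoc, c3 rfl]
  · obtain ⟨-, t1, t2, t3, t4⟩ := hturn J hJ i i' _ hi hi' (hall J (by omega) i hi)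
    refine ⟨fun a b => ?_, fun a b => ?_, t3, t4⟩
    · rw [t1 a b]
      ring
    · rw [t2 a b]
      ring

end IsStrip

/-- All fans of an accordion triangulation are related by one reflection of the weights. -/
theorem exists_fan (hP : P.IsAccordion) (h0 : 2 < P.index 0) (hn : P.numWeights = n)
    (hn2 : 2 ≤ n) : ∃ m : ZMod n, ∀ i, P.Fan n i (m - i) := by
  obtain ⟨M, e, q, h⟩ := exists_isStrip_of_isAccordion hP
  obtain ⟨m, hm, -⟩ := h.exists_fan_center h0 hn hn2
  refine ⟨m, fun i => ?_⟩
  obtain ⟨J, hJ, hc⟩ := h.exists_center (two_lt_index_wvert h0 hn i)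
  refine hm J hJ i ?_
  rcases hc with ⟨hq, hv⟩ | ⟨hq, hv⟩
  · rw [IsStrip.center_of_eq_add hq, hv]
  · rw [IsStrip.center_of_eq hq, hv]

/-- Every diagonal of an accordion triangulation with at least one weight ends at a weight. -/
theorem exists_wvert_of_adj (hP : P.IsAccordion) (h0 : 2 < P.index 0) (hn : P.numWeights = n)
    {u v : ZMod (P.s + 1)} (huv : P.diag.Adj u v) :
    (∃ i, u = P.wvert n i) ∨ ∃ i, v = P.wvert n i := by
  obtain ⟨M, e, q, h⟩ := exists_isStrip_of_isAccordion hP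
  obtain ⟨J₀, hJ₀, -⟩ := h.exists_center h0
  have key : ∀ s t, StripAdj M q s t → 2 < P.index (e + (s : ZMod (P.s + 1))) ∨
      2 < P.index (e + (t : ZMod (P.s + 1))) := by
    rintro s t ⟨J, hJ, hst⟩
    -- Consecutive diagonals share an endpoint, which is then a weight; the last diagonal is
    -- compared with its predecessor. The weight at `0` guarantees that there are two diagonals.
    have hends : 2 < P.index (e + ((1 + q J : ℕ) : ZMod (P.s + 1))) ∨
        2 < P.index (e + ((M + 3 + q J - J : ℕ) : ZMod (P.s + 1))) := by
      rcases hJ.lt_or_eq with hlt | rfl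
      · rcases h.path.step J hlt with hq | hq
        · exact Or.inl (h.two_lt_index_right hlt hq)
        · exact Or.inr (h.two_lt_index_left hlt hq)
      · have h1 := h.path.step (J - 1) (by omega)
        have h2 := h.two_lt_index_right (J := J - 1) (by omega)
        have h3 := h.two_lt_index_left (J := J - 1) (by omega)
        rw [Nat.sub_add_cancel (by omega)] at h1 h2 h3
        have h4 := h.path.le_self (J := J - 1) (by omega)
        rcases h1 with hq | hq
        · left
          rw [hq]
          exact h2 hq
        · right
          have e1 : J + 3 + q J - J = J + 3 + q (J - 1) - (J - 1) := by omega
          rw [e1]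
          exact h3 hq
    rcases hst with ⟨rfl, rfl⟩ | ⟨rfl, rfl⟩
    · exact hends
    · exact hends.symm
  obtain ⟨s, hs, rfl⟩ := h.exists_eq u
  obtain ⟨t, ht, rfl⟩ := h.exists_eq v
  rcases key s t ((h.adj_iff s t hs ht).1 huv) with h1 | h1
  · left
    obtain ⟨i, hi⟩ := exists_wvert_eq h0 hn h1
    exact ⟨i, hi.symm⟩
  · right
    obtain ⟨i, hi⟩ := exists_wvert_eq h0 hn h1
    exact ⟨i, hi.symm⟩

theorem HasWeights.eq_index {x : ZMod n → ℤ} (h0 : 2 < P.index 0) (hx : P.HasWeights n x)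
    (i : ZMod n) : x i = P.index (P.wvert n i) := by
  rw [hx.2 i, weight_residueRep h0 hx.1]

/-- The fans of the triangulation `𝒫^m_x`. -/
theorem IsRotation.fan {m : ℕ} {x : ZMod n → ℤ} (hn2 : 2 ≤ n) (h : P.IsRotation n m x) (i : ZMod n) :
    P.Fan n i (m - i) := by
  obtain ⟨hP, h0, hx, hg⟩ := h
  obtain ⟨m', hm'⟩ := exists_fan hP h0 hx.1 hn2
  have := diagonalsGoTo_unique h0 hx.1 hn2 hg (hm' 0).goes
  rw [sub_zero] at this
  rw [this]
  exact hm' i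

/-- The weight whose fan goes to the arc `j` is `x_{m-j}`, and the two ways of counting its
diagonals are the two values of `kConst`. -/
theorem IsRotation.arc_eq {m : ℕ} {x : ZMod n → ℤ} (hn2 : 2 ≤ n) (hm : m ≤ n - 1)
    (h : P.IsRotation n m x) (j : ZMod n) :
    (P.arc n j : ℤ) - 1 = x (m - j) - kConst n m j := by
  have hf := h.fan hn2 (m - j)
  rw [sub_sub_cancel] at hf
  rw [h.2.2.1.eq_index h.2.1, kConst_eq_ite hn2 hm]
  rcases hf.arc_eq with ⟨h1, h2⟩ | ⟨h1, h2, h3⟩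
  · rw [if_pos h2, h1]
  · rw [if_neg (not_or.2 ⟨h2, h3⟩), ← h1]
    push_cast
    ring

theorem IsRotation.systemS {m : ℕ} {x y : ZMod n → ℤ} (hn2 : 2 ≤ n) (hm : m ≤ n - 1)
    (h : P.IsRotation n m x) (hy : P.HasCoherentGraph n x y) : SystemS n m x y := by
  intro i
  rw [hy.2 i, gap_residueRep h.2.1 h.2.2.1.1, h.arc_eq hn2 hm]
  congr 2
  simp only [CharP.cast_eq_zero]
  ring

theorem IsRotation.hasCoherentGraph {m : ℕ} {x y : ZMod n → ℤ} (hn2 : 2 ≤ n) (hm : m ≤ n - 1)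
    (h : P.IsRotation n m x) (hy : SystemS n m x y) : P.HasCoherentGraph n x y := by
  refine ⟨h.2.2.1, fun i => ?_⟩
  rw [hy i, gap_residueRep h.2.1 h.2.2.1.1, h.arc_eq hn2 hm]
  congr 2
  simp only [CharP.cast_eq_zero]
  ring

/-! ### Uniqueness of `𝒫^m_x` -/

theorem wpos_eq_sum (hn : P.numWeights = n) {k : ℕ} (hk : k ≤ n) :
    P.wpos k = ∑ l ∈ Finset.range k, P.arc n (l : ZMod n) := by
  induction k with
  | zero => rfl
  | succ k ih =>
    have := wpos_lt_wpos (P := P) (k := k) (l := k + 1) (by omega) (by omega)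
    rw [Finset.sum_range_succ, ← ih (by omega)]
    unfold arc
    rw [ZMod.val_natCast, Nat.mod_eq_of_lt (by omega)]
    omega

/-- Two polygons with the same weights and the same arcs between them, whose fans are
given by the same reflection, are equal. -/
theorem IsRotation.eq {Q : FramedPolygon} {m : ℕ} {x : ZMod n → ℤ} (hn2 : 2 ≤ n) (hm : m ≤ n - 1)
    (hP : P.IsRotation n m x) (hQ : Q.IsRotation n m x) : P = Q := by
  -- Equal arcs give equal positions of the weights and equal numbers of vertices. The diagonals
  -- then agree because each of them ends at a weight, where the fan is known.
  have harc : ∀ j, P.arc n j = Q.arc n j := fun j => by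
    have h1 := hP.arc_eq hn2 hm j
    have h2 := hQ.arc_eq hn2 hm j
    omega
  have hw : ∀ k ≤ n, P.wpos k = Q.wpos k := fun k hk => by
    rw [wpos_eq_sum hP.2.2.1.1 hk, wpos_eq_sum hQ.2.2.1.1 hk]
    exact Finset.sum_congr rfl fun l _ => harc _
  have hs : P.s = Q.s := by
    have h1 := wpos_last hP.2.1
    have h2 := wpos_last hQ.2.1
    rw [hP.2.2.1.1] at h1
    rw [hQ.2.2.1.1] at h2
    have := hw n le_rfl
    omega
  have hfP := fun i => (diagonalsGoTo_iff hP.2.1 hP.2.2.1.1 i (m - i)).1 (hP.fan hn2 i).goes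
  have hfQ := fun i => (diagonalsGoTo_iff hQ.2.1 hQ.2.2.1.1 i (m - i)).1 (hQ.fan hn2 i).goes
  have hvP := fun u v => exists_wvert_of_adj (u := u) (v := v) hP.1 hP.2.1 hP.2.2.1.1
  have hvQ := fun u v => exists_wvert_of_adj (u := u) (v := v) hQ.1 hQ.2.1 hQ.2.2.1.1
  obtain ⟨s, _, D, _, _, _⟩ := P
  obtain ⟨s', _, D', _, _, _⟩ := Q
  simp only at hs
  subst hs
  have hwv : ∀ i : ZMod n, wvert ⟨s, ‹_›, D, ‹_›, ‹_›, ‹_›⟩ n i =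
      wvert ⟨s, ‹_›, D', ‹_›, ‹_›, ‹_›⟩ n i := fun i => by
    unfold wvert
    rw [hw _ (ZMod.val_lt i).le]
  have hadj : ∀ i v, D.Adj (wvert ⟨s, ‹_›, D, ‹_›, ‹_›, ‹_›⟩ n i) v ↔
      D'.Adj (wvert ⟨s, ‹_›, D, ‹_›, ‹_›, ‹_›⟩ n i) v := by
    intro i v
    rw [hfP i v]
    simp only [harc, hwv]
    exact (hfQ i v).symm
  have hD : D = D' := by
    ext u v
    constructor
    · intro huv
      rcases hvP u v huv with ⟨i, rfl⟩ | ⟨i, rfl⟩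
      · exact (hadj i v).1 huv
      · exact ((hadj i u).1 huv.symm).symm
    · intro huv
      rcases hvQ u v huv with ⟨i, rfl⟩ | ⟨i, rfl⟩
      · rw [← hwv] at huv ⊢
        exact (hadj i v).2 huv
      · rw [← hwv] at huv ⊢
        exact ((hadj i u).2 huv.symm).symm
  subst hD
  rfl

end FramedPolygon

/-! ### Lattice paths with prescribed runs -/

/-- The beginning of the `t`-th run, for runs of lengths `z 0, z 1, …`. -/
def runStart (z : ℕ → ℕ) (t : ℕ) : ℕ := ∑ s ∈ Finset.range t, z s

/-- The lattice path whose `t`-th run consists of `z t` steps, of the first kind if `R t` holds. -/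
noncomputable def runPath (R : ℕ → Prop) (z : ℕ → ℕ) (J : ℕ) : ℕ := by
  classical
  exact Nat.count (fun K => ∃ t, R t ∧ runStart z t ≤ K ∧ K < runStart z (t + 1)) J

section Runs

variable {R : ℕ → Prop} {z : ℕ → ℕ}

theorem runStart_succ (z : ℕ → ℕ) (t : ℕ) : runStart z (t + 1) = runStart z t + z t :=
  Finset.sum_range_succ _ _

theorem runStart_strictMono (hz : ∀ t, 0 < z t) : StrictMono (runStart z) :=
  strictMono_nat_of_lt_succ fun t => by
    have := hz t
    rw [runStart_succ]
    omega

theorem runPath_succ (hz : ∀ t, 0 < z t) {t J : ℕ} (h1 : runStart z t ≤ J)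
    (h2 : J < runStart z (t + 1)) :
    (R t → runPath R z (J + 1) = runPath R z J + 1) ∧
      (¬ R t → runPath R z (J + 1) = runPath R z J) := by
  classical
  have hmono := (runStart_strictMono hz).monotone
  have huniq : ∀ u, runStart z u ≤ J → J < runStart z (u + 1) → u = t := by
    intro u h3 h4
    rcases Nat.lt_trichotomy u t with h | h | h
    · have := hmono (show u + 1 ≤ t from h)
      omega
    · exact h
    · have := hmono (show t + 1 ≤ u from h)
      omega
  unfold runPath
  rw [Nat.count_succ]
  constructor
  · intro hR
    rw [if_pos ⟨t, hR, h1, h2⟩]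
  · intro hR
    rw [if_neg (by rintro ⟨u, hu, h3, h4⟩; exact hR (huniq u h3 h4 ▸ hu)), add_zero]

theorem isPath_runPath (R : ℕ → Prop) (z : ℕ → ℕ) (M : ℕ) : IsPath M (runPath R z) := by
  classical
  refine ⟨by simp [runPath], fun J _ => ?_⟩
  unfold runPath
  rw [Nat.count_succ]
  split_ifs
  · exact Or.inr rfl
  · exact Or.inl rfl

theorem exists_run {n J : ℕ} (hJ : J < runStart z n) :
    ∃ t < n, runStart z t ≤ J ∧ J < runStart z (t + 1) := by
  induction n with
  | zero => simp [runStart] at hJ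
  | succ n ih =>
    rcases Nat.lt_or_ge J (runStart z n) with h | h
    · obtain ⟨t, ht, h1⟩ := ih h
      exact ⟨t, by omega, h1⟩
    · exact ⟨n, by omega, h, hJ⟩

theorem runPath_of_mem_run (hz : ∀ t, 0 < z t) {t J : ℕ} (h1 : runStart z t ≤ J)
    (h2 : J ≤ runStart z (t + 1)) :
    (R t → runPath R z J + runStart z t = runPath R z (runStart z t) + J) ∧
      (¬ R t → runPath R z J = runPath R z (runStart z t)) := by
  induction J, h1 using Nat.le_induction with
  | base => exact ⟨fun _ => rfl, fun _ => rfl⟩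
  | succ J hJ ih =>
    obtain ⟨i1, i2⟩ := ih (by omega)
    obtain ⟨s1, s2⟩ := runPath_succ (R := R) hz hJ (by omega)
    refine ⟨fun hR => ?_, fun hR => ?_⟩
    · have := i1 hR
      have := s1 hR
      omega
    · rw [s2 hR, i2 hR]

end Runs

namespace FramedPolygon.IsStrip

variable {P : FramedPolygon} {n : ℕ} {e : ZMod (P.s + 1)} {R : ℕ → Prop} {z : ℕ → ℕ}

theorem center_run (h : P.IsStrip (runStart z n) e (runPath R z)) (hz : ∀ t, 0 < z t) {t J : ℕ}
    (h1 : runStart z t ≤ J) (h2 : J < runStart z (t + 1)) (hJ : J < runStart z n) :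
    center P (runStart z n) e (runPath R z) J =
      center P (runStart z n) e (runPath R z) (runStart z t) := by
  obtain ⟨s1, s2⟩ := runPath_succ (R := R) hz h1 h2
  obtain ⟨r1, r2⟩ := runPath_succ (R := R) hz (le_refl (runStart z t)) (by omega)
  obtain ⟨i1, i2⟩ := runPath_of_mem_run (R := R) hz h1 h2.le
  have hle := h.path.le_self hJ.le
  by_cases hR : R t
  · rw [center_of_eq_add (s1 hR), center_of_eq_add (r1 hR)]
    have := i1 hR
    congr 2
    omega
  · rw [center_of_eq (s2 hR), center_of_eq (r2 hR), i2 hR]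

/-- As the kinds of steps alternate, each run is maximal, so its centre has exactly `z t + 1`
diagonals. -/
theorem index_center_run (h : P.IsStrip (runStart z n) e (runPath R z)) (hz : ∀ t, 0 < z t)
    (hR : ∀ t, R (t + 1) ↔ ¬ R t) {t : ℕ} (ht : t < n) :
    P.index (center P (runStart z n) e (runPath R z) (runStart z t)) = z t + 2 := by
  have hmono := runStart_strictMono hz
  have ht1 : runStart z t < runStart z (t + 1) := hmono (Nat.lt_succ_self t)
  have htn : runStart z (t + 1) ≤ runStart z n := hmono.monotone ht
  obtain ⟨r1, r2⟩ := runPath_succ (R := R) hz (le_refl (runStart z t)) ht1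
  have hin := fun J h1 h2 => runPath_of_mem_run (R := R) (J := J) (t := t) hz h1 h2
  have hlip := h.path.mono_lip (J := runStart z t) (J' := runStart z n) (by omega) le_rfl
  have hle := h.path.le_self (J := runStart z t) (by omega)
  have hcard : (Finset.Icc (runStart z t) (runStart z (t + 1))).card = z t + 1 := by
    rw [Nat.card_Icc, runStart_succ]
    omega
  have hprev : ∀ J, J < runStart z t →
      (R t → runPath R z (runStart z t) ≤ runPath R z (runStart z t - 1)) ∧
      (¬ R t → runPath R z (runStart z t) = runPath R z (runStart z t - 1) + 1) := by
    intro J hJ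
    cases t with
    | zero => simp [runStart] at hJ
    | succ t =>
      have h2 : runStart z t < runStart z (t + 1) := hmono (Nat.lt_succ_self t)
      obtain ⟨s1, s2⟩ := runPath_succ (R := R) (J := runStart z (t + 1) - 1) (t := t) hz
        (by omega) (by omega)
      rw [Nat.sub_add_cancel (by omega)] at s1 s2
      exact ⟨fun hr => (s2 ((hR t).1 hr)).le, fun hr => s1 (not_not.1 fun h => hr ((hR t).2 h))⟩
  have hnext : runStart z (t + 1) < runStart z n →
      (R t → runPath R z (runStart z (t + 1) + 1) = runPath R z (runStart z (t + 1))) ∧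
      (¬ R t → runPath R z (runStart z (t + 1) + 1) = runPath R z (runStart z (t + 1)) + 1) := by
    intro _
    obtain ⟨s1, s2⟩ := runPath_succ (R := R) (t := t + 1) hz le_rfl (hmono (Nat.lt_succ_self _))
    exact ⟨fun hr => s2 fun h => (hR t).1 h hr, fun hr => s1 ((hR t).2 hr)⟩
  have hin1 := hin _ ht1.le le_rfl
  by_cases hr : R t
  · have e1 : runStart z n + 3 + runPath R z (runStart z t) - runStart z t =
        runStart z n + 3 - (runStart z t - runPath R z (runStart z t)) := by omega
    rw [center_of_eq_add (r1 hr), e1, h.index_left (by omega)]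
    suffices hS : (Finset.range (runStart z n + 1)).filter (fun J => J - runPath R z J = runStart z t - runPath R z (runStart z t)) =
        Finset.Icc (runStart z t) (runStart z (t + 1)) by rw [hS, hcard]
    ext J
    simp only [Finset.mem_filter, Finset.mem_range, Finset.mem_Icc]
    constructor
    · rintro ⟨hJ, hJ'⟩
      have hleJ := h.path.le_self (J := J) (by omega)
      constructor
      · by_contra hlt
        have h1 := (hprev J (by omega)).1 hr
        have h2 := h.path.mono_lip (J := J) (J' := runStart z t - 1) (by omega) (by omega)
        have h3 := h.path.mono_lip (J := J) (J' := runStart z t) (by omega) (by omega)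
        omega
      · by_contra hlt
        have h1 := (hnext (by omega)).1 hr
        have h2 := h.path.mono_lip (J := runStart z (t + 1) + 1) (J' := J) (by omega) (by omega)
        have h3 := hin1.1 hr
        omega
    · rintro ⟨h1, h2⟩
      have := (hin J h1 h2).1 hr
      omega
  · rw [center_of_eq (r2 hr), h.index_right (by omega)]
    suffices hS : (Finset.range (runStart z n + 1)).filter (fun J => runPath R z J = runPath R z (runStart z t)) =
        Finset.Icc (runStart z t) (runStart z (t + 1)) by rw [hS, hcard]
    ext J
    simp only [Finset.mem_filter, Finset.mem_range, Finset.mem_Icc]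
    constructor
    · rintro ⟨hJ, hJ'⟩
      constructor
      · by_contra hlt
        have h1 := (hprev J (by omega)).2 hr
        have h2 := h.path.mono_lip (J := J) (J' := runStart z t - 1) (by omega) (by omega)
        omega
      · by_contra hlt
        have h1 := (hnext (by omega)).2 hr
        have h2 := h.path.mono_lip (J := runStart z (t + 1) + 1) (J' := J) (by omega) (by omega)
        have h3 := hin1.2 hr
        omega
    · rintro ⟨h1, h2⟩
      exact ⟨by omega, (hin J h1 h2).2 hr⟩

/-- Centres on different sides are different vertices. Between two runs with centres on the same
side there is a run of the other kind, which moves the endpoint on that side. -/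
theorem center_run_lt (h : P.IsStrip (runStart z n) e (runPath R z)) (hz : ∀ t, 0 < z t)
    (hR : ∀ t, R (t + 1) ↔ ¬ R t) {t u : ℕ} (htu : t < u) (hu : u < n) :
    center P (runStart z n) e (runPath R z) (runStart z t) ≠
      center P (runStart z n) e (runPath R z) (runStart z u) := by
  have hmono := runStart_strictMono hz
  have hun := hmono hu
  have htu' := hmono htu
  obtain ⟨r1, r2⟩ := runPath_succ (R := R) hz (le_refl (runStart z t)) (hmono (Nat.lt_succ_self t))
  obtain ⟨s1, s2⟩ := runPath_succ (R := R) hz (le_refl (runStart z u)) (hmono (Nat.lt_succ_self u))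
  have ht1 := h.path.le_self (J := runStart z t) (by omega)
  have ht2 := h.path.mono_lip (J := runStart z t) (J' := runStart z n) (by omega) le_rfl
  have hu1 := h.path.le_self (J := runStart z u) (by omega)
  have hu2 := h.path.mono_lip (J := runStart z u) (J' := runStart z n) (by omega) le_rfl
  have hnle := h.path.le_self (le_refl (runStart z n))
  have hgap : t + 1 < u → (R t → runPath R z (runStart z u) + runStart z t <
        runPath R z (runStart z t) + runStart z u) ∧
      (¬ R t → runPath R z (runStart z t) < runPath R z (runStart z u)) := by
    intro h1
    have hz1 := hz (t + 1)
    have hsucc := runStart_succ z (t + 1)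
    have hle : runStart z (t + 1 + 1) ≤ runStart z u := hmono.monotone h1
    have hlt1 : runStart z t < runStart z (t + 1) := hmono (Nat.lt_succ_self t)
    obtain ⟨a1, a2⟩ := runPath_of_mem_run (R := R) hz (t := t + 1) (by omega)
      (le_refl (runStart z (t + 1 + 1)))
    have b1 := h.path.mono_lip (J := runStart z t) (J' := runStart z (t + 1)) hlt1.le (by omega)
    have b2 := h.path.mono_lip hle hun.le
    refine ⟨fun hr => ?_, fun hr => ?_⟩
    · have := a2 fun hh => (hR t).1 hh hr
      omega
    · have := a1 ((hR t).2 hr)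
      omega
  have halt : u = t + 1 → (R u ↔ ¬ R t) := fun hh => hh ▸ hR t
  by_cases hrt : R t <;> by_cases hru : R u
  · rw [center_of_eq_add (r1 hrt), center_of_eq_add (s1 hru), Ne, h.inj (by omega) (by omega)]
    rcases Nat.lt_or_ge (t + 1) u with h1 | h1
    · have := (hgap h1).1 hrt
      omega
    · exact absurd hrt ((halt (by omega)).1 hru)
  · rw [center_of_eq_add (r1 hrt), center_of_eq (s2 hru), Ne, h.inj (by omega) (by omega)]
    omega
  · rw [center_of_eq (r2 hrt), center_of_eq_add (s1 hru), Ne, h.inj (by omega) (by omega)]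
    omega
  · rw [center_of_eq (r2 hrt), center_of_eq (s2 hru), Ne, h.inj (by omega) (by omega)]
    rcases Nat.lt_or_ge (t + 1) u with h1 | h1
    · have := (hgap h1).2 hrt
      omega
    · exact absurd ((halt (by omega)).2 hrt) hru

theorem exists_center_run (h : P.IsStrip (runStart z n) e (runPath R z)) (hz : ∀ t, 0 < z t)
    {v : ZMod (P.s + 1)} (hv : 2 < P.index v) :
    ∃ t < n, v = center P (runStart z n) e (runPath R z) (runStart z t) := by
  obtain ⟨J, hJ, hc⟩ := h.exists_center hv
  obtain ⟨t, ht, h1, h2⟩ := exists_run hJ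
  refine ⟨t, ht, ?_⟩
  rw [← h.center_run hz h1 h2 hJ]
  rcases hc with ⟨hq, hv⟩ | ⟨hq, hv⟩
  · rw [center_of_eq_add hq, hv]
  · rw [center_of_eq hq, hv]

/-- A strip has as many weights as its lattice path has runs. -/
theorem numWeights_eq (h : P.IsStrip (runStart z n) e (runPath R z)) (hz : ∀ t, 0 < z t)
    (hR : ∀ t, R (t + 1) ↔ ¬ R t) (h0 : 2 < P.index 0) : P.numWeights = n := by
  have : NeZero P.numWeights := ⟨(numWeights_pos h0).ne'⟩
  have hex : ∀ t : Fin n, ∃ i, P.wvert P.numWeights i =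
      center P (runStart z n) e (runPath R z) (runStart z t) := fun t =>
    exists_wvert_eq h0 rfl (by rw [h.index_center_run hz hR t.2]; have := hz t; omega)
  choose f hf using hex
  have hinj : Function.Injective f := by
    intro t u htu
    have h1 := hf t
    rw [htu, hf u] at h1
    rcases Nat.lt_trichotomy t.val u.val with h2 | h2 | h2
    · exact absurd h1.symm (h.center_run_lt hz hR h2 u.2)
    · exact Fin.ext h2
    · exact absurd h1 (h.center_run_lt hz hR h2 t.2)
  have hsurj : Function.Surjective f := by
    intro i
    obtain ⟨t, ht, hi⟩ := h.exists_center_run hz (two_lt_index_wvert h0 rfl i)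
    exact ⟨⟨t, ht⟩, wvert_injective h0 rfl ((hf ⟨t, ht⟩).trans hi.symm)⟩
  have := Fintype.card_of_bijective ⟨hinj, hsurj⟩
  rw [Fintype.card_fin, ZMod.card] at this
  exact this.symm

end FramedPolygon.IsStrip

/-! ### Existence of `𝒫^m_x` -/

/-- The positions of the centres of consecutive fans in `𝒫^m_x`. -/
def fanIndex (n m : ℕ) : ℕ → ZMod n
  -- The first centre solves `2i = m` or `2i = m + 1`, whichever is possible in the integers. At
  -- each turn the sum of neighbouring centres is `m` or `m + 1` alternately, as in
  -- `exists_fan_center`.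
  | 0 => ((m + 1) / 2 : ℕ)
  | t + 1 => (m : ZMod n) + (if Even (t + m) then 1 else 0) - fanIndex n m t

/-- Two steps from an index `t` of the parity of `m` lower the value by one, so the value at `m - 2
* k` is `k`. Hence the hidden vertex is the `m`-th centre. -/
theorem fanIndex_self (n m : ℕ) : fanIndex n m m = 0 := by
  have hstep : ∀ t, Even (t + m) → fanIndex n m (t + 2) = fanIndex n m t - 1 := by
    intro t ht
    have ht' : ¬ Even (t + 1 + m) := by
      rw [Nat.even_iff] at *
      omega
    simp only [fanIndex, ht, ht', if_true, if_false]
    ring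
  have hk : ∀ k, 2 * k ≤ m → fanIndex n m (m - 2 * k) = (k : ZMod n) → fanIndex n m m = 0 := by
    intro k
    induction k with
    | zero =>
      intro _ h
      simpa using h
    | succ k ih =>
      intro hle h
      refine ih (by omega) ?_
      have e1 : m - 2 * k = m - 2 * (k + 1) + 2 := by omega
      rw [e1, hstep _ (by rw [Nat.even_iff]; omega), h]
      push_cast
      ring
  rcases Nat.even_or_odd m with hm | hm
  · obtain ⟨k, hk'⟩ := hm
    refine hk k (by omega) ?_
    have e1 : m - 2 * k = 0 := by omega
    have e2 : (m + 1) / 2 = k := by omega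
    rw [e1, fanIndex, e2]
  · obtain ⟨k, hk'⟩ := hm
    refine hk k (by omega) ?_
    have e1 : m - 2 * k = 0 + 1 := by omega
    have e2 : (m + 1) / 2 = k + 1 := by omega
    have e3 : ¬ Even (0 + m) := by
      rw [Nat.even_iff]
      omega
    rw [e1, fanIndex, fanIndex, e2, if_neg e3, hk']
    push_cast
    ring

namespace FramedPolygon

/-- The strip has some reflection constant `m'` and some order of centres `d`. Both are compared
with `m` and `fanIndex`, and the position of the hidden vertex removes the only freedom. -/
theorem IsStrip.isRotation {P : FramedPolygon} {n m : ℕ} {x : ZMod n → ℤ} {z : ℕ → ℕ}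
    {e : ZMod (P.s + 1)} (hn2 : 2 ≤ n) (hm : m < n) (hz : ∀ t, 0 < z t)
    (hzx : ∀ t, (z t : ℤ) + 2 = x (fanIndex n m t))
    (h : P.IsStrip (runStart z n) e (runPath (fun t => Even (t + m)) z))
    (hcen : IsStrip.center P (runStart z n) e (runPath (fun t => Even (t + m)) z)
      (runStart z m) = 0) : P.IsRotation n m x := by
  have : NeZero n := ⟨by omega⟩
  set R : ℕ → Prop := fun t => Even (t + m) with hRdef
  have hR : ∀ t, R (t + 1) ↔ ¬ R t := fun t => by
    simp only [hRdef, Nat.even_iff]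
    omega
  have hmono := runStart_strictMono hz
  have hmono1 : ∀ t, runStart z t < runStart z (t + 1) := fun t => hmono (Nat.lt_succ_self t)
  have h0 : 2 < P.index 0 := by
    rw [← hcen, h.index_center_run hz hR hm]
    have := hz m
    omega
  have hnum := h.numWeights_eq hz hR h0
  obtain ⟨m', hfan, hfirst, hstep⟩ := h.exists_fan_center h0 hnum hn2
  have hex : ∀ t, ∃ i, t < n → P.wvert n i =
      IsStrip.center P (runStart z n) e (runPath R z) (runStart z t) := fun t => by
    by_cases ht : t < n
    · obtain ⟨i, hi⟩ := exists_wvert_eq h0 hnum (h.two_lt_index_center (hmono ht))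
      exact ⟨i, fun _ => hi⟩
    · exact ⟨0, fun hh => absurd hh ht⟩
  choose d hd using hex
  -- The offset `δ = d 0 - fanIndex n m 0` satisfies `m' - m = 2δ`. Since the recursion replaces an
  -- offset by `(m' - m)` minus it, `δ` persists for all centres.
  have hd0 : m' - m = (d 0 - fanIndex n m 0) + (d 0 - fanIndex n m 0) := by
    have hpos : 0 < runStart z n := by
      have : runStart z 0 < runStart z n := hmono (by omega)
      omega
    obtain ⟨f1, f2⟩ := hfirst (d 0) hpos (hd 0 (by omega))
    obtain ⟨r1, r2⟩ := runPath_succ (R := R) hz (le_refl (runStart z 0)) (hmono1 0)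
    have e0 : runStart z 0 = 0 := rfl
    rw [e0, zero_add, (isPath_runPath R z 0).zero] at r1 r2
    by_cases hr : R 0
    · have e1 : m = (m + 1) / 2 + (m + 1) / 2 := by
        simp only [hRdef, Nat.even_iff] at hr
        omega
      have e2 : (m : ZMod n) = fanIndex n m 0 + fanIndex n m 0 := by
        rw [fanIndex, ← Nat.cast_add, ← e1]
      rw [f1 (r1 hr), e2]
      ring
    · have e1 : m + 1 = (m + 1) / 2 + (m + 1) / 2 := by
        simp only [hRdef, Nat.even_iff] at hr
        omega
      have e2 : (m : ZMod n) + 1 = fanIndex n m 0 + fanIndex n m 0 := by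
        rw [fanIndex, ← Nat.cast_add, ← e1]
        push_cast
        rfl
      have := f2 (r2 hr)
      linear_combination this - e2
  have hdc : ∀ t < n, d t - fanIndex n m t = d 0 - fanIndex n m 0 := by
    intro t
    induction t with
    | zero => exact fun _ => rfl
    | succ t ih =>
      intro ht
      have ih' := ih (by omega)
      have hlt := hmono1 t
      have hlt' : runStart z (t + 1) < runStart z n := hmono ht
      have hJ1 : runStart z (t + 1) - 1 + 1 = runStart z (t + 1) := by omega
      have hJ2 : runStart z (t + 1) - 1 + 2 = runStart z (t + 1) + 1 := by omega
      obtain ⟨a1, a2, -, -⟩ := hstep (runStart z (t + 1) - 1) (by omega) (d t) (d (t + 1))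
        (by rw [hd t (by omega), h.center_run (t := t) (J := runStart z (t + 1) - 1) hz (by omega) (by omega)
          (by omega)])
        (by rw [hJ1, hd (t + 1) ht])
      obtain ⟨r1, r2⟩ := runPath_succ (R := R) (J := runStart z (t + 1) - 1) (t := t) hz
        (by omega) (by omega)
      obtain ⟨s1, s2⟩ := runPath_succ (R := R) hz (le_refl (runStart z (t + 1))) (hmono1 (t + 1))
      rw [hJ1, hJ2] at a1 a2
      rw [hJ1] at r1 r2
      by_cases hr : R t
      · have e1 := a1 (r1 hr) (s2 fun hh => (hR t).1 hh hr)
        have e2 : fanIndex n m (t + 1) = m + 1 - fanIndex n m t := by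
          rw [fanIndex, if_pos hr]
        rw [e2]
        linear_combination e1 - ih' + hd0
      · have e1 := a2 (r2 hr) (s1 ((hR t).2 hr))
        have e2 : fanIndex n m (t + 1) = m + 0 - fanIndex n m t := by
          rw [fanIndex, if_neg hr]
        rw [e2]
        linear_combination e1 - ih' + hd0
  have hdm : d m = 0 := wvert_injective h0 hnum (by rw [hd m hm, hcen, wvert_zero])
  have hδ : d 0 - fanIndex n m 0 = 0 := by
    rw [← hdc m hm, hdm, fanIndex_self, sub_zero]
  have hm' : m' = m := by
    rw [hδ, add_zero] at hd0
    exact sub_eq_zero.1 hd0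
  refine ⟨h.isAccordion, h0, ⟨hnum, fun i => ?_⟩, ?_⟩
  · rw [weight_residueRep h0 hnum]
    obtain ⟨t, ht, hi⟩ := h.exists_center_run hz (two_lt_index_wvert h0 hnum i)
    have e1 : i = d t := wvert_injective h0 hnum (by rw [hd t ht, hi])
    have e2 := hdc t ht
    rw [hδ, sub_eq_zero] at e2
    rw [hi, h.index_center_run hz hR ht, e1, e2, ← hzx]
    push_cast
    rfl
  · have := (hfan (runStart z m) (hmono hm) 0 (by rw [hcen, wvert_zero])).goes
    rwa [sub_zero, hm'] at this

/-- The triangulation `𝒫^m_x` exists. -/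
theorem exists_isRotation {n m : ℕ} (hn2 : 2 ≤ n) {x : ZMod n → ℤ} (hm : m ≤ n - 1)
    (hx : ∀ i, 3 ≤ x i) : ∃ P : FramedPolygon, P.IsRotation n m x := by
  set z : ℕ → ℕ := fun t => (x (fanIndex n m t)).toNat - 2 with hzdef
  have hzx : ∀ t, (z t : ℤ) + 2 = x (fanIndex n m t) := fun t => by
    have := hx (fanIndex n m t)
    simp only [hzdef]
    omega
  have hz : ∀ t, 0 < z t := fun t => by
    have := hx (fanIndex n m t)
    have := hzx t
    omega
  set M := runStart z n with hM
  set q := runPath (fun t => Even (t + m)) z with hq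
  have hpath : IsPath M q := isPath_runPath _ z M
  -- `c` is the coordinate of the `m`-th centre; starting the strip at `-c` makes this centre the
  -- hidden vertex.
  set c : ℕ := if q (runStart z m + 1) = q (runStart z m) then 1 + q (runStart z m)
    else M + 3 + q (runStart z m) - runStart z m with hc
  set e : ZMod (M + 3 + 1) := -(c : ZMod (M + 3 + 1)) with he
  refine ⟨strip M e q hpath, (isStrip_strip M e q hpath).isRotation hn2 (by omega) hz hzx ?_⟩
  have h1 : ∀ d : ℕ, c = d → e + (d : ZMod (M + 3 + 1)) = 0 := fun d hd => by
    rw [he, hd]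
    ring
  unfold IsStrip.center
  split_ifs with hif
  · exact h1 _ (by rw [hc, if_pos hif])
  · exact h1 _ (by rw [hc, if_neg hif])

end FramedPolygon

namespace FramedPolygon

variable {P Q : FramedPolygon} {n : ℕ}

/-! ### Standard frames -/

theorem exists_natCast_eq {N : ℕ} [NeZero N] (v : ZMod N) : ∃ t < N, v = (t : ZMod N) := by
  obtain ⟨t, ht, hv⟩ := exists_eq_add_natCast 0 v
  exact ⟨t, ht, by rw [hv, zero_add]⟩

theorem natCast_inj_of_lt {N a b : ℕ} (ha : a < N) (hb : b < N) :
    (a : ZMod N) = (b : ZMod N) ↔ a = b := by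
  have := add_natCast_inj (0 : ZMod N) ha hb
  rwa [zero_add, zero_add] at this

theorem chordsCross_natCast_iff {s a b c d : ℕ} (ha : a < s + 1) (hb : b < s + 1) (hc : c < s + 1)
    (hd : d < s + 1) :
    ChordsCross (a : ZMod (s + 1)) (b : ZMod (s + 1)) (c : ZMod (s + 1)) (d : ZMod (s + 1)) ↔
    (min a b < c ∧ c < max a b ∧ (d < min a b ∨ max a b < d)) ∨
      (min a b < d ∧ d < max a b ∧ (c < min a b ∨ max a b < c)) := by
  have := chordsCross_add_iff (0 : ZMod (s + 1)) ha hb hc hd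
  simpa only [zero_add] using this

/-- A diagonal at `c` does not leave the polygon cut off by a diagonal `ab` with `a < c < b`. -/
theorem mem_Icc_of_adj {a b c d : ℕ} (hab : P.diag.Adj (a : ZMod (P.s + 1)) (b : ZMod (P.s + 1)))
    (hcd : P.diag.Adj (c : ZMod (P.s + 1)) (d : ZMod (P.s + 1))) (hac : a < c) (hcb : c < b)
    (hb : b < P.s + 1) (hd : d < P.s + 1) : a ≤ d ∧ d ≤ b := by
  have := P.noncrossing _ _ _ _ hab hcd
  rw [chordsCross_natCast_iff (by omega) hb (by omega) hd] at this
  omega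

theorem natCast_ne_of_adj {a b : ℕ} (h : P.diag.Adj (a : ZMod (P.s + 1)) (b : ZMod (P.s + 1))) :
    a ≠ b ∧ b ≠ a + 1 ∧ a ≠ b + 1 := by
  have h1 := P.not_side _ _ h
  refine ⟨fun hh => h.ne (by rw [hh]), fun hh => h1.1 ?_, fun hh => h1.2 ?_⟩
  · rw [hh]
    push_cast
    rfl
  · rw [hh]
    push_cast
    rfl

theorem index_eq_one_iff (v : ZMod (P.s + 1)) : P.index v = 1 ↔ ∀ w, ¬ P.diag.Adj v w := by
  unfold index
  rw [Nat.add_eq_right, Set.ncard_eq_zero (Set.toFinite _), Set.eq_empty_iff_forall_notMem]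
  rfl

theorem index_one_eq_one_of_adj (h : P.diag.Adj 0 ((2 : ℕ) : ZMod (P.s + 1))) : P.index 1 = 1 := by
  have hs := P.two_le
  rw [index_eq_one_iff]
  intro w hw
  obtain ⟨t, ht, rfl⟩ := exists_natCast_eq w
  rw [← Nat.cast_zero] at h
  replace hw : P.diag.Adj ((1 : ℕ) : ZMod (P.s + 1)) (t : ZMod (P.s + 1)) := by
    rwa [Nat.cast_one]
  have h1 := mem_Icc_of_adj h hw (by omega) (by omega) (by omega) ht
  have h2 := natCast_ne_of_adj hw
  omega

/-- A chord crossing the one from `0` to `2` must end at the vertex `1`, which has no diagonals, so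
maximality applies. -/
theorem adj_of_index_one_eq_one (hs : 3 ≤ P.s) (h : P.index 1 = 1) :
    P.diag.Adj 0 ((2 : ℕ) : ZMod (P.s + 1)) := by
  rw [index_eq_one_iff] at h
  rw [← Nat.cast_zero]
  refine P.maximal _ _ ?_ ?_ ?_ ?_
  · rw [Ne, natCast_inj_of_lt (by omega) (by omega)]
    omega
  · rw [← Nat.cast_one (R := ZMod (P.s + 1)), ← Nat.cast_add, Ne, natCast_inj_of_lt (by omega) (by omega)]
    omega
  · rw [← Nat.cast_one (R := ZMod (P.s + 1)), ← Nat.cast_add, Ne, natCast_inj_of_lt (by omega) (by omega)]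
    omega
  · intro c d hcd
    obtain ⟨c, hc, rfl⟩ := exists_natCast_eq c
    obtain ⟨d, hd, rfl⟩ := exists_natCast_eq d
    rw [chordsCross_natCast_iff (by omega) (by omega) hc hd]
    intro hcross
    have h1 : c = 1 ∨ d = 1 := by omega
    rcases h1 with rfl | rfl
    · exact h _ (by rwa [Nat.cast_one] at hcd)
    · exact h _ (by rw [Nat.cast_one] at hcd; exact hcd.symm)

section

variable [NeZero n]

theorem diagonalsGoTo_zero_iff (h0 : 2 < P.index 0) (hn : P.numWeights = n) (j : ZMod n) :
    P.DiagonalsGoTo n 0 j ↔ ∀ v < P.s + 1, P.diag.Adj 0 (v : ZMod (P.s + 1)) ↔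
      (2 ≤ v ∧ v < P.s ∧ P.wpos j.val ≤ v ∧ v ≤ P.wpos (j.val + 1)) := by
  have hj : j.val < n := ZMod.val_lt j
  have hs := P.two_le
  have hlt := wpos_lt_wpos (P := P) (k := j.val) (l := j.val + 1) (by omega) (by omega)
  have hle : P.wpos (j.val + 1) ≤ P.s + 1 := by
    rw [← wpos_last h0, hn]
    rcases (show j.val + 1 ≤ n from hj).lt_or_eq with h | h
    · exact (wpos_lt_wpos h hn.ge).le
    · rw [h]
  have hlast : ((P.s : ℕ) : ZMod (P.s + 1)) = 0 - 1 := by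
    have := ZMod.natCast_self (P.s + 1)
    push_cast at this ⊢
    linear_combination this
  have key : ∀ v : ℕ, v < P.s + 1 →
      (((v : ZMod (P.s + 1)) ≠ 0 ∧ (v : ZMod (P.s + 1)) ≠ 0 + 1 ∧ (v : ZMod (P.s + 1)) ≠ 0 - 1 ∧
        ∃ t ≤ P.arc n j, (v : ZMod (P.s + 1)) = P.wvert n j + (t : ZMod (P.s + 1))) ↔
      (2 ≤ v ∧ v < P.s ∧ P.wpos j.val ≤ v ∧ v ≤ P.wpos (j.val + 1))) := by
    intro v hv
    have e0 : (v : ZMod (P.s + 1)) ≠ 0 ↔ v ≠ 0 := by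
      rw [← Nat.cast_zero, Ne, natCast_inj_of_lt hv (by omega)]
    have e1 : (v : ZMod (P.s + 1)) ≠ 0 + 1 ↔ v ≠ 1 := by
      rw [zero_add, ← Nat.cast_one (R := ZMod (P.s + 1)), Ne, natCast_inj_of_lt hv (by omega)]
    have e2 : (v : ZMod (P.s + 1)) ≠ 0 - 1 ↔ v ≠ P.s := by
      rw [← hlast, Ne, natCast_inj_of_lt hv (by omega)]
    rw [e0, e1, e2]
    unfold arc wvert
    constructor
    · rintro ⟨h1, h2, h3, t, ht, h4⟩
      rw [← Nat.cast_add] at h4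
      have h5 : P.wpos j.val + t < P.s + 1 := by
        by_contra hge
        have h6 : P.wpos j.val + t = P.s + 1 := by omega
        rw [h6, ZMod.natCast_self, ← Nat.cast_zero, natCast_inj_of_lt hv (by omega)] at h4
        exact h1 h4
      rw [natCast_inj_of_lt hv h5] at h4
      omega
    · rintro ⟨h1, h2, h3, h4⟩
      refine ⟨by omega, by omega, by omega, v - P.wpos j.val, by omega, ?_⟩
      rw [← Nat.cast_add, Nat.add_sub_cancel' h3]
  rw [diagonalsGoTo_iff h0 hn, wvert_zero]
  constructor
  · intro h v hv
    rw [h, key v hv]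
  · intro h v
    obtain ⟨v, hv, rfl⟩ := exists_natCast_eq v
    rw [h v hv, key v hv]

/-- If `b₁ = 1`, then the diagonals of the hidden vertex `x_n` can only go to `(x_n, x_1)`. -/
theorem eq_zero_of_diagonalsGoTo (h0 : 2 < P.index 0) (hn : P.numWeights = n) (h1 : P.index 1 = 1)
    {j : ZMod n} (h : P.DiagonalsGoTo n 0 j) : j = 0 := by
  by_contra hj
  have hjn : j.val < n := ZMod.val_lt j
  have hj0 : 0 < j.val := ZMod.val_pos.2 hj
  rw [diagonalsGoTo_zero_iff h0 hn] at h
  obtain ⟨a, b, hab, ha, hb⟩ := exists_two_adj h0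
  obtain ⟨a, hal, rfl⟩ := exists_natCast_eq a
  obtain ⟨b, hbl, rfl⟩ := exists_natCast_eq b
  rw [Ne, natCast_inj_of_lt hal hbl] at hab
  have ha' := (h a hal).1 ha
  have hb' := (h b hbl).1 hb
  have h2 := (h 2 (by omega)).1 (adj_of_index_one_eq_one (by omega) h1)
  have hpos : 0 < P.wpos j.val := wpos_lt_wpos (k := 0) hj0 (by omega)
  have hw := two_lt_index_wvert h0 hn j
  unfold wvert at hw
  have hne : P.wpos j.val ≠ 1 := by
    intro hh
    rw [hh, Nat.cast_one, h1] at hw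
    omega
  -- So the vertex `2` is a weight. But the hidden vertex has a second diagonal, hence is also
  -- joined to `3`; inside the quadrilateral `0123` the vertex `2` has no diagonal except to `0`.
  have hw2 : P.wpos j.val = 2 := by omega
  rw [hw2] at hw
  have h3 := (h 3 (by omega)).2 (by omega)
  rw [← Nat.cast_zero] at h3
  obtain ⟨c, d, hcd, hc, hd⟩ := exists_two_adj hw
  obtain ⟨c, hcl, rfl⟩ := exists_natCast_eq c
  obtain ⟨d, hdl, rfl⟩ := exists_natCast_eq d
  rw [Ne, natCast_inj_of_lt hcl hdl] at hcd
  have c1 := mem_Icc_of_adj h3 hc (by omega) (by omega) (by omega) hcl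
  have d1 := mem_Icc_of_adj h3 hd (by omega) (by omega) (by omega) hdl
  have c2 := natCast_ne_of_adj hc
  have d2 := natCast_ne_of_adj hd
  omega

theorem index_one_eq_one (h0 : 2 < P.index 0) (hn : P.numWeights = n)
    (h : P.DiagonalsGoTo n 0 0) : P.index 1 = 1 := by
  refine index_one_eq_one_of_adj ?_
  rw [diagonalsGoTo_zero_iff h0 hn, ZMod.val_zero] at h
  obtain ⟨a, b, hab, ha, hb⟩ := exists_two_adj h0
  obtain ⟨a, hal, rfl⟩ := exists_natCast_eq a
  have ha' := (h a hal).1 ha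
  rw [wpos_zero] at *
  exact (h 2 (by omega)).2 (by omega)

theorem IsRotation.hasStandardFrame {x : ZMod n → ℤ} (h : P.IsRotation n 0 x) :
    P.HasStandardFrame := by
  obtain ⟨hP, h0, hx, hg⟩ := h
  rw [Nat.cast_zero] at hg
  obtain rfl := hx.1
  exact ⟨h0, Or.inl hg, index_one_eq_one h0 rfl hg⟩

/-- Of the two alternatives of type (I), the arc from `x_{n-1}` to `x_n` is compatible with `b₁ = 1`
only if it coincides with the arc from `x_n` to `x_1`. -/
theorem HasStandardFrame.isRotation {x : ZMod n → ℤ} (hP : P.IsAccordion)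
    (h : P.HasStandardFrame) (hx : P.HasWeights n x) : P.IsRotation n 0 x := by
  obtain ⟨h0, hI, h1⟩ := h
  rw [hx.1] at hI
  refine ⟨hP, h0, hx, ?_⟩
  rw [Nat.cast_zero]
  rcases hI with hI | hI
  · exact hI
  · have := eq_zero_of_diagonalsGoTo h0 hx.1 h1 hI
    rwa [this] at hI

/-! ### Coherent graphs and dual chains -/

theorem length_chain (P : FramedPolygon) : P.chain.length = P.s := by
  simp [chain]

theorem map_max_chain_eq_iff (h : P.index 0 = Q.index 0) :
    P.chain.map (max 2) = Q.chain.map (max 2) ↔ P.s = Q.s ∧ ∀ j < P.s + 1,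
      max 2 (P.index (j : ZMod (P.s + 1))) = max 2 (Q.index (j : ZMod (Q.s + 1))) := by
  have h1 : P.chain.map (max 2) = Q.chain.map (max 2) ↔
      (P.index 0 :: P.chain).map (max 2) = (Q.index 0 :: Q.chain).map (max 2) := by
    simp [h]
  rw [h1, index_zero_cons_chain, index_zero_cons_chain, List.map_map, List.map_map]
  constructor
  · intro hh
    have hs : P.s = Q.s := by simpa using congrArg List.length hh
    have hr : List.range (Q.s + 1) = List.range (P.s + 1) := by rw [hs]
    rw [hr, List.map_inj_left] at hh
    exact ⟨hs, fun j hj => hh j (List.mem_range.2 hj)⟩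
  · rintro ⟨hs, hh⟩
    have hr : List.range (Q.s + 1) = List.range (P.s + 1) := by rw [hs]
    rw [hr]
    exact List.map_congr_left fun j hj => hh j (List.mem_range.1 hj)

/-- The dual chain can be read off from the coherent graph. -/
theorem HasCoherentGraph.map_max_chain_eq {x y : ZMod n → ℤ} (h0 : 2 < P.index 0)
    (h0' : 2 < Q.index 0) (hP : P.HasCoherentGraph n x y) (hQ : Q.HasCoherentGraph n x y) :
    P.chain.map (max 2) = Q.chain.map (max 2) := by
  obtain ⟨hPx, hPy⟩ := hP
  obtain ⟨hQx, hQy⟩ := hQ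
  have harc : ∀ j, P.arc n j = Q.arc n j := fun j => by
    have h1 := hPy j
    have h2 := hQy j
    rw [gap_residueRep h0 hPx.1] at h1
    rw [gap_residueRep h0' hQx.1] at h2
    omega
  have hw : ∀ k ≤ n, P.wpos k = Q.wpos k := fun k hk => by
    rw [wpos_eq_sum hPx.1 hk, wpos_eq_sum hQx.1 hk]
    exact Finset.sum_congr rfl fun l _ => harc _
  have hs : P.s = Q.s := by
    have h1 := wpos_last h0
    have h2 := wpos_last h0'
    rw [hPx.1] at h1
    rw [hQx.1] at h2
    have := hw n le_rfl
    omega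
  have hindex : ∀ k < n, P.index (P.wpos k : ZMod (P.s + 1)) =
      Q.index (P.wpos k : ZMod (Q.s + 1)) := by
    intro k hk
    have h1 := hPx.eq_index h0 (k : ZMod n)
    have h2 := hQx.eq_index h0' (k : ZMod n)
    unfold wvert at h1 h2
    rw [ZMod.val_natCast, Nat.mod_eq_of_lt hk] at h1 h2
    rw [← hw k hk.le] at h2
    omega
  have h00 : P.index 0 = Q.index 0 := by
    have := hindex 0 (Nat.pos_of_neZero n)
    rwa [wpos_zero, Nat.cast_zero, Nat.cast_zero] at this
  rw [map_max_chain_eq_iff h00]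
  refine ⟨hs, fun j hj => ?_⟩
  have iP := two_lt_index_iff h0 hj
  have iQ := two_lt_index_iff h0' (hs ▸ hj)
  rw [hPx.1] at iP
  rw [hQx.1] at iQ
  by_cases hj : ∃ k < n, P.wpos k = j
  · obtain ⟨k, hk, rfl⟩ := hj
    rw [hindex k hk]
  · have h1 := mt iP.1 hj
    have h2 := mt iQ.1 fun ⟨k, hk, hkj⟩ => hj ⟨k, hk, by rw [hw k hk.le, hkj]⟩
    omega

end

/-- The coherent graph can be read off from the dual chain and the hidden index. -/
theorem HasCoherentGraph.of_map_max_chain_eq {x y : ZMod n → ℤ} (hP : P.HasCoherentGraph n x y)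
    (hn : n ≠ 0) (h00 : P.index 0 = Q.index 0) (h : P.chain.map (max 2) = Q.chain.map (max 2)) :
    Q.HasCoherentGraph n x y := by
  have : NeZero n := ⟨hn⟩
  obtain ⟨hs, hmax⟩ := (map_max_chain_eq_iff h00).1 h
  -- The position `s + 1` stands for the hidden vertex, which the dual chain does not record; it is
  -- covered by equality of the hidden indices.
  have hmax' : ∀ j ≤ P.s + 1,
      max 2 (P.index (j : ZMod (P.s + 1))) = max 2 (Q.index (j : ZMod (Q.s + 1))) := by
    intro j hj
    rcases hj.lt_or_eq with hj | rfl
    · exact hmax j hj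
    · have hz : ((P.s + 1 : ℕ) : ZMod (Q.s + 1)) = 0 := by
        rw [hs]
        exact ZMod.natCast_self _
      rw [ZMod.natCast_self, hz, h00]
  have hpos : P.weightPositions = Q.weightPositions := by
    unfold weightPositions
    have hr : List.range' 1 (P.s + 1) = List.range' 1 (Q.s + 1) := by rw [hs]
    rw [← hr]
    refine List.filter_congr fun j hj => ?_
    rw [List.mem_range'] at hj
    have := hmax' j (by omega)
    rw [decide_eq_decide]
    omega
  have hpos' : P.pos = Q.pos := by
    unfold pos
    rw [hpos]
  have hnum : P.numWeights = Q.numWeights := by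
    unfold numWeights
    rw [hpos]
  obtain ⟨⟨hw, hx⟩, hy⟩ := hP
  refine ⟨⟨hnum ▸ hw, fun i => ?_⟩, fun i => ?_⟩
  · rw [hx i]
    unfold weight
    rw [← hpos']
    have hi := ZMod.val_lt i
    have hrep : 1 ≤ residueRep n i ∧ residueRep n i ≤ n := by
      unfold residueRep
      split_ifs <;> omega
    have h1 := (mem_weightPositions P _).1 (pos_mem (P := P) hrep.1 (by omega))
    have h2 := hmax' _ h1.2.1
    have h3 := h1.2.2
    congr 1
    omega
  · rw [hy i]
    unfold gap
    rw [hnum, hpos', hs]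

/-! ### Companions -/

theorem IsAccordion.hiddenIndex_chain (hP : P.IsAccordion) (h0 : 2 < P.index 0) :
    hiddenIndex P.chain = P.index 0 ∧ IsWWDecomposition (P.chain.map (max 2)) P.chain := by
  obtain ⟨M, e, q, h⟩ := exists_isStrip_of_isAccordion hP
  obtain ⟨A, B, C, hc, hd⟩ := h.exists_chain_eq (by omega)
  rw [hc]
  exact ⟨hiddenIndex_of_dualChains hd, isWWDecomposition_of_dualChains hd⟩

/-- Accordion triangulations with the same dual chain represent different WW-decompositions for the
same basic wormhole singularity. -/
theorem exists_isBasicWormholeSingularity (hP : P.IsAccordion) (hQ : Q.IsAccordion)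
    (h0 : 2 < P.index 0) (h0' : 2 < Q.index 0) (hne : P.chain ≠ Q.chain)
    (h : P.chain.map (max 2) = Q.chain.map (max 2)) :
    ∃ Δ q, IsBasicWormholeSingularity Δ q ∧ P.Represents Δ q ∧ Q.Represents Δ q := by
  obtain ⟨h1, h2⟩ := hP.hiddenIndex_chain h0
  obtain ⟨-, h4⟩ := hQ.hiddenIndex_chain h0'
  rw [← h] at h4
  set k := P.chain.map (max 2) with hk
  have hk2 : ∀ e ∈ k, 2 ≤ e := fun e he => h2.1 e he
  have hkne : k ≠ [] := by
    have := P.two_le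
    have h5 : k.length = P.s := by rw [hk, List.length_map, length_chain]
    intro hnil
    rw [hnil, List.length_nil] at h5
    omega
  obtain ⟨Δ, q, hq0, hq, hcop, hdc⟩ := exists_isDualChain hk2 hkne
  refine ⟨Δ, q, ⟨⟨hq0, hq, hcop, k, hdc, P.chain, Q.chain, hne, h2, h4⟩, ?_⟩, ⟨k, hdc, h2⟩,
    ⟨k, hdc, h4⟩⟩
  intro k' c hdc' hc
  rw [hdc'.unique hdc] at hc
  have e1 := hiddenIndex_eq_of_isWWDecomposition hc
  have e2 := hiddenIndex_eq_of_isWWDecomposition h2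
  omega

/-- A basic wormhole triangulation whose hidden vertex is a weight has a companion which is an
accordion triangulation. -/
theorem IsBasicWormhole.exists_companion (hP : P.IsAccordion) (h0 : 2 < P.index 0)
    (h : P.IsBasicWormhole) : ∃ Q : FramedPolygon, Q.IsAccordion ∧ Q.index 0 = P.index 0 ∧
      Q.chain ≠ P.chain ∧ Q.chain.map (max 2) = P.chain.map (max 2) := by
  obtain ⟨Δ, q, ⟨⟨-, -, -, k, hdc, c₁, c₂, hne, hc₁, hc₂⟩, -⟩, k', hdc', hPk⟩ := h
  obtain rfl := hdc'.unique hdc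
  obtain ⟨h1, -⟩ := hP.hiddenIndex_chain h0
  have e2 := hiddenIndex_eq_of_isWWDecomposition hPk
  have hPmap := (exists_dualChains_of_isWWDecomposition hPk h1 (by omega)).1
  obtain ⟨c, hcne, hc⟩ : ∃ c, c ≠ P.chain ∧ IsWWDecomposition k' c := by
    by_cases hh : c₁ = P.chain
    · exact ⟨c₂, fun h2 => hne (hh.trans h2.symm), hc₂⟩
    · exact ⟨c₁, hh, hc₁⟩
  have e1 := hiddenIndex_eq_of_isWWDecomposition hc
  -- The hidden index depends only on the dual chain. The other decomposition therefore has hidden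
  -- index `P.index 0` as well and is again realized by an accordion.
  obtain ⟨hmap, A, B, C, rfl, hd⟩ := exists_dualChains_of_isWWDecomposition (x := P.index 0) hc
    (by omega) (by omega)
  obtain ⟨Q, hQ, hQ0, hQc⟩ := exists_polygon_of_dualChains hd
  exact ⟨Q, hQ, hQ0, by rwa [hQc], by rw [hQc, hmap, hPmap]⟩

/-- The first entry distinguishes the chains: `b₁ = 1` forces the diagonals of the hidden vertex to
go to `(x_n, x_1)`. -/
theorem IsRotation.chain_ne [NeZero n] {m : ℕ} {x : ZMod n → ℤ} (hm0 : 1 ≤ m) (hm : m ≤ n - 1)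
    (hP : P.IsRotation n 0 x) (hQ : Q.IsRotation n m x) : P.chain ≠ Q.chain := by
  intro h
  have hP1 := hP.hasStandardFrame.2.2
  have hs : P.s = Q.s := by rw [← length_chain, h, length_chain]
  have hhead : ∀ R : FramedPolygon, R.chain[0]? = some (R.index 1) := fun R => by
    have := R.two_le
    unfold chain
    rw [List.getElem?_map, List.getElem?_range (by omega)]
    simp
  have h1 : Q.index 1 = 1 := by
    have := hhead Q
    rw [← h, hhead P, Option.some_inj] at this
    rw [← this, hP1]
  have := eq_zero_of_diagonalsGoTo hQ.2.1 hQ.2.2.1.1 h1 hQ.2.2.2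
  rw [← Nat.cast_zero, natCast_inj_of_lt (by omega) (by omega)] at this
  omega

theorem isBasicWormhole_and_isCompanion {m : ℕ} {x y : ZMod n → ℤ} (hn : 2 ≤ n) (hm0 : 1 ≤ m)
    (hm : m ≤ n - 1) (hS0 : SystemS n 0 x y) (hSm : SystemS n m x y)
    (hP : P.IsRotation n 0 x) (hQ : Q.IsRotation n m x) :
    P.IsBasicWormhole ∧ Q.IsBasicWormhole ∧ P.IsCompanion Q := by
  have : NeZero n := ⟨by omega⟩
  have hne := hP.chain_ne hm0 hm hQ
  obtain ⟨Δ, q, hb, hrP, hrQ⟩ := exists_isBasicWormholeSingularity hP.1 hQ.1 hP.2.1 hQ.2.1 hne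
    ((hP.hasCoherentGraph hn (by omega) hS0).map_max_chain_eq hP.2.1 hQ.2.1
      (hQ.hasCoherentGraph hn hm hSm))
  exact ⟨⟨Δ, q, hb, hrP⟩, ⟨Δ, q, hb, hrQ⟩, Δ, q, hb, hrP, hrQ, hne.symm⟩

theorem three_le_of_hasWeights [NeZero n] {x : ZMod n → ℤ} (h0 : 2 < P.index 0)
    (hx : P.HasWeights n x) (i : ZMod n) : 3 ≤ x i := by
  rw [hx.eq_index h0]
  exact_mod_cast two_lt_index_wvert h0 hx.1 i

/-- A companion that is an accordion has the same coherent graph, so it is `𝒫^m_x` for its own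
reflection constant `m`. By uniqueness `m = 0` would give back `P`. -/
theorem IsRotation.isBasicWormhole_iff {x y : ZMod n → ℤ} (hn : 2 ≤ n) (hP : P.IsRotation n 0 x)
    (hy : P.HasCoherentGraph n x y) : P.IsBasicWormhole ↔
      ∃ m : ℕ, 1 ≤ m ∧ m ≤ n - 1 ∧ SystemS n 0 x y ∧ SystemS n m x y := by
  have : NeZero n := ⟨by omega⟩
  constructor
  · intro h
    obtain ⟨Q, hQ, hQ0, hne, hmap⟩ := h.exists_companion hP.1 hP.2.1
    have hQy := hy.of_map_max_chain_eq (by omega) hQ0.symm hmap.symm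
    have hQ0' : 2 < Q.index 0 := hQ0 ▸ hP.2.1
    obtain ⟨m, hm⟩ := exists_fan hQ hQ0' hQy.1.1 hn
    have hmn : m.val < n := ZMod.val_lt m
    have hrot : Q.IsRotation n m.val x := by
      refine ⟨hQ, hQ0', hQy.1, ?_⟩
      have := (hm 0).goes
      rwa [sub_zero, ← ZMod.natCast_zmod_val m] at this
    refine ⟨m.val, ?_, by omega, hP.systemS hn (by omega) hy, hrot.systemS hn (by omega) hQy⟩
    by_contra hm0
    have e0 : m.val = 0 := by omega
    rw [e0] at hrot
    exact hne (by rw [hP.eq hn (by omega) hrot])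
  · rintro ⟨m, hm0, hm, hS0, hSm⟩
    obtain ⟨Q, hQ⟩ := exists_isRotation hn hm (three_le_of_hasWeights hP.2.1 hP.2.2.1)
    exact (isBasicWormhole_and_isCompanion hn hm0 hm hS0 hSm hP hQ).1

end FramedPolygon

/-! ### Assembly of the five claims -/

theorem theorem3p17 (n : ℕ) (hn : 2 ≤ n) :
    -- the triangulations `𝒫^m_x` are well defined, and `S_m` is the system of their coherent graphs
    (∀ m : ℕ, m ≤ n - 1 → ∀ x : ZMod n → ℤ, (∀ i, 3 ≤ x i) →
      (∃! P : FramedPolygon, P.IsRotation n m x) ∧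
      ∀ (P : FramedPolygon) (y : ZMod n → ℤ),
        P.IsRotation n m x → P.HasCoherentGraph n x y → SystemS n m x y) ∧
    -- criterion for basic wormhole triangulations with a standard frame
    (∀ (P : FramedPolygon) (x y : ZMod n → ℤ),
      P.IsAccordion → P.HasStandardFrame → P.HasCoherentGraph n x y →
      P.IsRotation n 0 x ∧
      (P.IsBasicWormhole ↔
        ∃ m : ℕ, 1 ≤ m ∧ m ≤ n - 1 ∧ SystemS n 0 x y ∧ SystemS n m x y)) ∧
    -- consistency, the parametric solution, and the resulting pairs of companions
    (∀ m : ℕ, 1 ≤ m → m ≤ n - 1 →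
      (Even n → (¬ Consistent n m ↔
        (¬ (Nat.gcd n m : ℤ) ∣ (n : ℤ) - ((m / 2 : ℕ) : ℤ)) ∧
        ¬ (Nat.gcd n m : ℤ) ∣ ((n / 2 : ℕ) : ℤ) - ((m / 2 : ℕ) : ℤ))) ∧
      (Odd n → (¬ Consistent n m ↔
        (¬ (Nat.gcd n m : ℤ) ∣ (n : ℤ) - (((m + 1) / 2 : ℕ) : ℤ)) ∧
        ¬ (Nat.gcd n m : ℤ) ∣ (((n - 1) / 2 : ℕ) : ℤ) - ((m / 2 : ℕ) : ℤ))) ∧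
      (Consistent n m →
        (∀ t : Fin (Nat.gcd n m) → ℤ,
          ∃! p : (ZMod n → ℤ) × (ZMod n → ℤ),
            SystemS n 0 p.1 p.2 ∧ SystemS n m p.1 p.2 ∧
            ∀ i : Fin (Nat.gcd n m), p.1 ((i.val + 1 : ℕ) : ZMod n) = t i) ∧
        ∀ x y : ZMod n → ℤ, SystemS n 0 x y ∧ SystemS n m x y ↔
          SystemS n 0 x y ∧
          ∀ i j : ℕ, 1 ≤ i → i ≤ Nat.gcd n m → 1 ≤ j → j ≤ n / Nat.gcd n m →
            x ((i + j * m : ℕ) : ZMod n) =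
              x (i : ZMod n) - ∑ l ∈ Finset.range j, vConst n m ((i + l * m : ℕ) : ZMod n)) ∧
      (∀ x y : ZMod n → ℤ, SystemS n 0 x y → SystemS n m x y → (∀ i, 3 ≤ x i) →
        ∀ P Q : FramedPolygon, P.IsRotation n 0 x → Q.IsRotation n m x →
          P.HasStandardFrame ∧
          P.HasCoherentGraph n x y ∧ Q.HasCoherentGraph n x y ∧
          P.IsBasicWormhole ∧ Q.IsBasicWormhole ∧ P.IsCompanion Q)) := by
  have : NeZero n := ⟨by omega⟩
  refine ⟨fun m hm x hx => ⟨?_, fun P y hP hy => hP.systemS hn hm hy⟩,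
    fun P x y hP hF hy => ?_, fun m hm0 hm => ⟨fun he => not_consistent_iff_of_even hn m he,
      fun ho => not_consistent_iff_of_odd hn m ho,
      fun hc => ⟨existsUnique_solution hn hc, solution_iff_parametric hn m⟩,
      fun x y hS0 hSm _ P Q hP hQ => ⟨hP.hasStandardFrame,
        hP.hasCoherentGraph hn (by omega) hS0, hQ.hasCoherentGraph hn hm hSm,
        FramedPolygon.isBasicWormhole_and_isCompanion hn hm0 hm hS0 hSm hP hQ⟩⟩⟩
  · obtain ⟨P, hP⟩ := FramedPolygon.exists_isRotation hn hm hx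
    exact ⟨P, hP, fun Q hQ => hQ.eq hn hm hP⟩
  · have hrot := hF.isRotation hP hy.1
    exact ⟨hrot, hrot.isBasicWormhole_iff hn hy⟩
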